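/- Let $M$ be a Hausdorff, second countable smooth manifold of dimension $n$ and let $\theta=\{\theta^1,\dots,\theta^n\}$ be a coframe on $M$ (smooth $1$-forms that are linearly independent at every point). Definitions. A local equivalence of $\theta$ is a diffeomorphism $\phi$ between open subsets of $M$ with $\phi^*\theta^i=\theta^i$ for all $i$. A smooth function or form on $M$ is invariant if it is preserved by all local equivalences; $\mathrm{Inv}(\theta)$ is the set of invariant functions. The rank of $\theta$ at $p$ is the dimension of the span of $\{d_pf: f\in\mathrm{Inv}(\theta)\}$, and $\theta$ is fully regular if its rank is locally constant. $H^1_\theta(M)$ is the space of closed invariant $1$-forms modulo $\{df: f\in \mathrm{Inv}(\theta)\}$. Two points $p,q$ are locally formally equivalent if some diffeomorphism between neighbourhoods of $p$ and $q$ takes $p$ to $q$ and preserves all $f\in\mathrm{Inv}(\theta)$; $X_\theta$ is the quotient of $M$ by this relation, with the (possibly non-Hausdorff) smooth structure for which the projection $\kappa_\theta:M\to X_\theta$ is a submersion. There are smooth functions $C_{ij}^k=-C_{ji}^k$ and vector fields $F_i$ on $X_\theta$ with $$d\theta^k=\sum_{i<j}(C_{ij}^k\circ\kappa_\theta)\,\theta^i\wedge\theta^j,\qquad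 d\kappa_\theta=\sum_i (F_i\circ\kappa_\theta)\,\theta^i .$$ The classifying Lie algebroid is $A_\theta=X_\theta\times\mathbb R^n$, with standard frame $\alpha_1,\dots,\alpha_n$, bracket $[\alpha_i,\alpha_j]=-\sum_k C_{ij}^k\alpha_k$ and anchor $\alpha_i\mapsto F_i$. It acts by Lie derivatives on the line bundle $L=\wedge^{n}A_\theta\otimes\wedge^{\dim X_\theta}T^*X_\theta$. If $\mu$ is a nowhere vanishing section of $L$ and $\nabla_{\alpha_i}\mu=c_i\mu$, the form $\sum_i (c_i\circ\kappa_\theta)\theta^i$ is a closed invariant $1$-form, and its class in $H^1_\theta(M)$ is the modular class $\mathrm{mod}(\theta)$; if $L$ has no nowhere vanishing section, $\mathrm{mod}(\theta)$ is one half of the class obtained in the same way from $L\otimes L$. Proposition. Let $\theta$ be fully regular, and suppose that its Lie algebra $\mathfrak g$ of infinitesimal symmetries (smooth vector fields $\xi$ on $M$ with $\mathcal L_\xi\theta^i=0$ for all $i$) has finite dimension $k$, with basis $\xi_1,\dots,\xi_k$. Suppose that the $\mathfrak g$-orbits have the same tangent spaces as the fibers of $\kappa_\theta$: $\{\xi(p):\xi\in\mathfrak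 g\}=\ker d_p\kappa_\theta$ for all $p\in M$. Let $\mu_G$ be a smooth invariant $k$-form on $M$ that restricts to a volume form on each $\mathfrak g$-orbit. Then: 1. The modular class $\mathrm{mod}(\theta)\in H^1_\theta(M)$ exists and is well defined (independent of the choices in its definition). 2. The $1$-form $d\log|\langle\mu_G,\xi_1\wedge\dots\wedge\xi_k\rangle|$ is closed and invariant, and $$\mathrm{mod}(\theta)=-\big[\,d\log|\langle\mu_G,\xi_1\wedge\dots\wedge\xi_k\rangle|\,\big]\in H^1_\theta(M).$$ 3. If $\mathrm{mod}(\theta)=0$, then $\mathfrak g$ is unimodular, i.e. $\operatorname{tr}(\mathrm{ad}_\xi)=0$ for all $\xi\in\mathfrak g$. 4. If moreover any two points of $M$ with the same image under $\kappa_\theta$ lie on the same $\mathfrak g$-orbit (so that the fibers of $\kappa_\theta$ are exactly the $\mathfrak g$-orbits), then $\mathfrak g$ is unimodular if and only if $\mathrm{mod}(\theta)=0$. -/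

import Mathlib

open scoped Manifold ContDiff Topology
open VectorField Manifold

noncomputable section

namespace CoframeGeometry

/-! ### Vector fields, differential forms and Lie derivatives -/

section Fields

variable {n : ℕ} {M : Type*} [TopologicalSpace M] [ChartedSpace (EuclideanSpace ℝ (Fin n)) M]
  [IsManifold (𝓡 n) ∞ M]

/-- The (not necessarily smooth) vector field `V` is smooth on `U`. -/
def SmoothFieldOn (V : ∀ p : M, TangentSpace (𝓡 n) p) (U : Set M) : Prop :=
  ContMDiffOn (𝓡 n) (𝓡 n).tangent ∞ (fun p => (⟨p, V p⟩ : TangentBundle (𝓡 n) M)) U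

lemma SmoothFieldOn.contMDiffAt {V : ∀ p : M, TangentSpace (𝓡 n) p} {U : Set M} {p : M}
    (hV : SmoothFieldOn V U) (hU : IsOpen U) (hp : p ∈ U) :
    ContMDiffAt (𝓡 n) (𝓡 n).tangent ∞ (fun p => (⟨p, V p⟩ : TangentBundle (𝓡 n) M)) p :=
  ContMDiffOn.contMDiffAt hV (hU.mem_nhds hp)

lemma SmoothFieldOn.mdifferentiableAt {V : ∀ p : M, TangentSpace (𝓡 n) p} {U : Set M} {p : M}
    (hV : SmoothFieldOn V U) (hU : IsOpen U) (hp : p ∈ U) :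
    MDifferentiableAt (𝓡 n) (𝓡 n).tangent (fun p => (⟨p, V p⟩ : TangentBundle (𝓡 n) M)) p :=
  (hV.contMDiffAt hU hp).mdifferentiableAt (by simp)

lemma SmoothFieldOn.mono {V : ∀ p : M, TangentSpace (𝓡 n) p} {U U' : Set M}
    (hV : SmoothFieldOn V U) (h : U' ⊆ U) : SmoothFieldOn V U' :=
  ContMDiffOn.mono hV h

lemma SmoothFieldOn.add {V W : ∀ p : M, TangentSpace (𝓡 n) p} {U : Set M}
    (hV : SmoothFieldOn V U) (hW : SmoothFieldOn W U) : SmoothFieldOn (V + W) U :=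
  ContMDiffOn.add_section hV hW

lemma SmoothFieldOn.smul {V : ∀ p : M, TangentSpace (𝓡 n) p} {U : Set M} (a : ℝ)
    (hV : SmoothFieldOn V U) : SmoothFieldOn (a • V) U :=
  ContMDiffOn.const_smul_section hV

lemma smoothFieldOn_zero {U : Set M} :
    SmoothFieldOn (0 : ∀ p : M, TangentSpace (𝓡 n) p) U :=
  (Bundle.contMDiff_zeroSection ℝ (TangentSpace (𝓡 n) : M → Type _)).contMDiffOn

lemma SmoothFieldOn.mlieBracket {V W : ∀ p : M, TangentSpace (𝓡 n) p} {U : Set M}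
    (hV : SmoothFieldOn V U) (hW : SmoothFieldOn W U) (hU : IsOpen U) :
    SmoothFieldOn (mlieBracket (𝓡 n) V W) U := by
  intro p hp
  have : IsManifold (𝓡 n) (minSmoothness ℝ 2) M := by
    rw [minSmoothness_of_isRCLikeNormedField]; infer_instance
  have : IsManifold (𝓡 n) (((⊤ : ℕ∞) : WithTop ℕ∞) + 1) M := by simpa using ‹IsManifold (𝓡 n) ∞ M›
  exact (ContMDiffAt.mlieBracket_vectorField (n := (⊤ : ℕ∞)) (m := (⊤ : ℕ∞))
    (hV.contMDiffAt hU hp) (hW.contMDiffAt hU hp) (by simp)).contMDiffWithinAt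

lemma contMDiffOn_mvfderiv {V : ∀ p : M, TangentSpace (𝓡 n) p} {U : Set M} {f : M → ℝ}
    (hV : SmoothFieldOn V U) (hf : ContMDiffOn (𝓡 n) 𝓘(ℝ, ℝ) ∞ f U) (hU : IsOpen U) :
    ContMDiffOn (𝓡 n) 𝓘(ℝ, ℝ) ∞ (fun q => mvfderiv (𝓡 n) f q (V q)) U := by
  have h1 := hf.contMDiffOn_tangentMapWithin (m := ∞) (by simp) hU.uniqueMDiffOn
  have h2 := h1.comp hV (fun p hp => hp)
  have h3 : ContMDiffOn (𝓡 n) 𝓘(ℝ, ℝ) ∞ (fun q => (tangentMapWithin (𝓡 n) 𝓘(ℝ, ℝ) f U ⟨q, V q⟩).2) U :=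
    (contMDiff_snd_tangentBundle_modelSpace ℝ 𝓘(ℝ, ℝ)).comp_contMDiffOn h2
  refine h3.congr fun q hq => ?_
  simp only [tangentMapWithin, mfderivWithin_of_isOpen hU hq]
  rfl

lemma mvfderiv_mlieBracket {V W : ∀ p : M, TangentSpace (𝓡 n) p} {U : Set M} {f : M → ℝ}
    (hV : SmoothFieldOn V U) (hW : SmoothFieldOn W U)
    (hf : ContMDiffOn (𝓡 n) 𝓘(ℝ, ℝ) ∞ f U) (hU : IsOpen U) {p : M} (hp : p ∈ U) :
    mvfderiv (𝓡 n) f p (mlieBracket (𝓡 n) V W p) =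
      mvfderiv (𝓡 n) (fun q => mvfderiv (𝓡 n) f q (W q)) p (V p) -
        mvfderiv (𝓡 n) (fun q => mvfderiv (𝓡 n) f q (V q)) p (W p) := by
  rcases Nat.eq_zero_or_pos n with rfl | hn
  · have h : ∀ v : TangentSpace (𝓡 0) p, v = 0 := fun v =>
      Subsingleton.elim (α := EuclideanSpace ℝ (Fin 0)) v 0
    rw [h (mlieBracket (𝓡 0) V W p), h (V p), h (W p)]
    simp
  obtain ⟨v, hv⟩ : ∃ v : EuclideanSpace ℝ (Fin n), v ≠ 0 := by
    have : Nonempty (Fin n) := ⟨⟨0, hn⟩⟩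
    exact exists_ne 0
  let Z : ∀ q : M, TangentSpace (𝓡 n) q :=
    FiberBundle.extend (EuclideanSpace ℝ (Fin n)) (E := TangentSpace (𝓡 n)) (x := p) v
  have hZp : Z p = v := FiberBundle.extend_apply_self _ _
  obtain ⟨s, hs, hZs⟩ := FiberBundle.exists_contMDiffOn_extend (𝓡 n) (EuclideanSpace ℝ (Fin n))
    (V := (TangentSpace (𝓡 n) : M → Type _)) (x₀ := p) (k := ∞) v
  obtain ⟨O, hOs, hO, hpO⟩ := mem_nhds_iff.1 (Filter.inter_mem hs (hU.mem_nhds hp))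
  have hZ : SmoothFieldOn Z O := ContMDiffOn.mono hZs fun q hq => (hOs hq).1
  have hV := hV.mono fun q hq => (hOs hq).2
  have hW := hW.mono fun q hq => (hOs hq).2
  have hf := hf.mono fun q hq => (hOs hq).2
  have hfd : ∀ q ∈ O, MDifferentiableAt (𝓡 n) 𝓘(ℝ, ℝ) f q := fun q hq =>
    (hf.contMDiffAt (hO.mem_nhds hq)).mdifferentiableAt (by simp)
  have key : ∀ {A B : ∀ p : M, TangentSpace (𝓡 n) p}, SmoothFieldOn A O → SmoothFieldOn B O →
      mlieBracket (𝓡 n) A (mlieBracket (𝓡 n) B (f • Z)) p =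
        mvfderiv (𝓡 n) (fun q => mvfderiv (𝓡 n) f q (B q)) p (A p) • Z p
        + mvfderiv (𝓡 n) f p (B p) • mlieBracket (𝓡 n) A Z p
        + (mvfderiv (𝓡 n) f p (A p) • mlieBracket (𝓡 n) B Z p
        + f p • mlieBracket (𝓡 n) A (mlieBracket (𝓡 n) B Z) p) := by
    intro A B hA hB
    have e : mlieBracket (𝓡 n) B (f • Z) =ᶠ[𝓝 p]
        ((fun q => mvfderiv (𝓡 n) f q (B q)) • Z + f • mlieBracket (𝓡 n) B Z) := by
      filter_upwards [hO.mem_nhds hpO] with q hq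
      exact mlieBracket_smul_right (hfd q hq) (hZ.mdifferentiableAt hO hq)
    have hBf : MDifferentiableAt (𝓡 n) 𝓘(ℝ, ℝ) (fun q => mvfderiv (𝓡 n) f q (B q)) p :=
      ((contMDiffOn_mvfderiv hB hf hO).contMDiffAt (hO.mem_nhds hpO)).mdifferentiableAt (by simp)
    have hBZ := (hB.mlieBracket hZ hO).mdifferentiableAt hO hpO
    have hZd := hZ.mdifferentiableAt hO hpO
    rw [Filter.EventuallyEq.mlieBracket_vectorField_eq (Filter.EventuallyEq.refl _ A) e,
      mlieBracket_add_right (MDifferentiableAt.smul_section hBf hZd)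
        (MDifferentiableAt.smul_section (hfd p hpO) hBZ), mlieBracket_smul_right hBf hZd,
      mlieBracket_smul_right (hfd p hpO) hBZ]
  have : IsManifold (𝓡 n) (minSmoothness ℝ 3) M := by
    rw [minSmoothness_of_isRCLikeNormedField]; infer_instance
  have two : (minSmoothness ℝ 2 : WithTop ℕ∞) ≤ ∞ := by
    rw [minSmoothness_of_isRCLikeNormedField]; exact ENat.LEInfty.out
  have hfZ : SmoothFieldOn (f • Z) O := ContMDiffOn.smul_section hf hZ
  have hVW := hV.mlieBracket hW hO
  have J1 := leibniz_identity_mlieBracket_apply ((hV.contMDiffAt hO hpO).of_le two)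
    ((hW.contMDiffAt hO hpO).of_le two) ((hfZ.contMDiffAt hO hpO).of_le two)
  have J2 := leibniz_identity_mlieBracket_apply ((hV.contMDiffAt hO hpO).of_le two)
    ((hW.contMDiffAt hO hpO).of_le two) ((hZ.contMDiffAt hO hpO).of_le two)
  rw [key hV hW, key hW hV, mlieBracket_smul_right (hfd p hpO) (hZ.mdifferentiableAt hO hpO),
    J2] at J1
  have hz : (mvfderiv (𝓡 n) f p (mlieBracket (𝓡 n) V W p) -
      (mvfderiv (𝓡 n) (fun q => mvfderiv (𝓡 n) f q (W q)) p (V p) -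
        mvfderiv (𝓡 n) (fun q => mvfderiv (𝓡 n) f q (V q)) p (W p))) • Z p = 0 := by
    rw [← sub_eq_zero] at J1
    rw [← neg_eq_zero, ← J1]
    module
  rw [hZp] at hz
  exact sub_eq_zero.1 ((smul_eq_zero.1 hz).resolve_right hv)

/-- Differential 1-forms (not necessarily smooth). -/
def OneForm (n : ℕ) (M : Type*) [TopologicalSpace M]
    [ChartedSpace (EuclideanSpace ℝ (Fin n)) M] : Type _ :=
  ∀ p : M, TangentSpace (𝓡 n) p →L[ℝ] ℝ

instance : AddCommGroup (OneForm n M) :=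
  inferInstanceAs (AddCommGroup (∀ p : M, TangentSpace (𝓡 n) p →L[ℝ] ℝ))

instance : Module ℝ (OneForm n M) :=
  inferInstanceAs (Module ℝ (∀ p : M, TangentSpace (𝓡 n) p →L[ℝ] ℝ))

@[simp] lemma OneForm.zero_apply (p : M) (v : TangentSpace (𝓡 n) p) :
    (0 : OneForm n M) p v = 0 := rfl

@[simp] lemma OneForm.add_apply (β η : OneForm n M) (p : M) (v : TangentSpace (𝓡 n) p) :
    (β + η) p v = β p v + η p v := rfl

@[simp] lemma OneForm.smul_apply (a : ℝ) (β : OneForm n M) (p : M)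
    (v : TangentSpace (𝓡 n) p) : (a • β) p v = a * β p v := rfl

/-- The differential of a function. -/
def differential (f : M → ℝ) : OneForm n M := fun p => mvfderiv (𝓡 n) f p

/-- Smoothness of a 1-form: its values on smooth local vector fields are smooth. -/
def SmoothOneForm (β : OneForm n M) : Prop :=
  ∀ (U : Set M) (V : ∀ p : M, TangentSpace (𝓡 n) p), IsOpen U → SmoothFieldOn V U →
    ContMDiffOn (𝓡 n) 𝓘(ℝ, ℝ) ∞ (fun p => β p (V p)) U

/-- Smoothness of a `k`-form: its values on smooth local vector fields are smooth. -/
def SmoothForm {k : ℕ} (β : ∀ p : M, TangentSpace (𝓡 n) p [⋀^Fin k]→L[ℝ] ℝ) : Prop :=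
  ∀ (U : Set M) (V : Fin k → ∀ p : M, TangentSpace (𝓡 n) p), IsOpen U →
    (∀ j, SmoothFieldOn (V j) U) →
    ContMDiffOn (𝓡 n) 𝓘(ℝ, ℝ) ∞ (fun p => β p (fun j => V j p)) U

/-- The value `(L_Y β)(V)` of the Lie derivative of a 1-form,
`Y(β(V)) - β([Y, V])`, for (local) vector fields `Y`, `V`. -/
def lieDerivOneForm (β : OneForm n M)
    (Y V : ∀ p : M, TangentSpace (𝓡 n) p) (p : M) : ℝ :=
  mvfderiv (𝓡 n) (fun q => β q (V q)) p (Y p) - β p (mlieBracket (𝓡 n) Y V p)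

/-- The value `(L_Y β)(V₁, …, V_k)` of the Lie derivative of a `k`-form,
`Y(β(V₁, …, V_k)) - ∑ⱼ β(V₁, …, [Y, Vⱼ], …, V_k)`, for (local) vector fields. -/
def lieDerivForm {k : ℕ} (β : ∀ p : M, TangentSpace (𝓡 n) p [⋀^Fin k]→L[ℝ] ℝ)
    (Y : ∀ p : M, TangentSpace (𝓡 n) p) (V : Fin k → ∀ p : M, TangentSpace (𝓡 n) p)
    (p : M) : ℝ :=
  mvfderiv (𝓡 n) (fun q => β q (fun j => V j q)) p (Y p) -
    ∑ j, β p (Function.update (fun l => V l p) j (mlieBracket (𝓡 n) Y (V j) p))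

/-- The value `dβ(V, W) = V(β(W)) - W(β(V)) - β([V, W])` of the exterior derivative of a 1-form
on (local) vector fields. -/
def extDerivOneForm (β : OneForm n M)
    (V W : ∀ p : M, TangentSpace (𝓡 n) p) (p : M) : ℝ :=
  mvfderiv (𝓡 n) (fun q => β q (W q)) p (V p) - mvfderiv (𝓡 n) (fun q => β q (V q)) p (W p) -
    β p (mlieBracket (𝓡 n) V W p)

end Fields

/-! ### Coframes and their invariants -/

/-- A coframe on an `n`-dimensional manifold: `n` smooth 1-forms, everywhere linearly
independent. -/
structure Coframe (n : ℕ) (M : Type*) [TopologicalSpace M]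
    [ChartedSpace (EuclideanSpace ℝ (Fin n)) M] [IsManifold (𝓡 n) ∞ M] where
  form : Fin n → OneForm n M
  smooth : ∀ i, SmoothOneForm (form i)
  linearIndependent : ∀ p, LinearIndependent ℝ (fun i => form i p)

namespace Coframe

variable {n : ℕ} {M : Type*} [TopologicalSpace M] [ChartedSpace (EuclideanSpace ℝ (Fin n)) M]
  [IsManifold (𝓡 n) ∞ M]

/-- A local self equivalence: a diffeomorphism between open subsets of `M` preserving the
coframe. -/
def IsLocalEquivalence (θ : Coframe n M) (e : OpenPartialHomeomorph M M) : Prop :=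
  ContMDiffOn (𝓡 n) (𝓡 n) ∞ e e.source ∧ ContMDiffOn (𝓡 n) (𝓡 n) ∞ e.symm e.target ∧
    ∀ i, ∀ p ∈ e.source, ∀ v : TangentSpace (𝓡 n) p,
      θ.form i (e p) (mfderiv (𝓡 n) (𝓡 n) e p v) = θ.form i p v

/-- The invariant functions `Inv(θ)`: smooth functions preserved by all local self
equivalences. -/
def Inv (θ : Coframe n M) : Set (M → ℝ) :=
  {f | ContMDiff (𝓡 n) 𝓘(ℝ, ℝ) ∞ f ∧
    ∀ e : OpenPartialHomeomorph M M, θ.IsLocalEquivalence e → ∀ p ∈ e.source, f (e p) = f p}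

/-- The rank of `Inv(θ)` at `p`: the dimension of the span of the differentials at `p`. -/
def rank (θ : Coframe n M) (p : M) : ℕ :=
  Module.finrank ℝ (Submodule.span ℝ ((fun f : M → ℝ => mvfderiv (𝓡 n) f p) '' θ.Inv))

/-- The coframe is fully regular: the rank of `Inv(θ)` is locally constant. -/
def FullyRegular (θ : Coframe n M) : Prop :=
  ∀ p, ∀ᶠ q in 𝓝 p, θ.rank q = θ.rank p

/-! ### The Lie algebra of infinitesimal symmetries -/

/-- The symmetry algebra: smooth vector fields `ξ` on `M` with `L_ξ θⁱ = 0` for all `i`. -/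
def symmetryAlgebra (θ : Coframe n M) : Submodule ℝ (∀ p : M, TangentSpace (𝓡 n) p) where
  carrier := {ξ | SmoothFieldOn ξ Set.univ ∧
    ∀ i (U : Set M) (V : ∀ p : M, TangentSpace (𝓡 n) p), IsOpen U → SmoothFieldOn V U →
      ∀ p ∈ U, lieDerivOneForm (θ.form i) ξ V p = 0}
  zero_mem' := ⟨smoothFieldOn_zero, fun i U V _ _ p _ => by simp [lieDerivOneForm]⟩
  add_mem' := by
    rintro ξ η ⟨hξ, h1⟩ ⟨hη, h2⟩
    refine ⟨hξ.add hη, fun i U V hU hV p hp => ?_⟩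
    have h1 := h1 i U V hU hV p hp
    have h2 := h2 i U V hU hV p hp
    simp only [lieDerivOneForm] at h1 h2 ⊢
    rw [mlieBracket_add_left (hξ.mdifferentiableAt isOpen_univ trivial)
      (hη.mdifferentiableAt isOpen_univ trivial), Pi.add_apply, map_add, map_add]
    linarith
  smul_mem' := by
    rintro a ξ ⟨hξ, h1⟩
    refine ⟨hξ.smul a, fun i U V hU hV p hp => ?_⟩
    have h1 := h1 i U V hU hV p hp
    simp only [lieDerivOneForm] at h1 ⊢
    rw [mlieBracket_const_smul_left (hξ.mdifferentiableAt isOpen_univ trivial), Pi.smul_apply,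
      map_smul, map_smul, smul_eq_mul, smul_eq_mul]
    linear_combination a * h1

lemma mlieBracket_mem_symmetryAlgebra (θ : Coframe n M) {ξ η : ∀ p : M, TangentSpace (𝓡 n) p}
    (hξ : ξ ∈ θ.symmetryAlgebra) (hη : η ∈ θ.symmetryAlgebra) :
    mlieBracket (𝓡 n) ξ η ∈ θ.symmetryAlgebra := by
  obtain ⟨sξ, h1⟩ := hξ
  obtain ⟨sη, h2⟩ := hη
  refine ⟨sξ.mlieBracket sη isOpen_univ, fun i U V hU hV p hp => ?_⟩
  have sξU := sξ.mono (Set.subset_univ U)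
  have sηU := sη.mono (Set.subset_univ U)
  have : IsManifold (𝓡 n) (minSmoothness ℝ 3) M := by
    rw [minSmoothness_of_isRCLikeNormedField]; infer_instance
  have two : (minSmoothness ℝ 2 : WithTop ℕ∞) ≤ ∞ := by
    rw [minSmoothness_of_isRCLikeNormedField]; exact ENat.LEInfty.out
  have J := leibniz_identity_mlieBracket_apply ((sξU.contMDiffAt hU hp).of_le two)
    ((sηU.contMDiffAt hU hp).of_le two) ((hV.contMDiffAt hU hp).of_le two)
  have swap : ∀ {a b : ∀ p : M, TangentSpace (𝓡 n) p},
      (∀ W : ∀ p : M, TangentSpace (𝓡 n) p, SmoothFieldOn W U → ∀ q ∈ U,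
        lieDerivOneForm (θ.form i) a W q = 0) →
      (∀ W : ∀ p : M, TangentSpace (𝓡 n) p, SmoothFieldOn W U → ∀ q ∈ U,
        lieDerivOneForm (θ.form i) b W q = 0) →
      SmoothFieldOn b U →
      mvfderiv (𝓡 n) (fun q => mvfderiv (𝓡 n) (fun r => θ.form i r (V r)) q (b q)) p (a p) =
        θ.form i p (mlieBracket (𝓡 n) a (mlieBracket (𝓡 n) b V) p) := by
    intro a b ha hb sb
    have e : (fun q => mvfderiv (𝓡 n) (fun r => θ.form i r (V r)) q (b q)) =ᶠ[𝓝 p]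
        fun q => θ.form i q (mlieBracket (𝓡 n) b V q) := by
      filter_upwards [hU.mem_nhds hp] with q hq
      exact sub_eq_zero.1 (hb V hV q hq)
    have e2 : mvfderiv (𝓡 n)
        (fun q => mvfderiv (𝓡 n) (fun r => θ.form i r (V r)) q (b q)) p =
        mvfderiv (𝓡 n) (fun q => θ.form i q (mlieBracket (𝓡 n) b V q)) p := by
      ext v
      exact congrArg (fun L : EuclideanSpace ℝ (Fin n) →L[ℝ] ℝ => L v) e.mfderiv_eq
    rw [e2]
    exact sub_eq_zero.1 (ha _ (sb.mlieBracket hV hU) p hp)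
  unfold lieDerivOneForm
  rw [mvfderiv_mlieBracket sξU sηU (θ.smooth i U V hU hV) hU hp,
    swap (fun W hW q hq => h1 i U W hU hW q hq) (fun W hW q hq => h2 i U W hU hW q hq) sηU,
    swap (fun W hW q hq => h2 i U W hU hW q hq) (fun W hW q hq => h1 i U W hU hW q hq) sξU, J,
    map_add]
  ring

instance (θ : Coframe n M) : LieRing θ.symmetryAlgebra where
  bracket ξ η := ⟨mlieBracket (𝓡 n) ξ.1 η.1, θ.mlieBracket_mem_symmetryAlgebra ξ.2 η.2⟩
  add_lie ξ η ζ := by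
    refine Subtype.ext (funext fun p => ?_)
    exact mlieBracket_add_left (ξ.2.1.mdifferentiableAt isOpen_univ trivial)
      (η.2.1.mdifferentiableAt isOpen_univ trivial)
  lie_add ξ η ζ := by
    refine Subtype.ext (funext fun p => ?_)
    exact mlieBracket_add_right (η.2.1.mdifferentiableAt isOpen_univ trivial)
      (ζ.2.1.mdifferentiableAt isOpen_univ trivial)
  lie_self ξ := by
    refine Subtype.ext (funext fun p => ?_)
    exact congrFun mlieBracket_self p
  leibniz_lie ξ η ζ := by
    refine Subtype.ext (funext fun p => ?_)
    have : IsManifold (𝓡 n) (minSmoothness ℝ 3) M := by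
      rw [minSmoothness_of_isRCLikeNormedField]; infer_instance
    have two : (minSmoothness ℝ 2 : WithTop ℕ∞) ≤ ∞ := by
      rw [minSmoothness_of_isRCLikeNormedField]; exact ENat.LEInfty.out
    exact leibniz_identity_mlieBracket_apply
      ((ξ.2.1.contMDiffAt isOpen_univ trivial).of_le two)
      ((η.2.1.contMDiffAt isOpen_univ trivial).of_le two)
      ((ζ.2.1.contMDiffAt isOpen_univ trivial).of_le two)

instance (θ : Coframe n M) : LieAlgebra ℝ θ.symmetryAlgebra where
  lie_smul a ξ η := by
    refine Subtype.ext (funext fun p => ?_)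
    exact mlieBracket_const_smul_right (η.2.1.mdifferentiableAt isOpen_univ trivial)

/-- The symmetry algebra is unimodular: `tr (ad ξ) = 0` for every `ξ`. -/
def Unimodular (θ : Coframe n M) : Prop :=
  ∀ ξ : θ.symmetryAlgebra, LinearMap.trace ℝ θ.symmetryAlgebra (LieAlgebra.ad ℝ _ ξ) = 0

/-- The tangent space at `p` of the orbit of the symmetry algebra through `p`. -/
def orbitTangent (θ : Coframe n M) (p : M) : Submodule ℝ (TangentSpace (𝓡 n) p) :=
  θ.symmetryAlgebra.map (LinearMap.proj p)

/-- `p` and `q` lie on the same orbit of the symmetry algebra: they are joined by a finite chain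
of integral curves of infinitesimal symmetries. -/
def SameOrbit (θ : Coframe n M) : M → M → Prop :=
  Relation.ReflTransGen fun p q => ∃ ξ ∈ θ.symmetryAlgebra, ∃ γ : ℝ → M,
    IsMIntegralCurveOn γ ξ (Set.Icc 0 1) ∧ γ 0 = p ∧ γ 1 = q

/-- The vectors annihilated by the differentials of all invariant functions, i.e. the kernel
at `p` of the differential of the classifying map. -/
def classifyingKernel (θ : Coframe n M) (p : M) : Submodule ℝ (TangentSpace (𝓡 n) p) where
  carrier := {v | ∀ f ∈ θ.Inv, mvfderiv (𝓡 n) f p v = 0}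
  zero_mem' := fun f _ => map_zero _
  add_mem' := fun hv hw f hf => by rw [map_add, hv f hf, hw f hf, add_zero]
  smul_mem' := fun a v hv f hf => by rw [map_smul, hv f hf, smul_zero]

/-! ### Invariant forms and the first invariant cohomology -/

/-- A `k`-form invariant under all local self equivalences. -/
def IsInvariantForm (θ : Coframe n M) {k : ℕ}
    (β : ∀ p : M, TangentSpace (𝓡 n) p [⋀^Fin k]→L[ℝ] ℝ) : Prop :=
  ∀ e : OpenPartialHomeomorph M M, θ.IsLocalEquivalence e → ∀ p ∈ e.source,
    ∀ v : Fin k → TangentSpace (𝓡 n) p,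
      β (e p) (fun j => mfderiv (𝓡 n) (𝓡 n) e p (v j)) = β p v

/-- The closed invariant (smooth) 1-forms. -/
def closedInvariant (θ : Coframe n M) :
    Submodule ℝ (OneForm n M) where
  carrier := {β | SmoothOneForm β ∧
    (∀ e : OpenPartialHomeomorph M M, θ.IsLocalEquivalence e → ∀ p ∈ e.source,
      ∀ v : TangentSpace (𝓡 n) p, β (e p) (mfderiv (𝓡 n) (𝓡 n) e p v) = β p v) ∧
    ∀ (U : Set M) (V W : ∀ p : M, TangentSpace (𝓡 n) p), IsOpen U → SmoothFieldOn V U →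
      SmoothFieldOn W U → ∀ p ∈ U, extDerivOneForm β V W p = 0}
  zero_mem' := by
    refine ⟨fun U V _ _ => contMDiffOn_const, fun e _ p _ v => rfl, fun U V W _ _ _ p _ => ?_⟩
    simp [extDerivOneForm, mvfderiv_const]
  add_mem' := by
    rintro β η ⟨hβ, h1, h2⟩ ⟨hη, k1, k2⟩
    refine ⟨fun U V hU hV => (hβ U V hU hV).add (hη U V hU hV), fun e he p hp v => ?_,
      fun U V W hU hV hW p hp => ?_⟩
    · simp only [OneForm.add_apply, h1 e he p hp v, k1 e he p hp v]
    · have h2 := h2 U V W hU hV hW p hp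
      have k2 := k2 U V W hU hV hW p hp
      have d : ∀ {α : OneForm n M} {Z : ∀ p : M, TangentSpace (𝓡 n) p},
          SmoothOneForm α → SmoothFieldOn Z U →
          MDifferentiableAt (𝓡 n) 𝓘(ℝ, ℝ) (fun q => α q (Z q)) p := fun hα hZ =>
        ((hα U _ hU hZ).contMDiffAt (hU.mem_nhds hp)).mdifferentiableAt (by simp)
      simp only [extDerivOneForm, OneForm.add_apply] at h2 k2 ⊢
      rw [mvfderiv_fun_add (d hβ hW) (d hη hW), mvfderiv_fun_add (d hβ hV) (d hη hV)]
      simp only [_root_.add_apply]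
      linear_combination h2 + k2
  smul_mem' := by
    rintro a β ⟨hβ, h1, h2⟩
    refine ⟨fun U V hU hV => (contMDiff_const (c := a)).contMDiffOn.mul (hβ U V hU hV), fun e he p hp v => ?_,
      fun U V W hU hV hW p hp => ?_⟩
    · simp only [OneForm.smul_apply, h1 e he p hp v]
    · have h2 := h2 U V W hU hV hW p hp
      have d : ∀ {Z : ∀ p : M, TangentSpace (𝓡 n) p}, SmoothFieldOn Z U →
          MDifferentiableAt (𝓡 n) 𝓘(ℝ, ℝ) (fun q => β q (Z q)) p := fun hZ =>
        ((hβ U _ hU hZ).contMDiffAt (hU.mem_nhds hp)).mdifferentiableAt (by simp)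
      simp only [extDerivOneForm, OneForm.smul_apply] at h2 ⊢
      rw [mvfderiv_fun_mul mdifferentiableAt_const (d hW),
        mvfderiv_fun_mul mdifferentiableAt_const (d hV)]
      simp only [mvfderiv_const, smul_zero, add_zero, _root_.smul_apply, smul_eq_mul]
      linear_combination a * h2

/-- The exact ones: differentials of invariant functions. -/
def exactInvariant (θ : Coframe n M) : Submodule ℝ θ.closedInvariant where
  carrier := {β | ∃ f ∈ θ.Inv, ∀ p, β.1 p = mvfderiv (𝓡 n) f p}
  zero_mem' := ⟨0, ⟨contMDiff_const, fun _ _ _ _ => rfl⟩, fun p => by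
    rw [mvfderiv_zero]; rfl⟩
  add_mem' := by
    rintro β η ⟨f, hf, h1⟩ ⟨g, hg, h2⟩
    refine ⟨f + g, ⟨hf.1.add hg.1, fun e he p hp => ?_⟩, fun p => ?_⟩
    · simp only [Pi.add_apply, hf.2 e he p hp, hg.2 e he p hp]
    · rw [mvfderiv_add (hf.1.mdifferentiable (by simp) p) (hg.1.mdifferentiable (by simp) p),
        ← h1 p, ← h2 p]
      rfl
  smul_mem' := by
    rintro a β ⟨f, hf, h1⟩
    refine ⟨fun p => a * f p, ⟨contMDiff_const.mul hf.1, fun e he p hp => ?_⟩, fun p => ?_⟩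
    · simp only [hf.2 e he p hp]
    · rw [mvfderiv_fun_mul mdifferentiableAt_const (hf.1.mdifferentiable (by simp) p),
        ← h1 p, mvfderiv_const, smul_zero, add_zero]
      rfl

/-- The first invariant cohomology `H¹_θ(M)`. -/
abbrev H1 (θ : Coframe n M) : Type _ := θ.closedInvariant ⧸ θ.exactInvariant

/-- The class in `H¹_θ(M)` of a closed invariant 1-form. -/
def cohomologyClass (θ : Coframe n M) (β : OneForm n M)
    (h : β ∈ θ.closedInvariant) : θ.H1 :=
  Submodule.Quotient.mk ⟨β, h⟩

/-! ### The classifying manifold -/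

/-- Local formal equivalence of points: some diffeomorphism between open neighbourhoods of `p`
and `q`, mapping `p` to `q`, preserves all invariant functions. -/
def FormallyEquivalent (θ : Coframe n M) (p q : M) : Prop :=
  ∃ e : OpenPartialHomeomorph M M,
    ContMDiffOn (𝓡 n) (𝓡 n) ∞ e e.source ∧ ContMDiffOn (𝓡 n) (𝓡 n) ∞ e.symm e.target ∧
    p ∈ e.source ∧ e p = q ∧ ∀ p' ∈ e.source, ∀ f ∈ θ.Inv, f (e p') = f p'

/-- Local formal equivalence is an equivalence relation. -/
def formalSetoid (θ : Coframe n M) : Setoid M where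
  r := θ.FormallyEquivalent
  iseqv := by
    refine ⟨fun p => ?_, ?_, ?_⟩
    · exact ⟨OpenPartialHomeomorph.refl M, contMDiffOn_id, contMDiffOn_id, trivial, rfl,
        fun _ _ _ _ => rfl⟩
    · rintro p q ⟨e, h1, h2, hp, rfl, h⟩
      refine ⟨e.symm, h2, by simpa using h1, e.map_source hp, e.left_inv hp, fun q' hq' f hf => ?_⟩
      have := h (e.symm q') (e.map_target hq') f hf
      rw [e.right_inv hq'] at this
      exact this.symm
    · rintro p q r ⟨e, h1, h2, hp, rfl, h⟩ ⟨e', h1', h2', hp', rfl, h'⟩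
      refine ⟨e.trans e', ?_, ?_, ?_, rfl, fun p' hp' f hf => ?_⟩
      · rw [OpenPartialHomeomorph.trans_source]
        exact h1'.comp (h1.mono Set.inter_subset_left) fun x hx => hx.2
      · rw [OpenPartialHomeomorph.trans_target]
        exact h2.comp (h2'.mono Set.inter_subset_left) fun x hx => hx.2
      · rw [OpenPartialHomeomorph.trans_source]
        exact ⟨hp, hp'⟩
      · rw [OpenPartialHomeomorph.trans_source] at hp'
        exact (h' (e p') hp'.2 f hf).trans (h p' hp'.1 f hf)

/-- The classifying space `X_θ`, the quotient of `M` by local formal equivalence. -/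
def ClassifyingSpace (θ : Coframe n M) : Type _ := Quotient θ.formalSetoid

instance (θ : Coframe n M) : TopologicalSpace θ.ClassifyingSpace :=
  inferInstanceAs (TopologicalSpace (Quotient θ.formalSetoid))

/-- The classifying map `κ_θ : M → X_θ`. -/
def classifyingMap (θ : Coframe n M) : M → θ.ClassifyingSpace := Quotient.mk θ.formalSetoid

end Coframe

/-! ### Realizations, their Lie algebroids and modular cocycles -/

/-- The initial data of a realization problem over a `d`-dimensional manifold `X`: functions
`C i j k` (skew in `i`, `j`) and vector fields `F i`. They define on the trivial bundle
`A = X × ℝⁿ`, with its standard frame `α₁, …, αₙ`, the bracket `[αᵢ, αⱼ] = -∑ₖ C i j k αₖ` and the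
anchor `♯αᵢ = F i`. -/
structure RealizationData (n d : ℕ) (X : Type*) [TopologicalSpace X]
    [ChartedSpace (EuclideanSpace ℝ (Fin d)) X] [IsManifold (𝓡 d) ∞ X] where
  C : Fin n → Fin n → Fin n → X → ℝ
  F : Fin n → ∀ x : X, TangentSpace (𝓡 d) x
  skew : ∀ i j k x, C i j k x = -C j i k x
  smooth_C : ∀ i j k, ContMDiff (𝓡 d) 𝓘(ℝ, ℝ) ∞ (C i j k)
  smooth_F : ∀ i, SmoothFieldOn (F i) Set.univ

namespace RealizationData

variable {n d : ℕ} {X : Type*} [TopologicalSpace X]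
  [ChartedSpace (EuclideanSpace ℝ (Fin d)) X] [IsManifold (𝓡 d) ∞ X]

/-- `(M, θ, h)` solves the realization problem:
`dθᵏ = ∑_{i<j} (C i j k ∘ h) θⁱ ∧ θʲ` and `dh = ∑ᵢ (F i ∘ h) θⁱ`. -/
def IsRealization (D : RealizationData n d X) {M : Type*} [TopologicalSpace M]
    [ChartedSpace (EuclideanSpace ℝ (Fin n)) M] [IsManifold (𝓡 n) ∞ M]
    (θ : Coframe n M) (h : M → X) : Prop :=
  ContMDiff (𝓡 n) (𝓡 d) ∞ h ∧
  (∀ k (U : Set M) (V W : ∀ p : M, TangentSpace (𝓡 n) p), IsOpen U → SmoothFieldOn V U →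
    SmoothFieldOn W U → ∀ p ∈ U, extDerivOneForm (θ.form k) V W p =
      ∑ i, ∑ j ∈ Finset.Ioi i, D.C i j k (h p) *
        (θ.form i p (V p) * θ.form j p (W p) - θ.form i p (W p) * θ.form j p (V p))) ∧
  ∀ p (v : TangentSpace (𝓡 n) p),
    mfderiv (𝓡 n) (𝓡 d) h p v = ∑ i, θ.form i p v • D.F i (h p)

/-- `L_{αᵢ}(α₁ ∧ ⋯ ∧ αₙ) = ∑ⱼ α₁ ∧ ⋯ ∧ [αᵢ, αⱼ] ∧ ⋯ ∧ αₙ` is this function times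
`α₁ ∧ ⋯ ∧ αₙ`. -/
def topWeight (D : RealizationData n d X) (i : Fin n) (x : X) : ℝ :=
  ∑ j, -D.C i j j x

/-- Since `α₁ ∧ ⋯ ∧ αₙ` is a global frame of `⋀ⁿ A`, the sections of `L_A = ⋀ⁿ A ⊗ ⋀ᵈ T*X` are the
`(α₁ ∧ ⋯ ∧ αₙ) ⊗ ν` with `ν` a `d`-form on `X`. This says that the section given by `ν` is smooth
and vanishes nowhere. -/
def IsNonvanishingSection (ν : ∀ x : X, TangentSpace (𝓡 d) x [⋀^Fin d]→L[ℝ] ℝ) : Prop :=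
  SmoothForm ν ∧ ∀ x, ν x ≠ 0

/-- The `A`-form with components `c i = ⟨c, αᵢ⟩` is the modular cocycle of the section
`μ = (α₁ ∧ ⋯ ∧ αₙ) ⊗ ν` of `L_A`: for all `i`,
`∇_{αᵢ} μ = L_{αᵢ}(α₁ ∧ ⋯ ∧ αₙ) ⊗ ν + (α₁ ∧ ⋯ ∧ αₙ) ⊗ L_{F i} ν = c i • μ`. -/
def IsModularCocycle (D : RealizationData n d X)
    (ν : ∀ x : X, TangentSpace (𝓡 d) x [⋀^Fin d]→L[ℝ] ℝ) (c : Fin n → X → ℝ) : Prop :=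
  (∀ i, ContMDiff (𝓡 d) 𝓘(ℝ, ℝ) ∞ (c i)) ∧
  ∀ i (U : Set X) (V : Fin d → ∀ x : X, TangentSpace (𝓡 d) x), IsOpen U →
    (∀ j, SmoothFieldOn (V j) U) → ∀ x ∈ U,
      D.topWeight i x * ν x (fun j => V j x) + lieDerivForm ν (D.F i) V x =
        c i x * ν x (fun j => V j x)

/-- A section `(α₁ ∧ ⋯ ∧ αₙ)² ⊗ σ` of `L_A ⊗ L_A`, with `σ` a section of `⋀ᵈ T*X ⊗ ⋀ᵈ T*X`, viewed
as a function of `2d` vectors alternating in the first `d` and in the last `d`, is smooth and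
vanishes nowhere. -/
def IsNonvanishingSquareSection
    (σ : ∀ x : X, TangentSpace (𝓡 d) x [⋀^Fin d]→ₗ[ℝ]
      (TangentSpace (𝓡 d) x [⋀^Fin d]→ₗ[ℝ] ℝ)) : Prop :=
  (∀ (U : Set X) (V W : Fin d → ∀ x : X, TangentSpace (𝓡 d) x), IsOpen U →
    (∀ j, SmoothFieldOn (V j) U) → (∀ j, SmoothFieldOn (W j) U) →
    ContMDiffOn (𝓡 d) 𝓘(ℝ, ℝ) ∞ (fun x => σ x (fun j => V j x) (fun j => W j x)) U) ∧
  ∀ x, σ x ≠ 0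

/-- The analogue of `IsModularCocycle` for the induced connection on `L_A ⊗ L_A`. -/
def IsSquareModularCocycle (D : RealizationData n d X)
    (σ : ∀ x : X, TangentSpace (𝓡 d) x [⋀^Fin d]→ₗ[ℝ]
      (TangentSpace (𝓡 d) x [⋀^Fin d]→ₗ[ℝ] ℝ)) (c : Fin n → X → ℝ) : Prop :=
  (∀ i, ContMDiff (𝓡 d) 𝓘(ℝ, ℝ) ∞ (c i)) ∧
  ∀ i (U : Set X) (V W : Fin d → ∀ x : X, TangentSpace (𝓡 d) x), IsOpen U →
    (∀ j, SmoothFieldOn (V j) U) → (∀ j, SmoothFieldOn (W j) U) → ∀ x ∈ U,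
      2 * D.topWeight i x * σ x (fun j => V j x) (fun j => W j x) +
        (mvfderiv (𝓡 d) (fun y => σ y (fun j => V j y) (fun j => W j y)) x (D.F i x) -
          ∑ l, σ x (Function.update (fun j => V j x) l (mlieBracket (𝓡 d) (D.F i) (V l) x))
            (fun j => W j x) -
          ∑ l, σ x (fun j => V j x)
            (Function.update (fun j => W j x) l (mlieBracket (𝓡 d) (D.F i) (W l) x))) =
        c i x * σ x (fun j => V j x) (fun j => W j x)

end RealizationData

namespace Coframe

variable {n : ℕ} {M : Type*} [TopologicalSpace M] [ChartedSpace (EuclideanSpace ℝ (Fin n)) M]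
  [IsManifold (𝓡 n) ∞ M]

/-- The pullback `θ*c = ∑ᵢ (c i ∘ h) θⁱ` of an `A`-form along `θ : TM → A` (over `h`). -/
def pullbackForm (θ : Coframe n M) {X : Type*} (h : M → X) (c : Fin n → X → ℝ) :
    OneForm n M :=
  fun p => ∑ i, c i (h p) • θ.form i p

/-- `m` is the modular class of the coframe. The classifying space carries its natural smooth
structure (the one for which `κ_θ` is a submersion) and `D` is the initial data, i.e. the
classifying Lie algebroid `A_θ`, of which `(M, θ, κ_θ)` is a realization; `m` corresponds under
`θ*` to the class of a modular cocycle of `A_θ`, or, if `L_A` has no nowhere vanishing section,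
to one half of the class of a cocycle relative to a section of `L_A ⊗ L_A`. -/
def IsModularClass (θ : Coframe n M) (m : θ.H1) : Prop :=
  ∃ (d : ℕ) (_ : ChartedSpace (EuclideanSpace ℝ (Fin d)) θ.ClassifyingSpace)
    (_ : IsManifold (𝓡 d) ∞ θ.ClassifyingSpace) (D : RealizationData n d θ.ClassifyingSpace),
    IsSubmersion (𝓡 n) (𝓡 d) ∞ θ.classifyingMap ∧ D.IsRealization θ θ.classifyingMap ∧
    ((∃ ν c, RealizationData.IsNonvanishingSection (d := d) ν ∧ D.IsModularCocycle ν c ∧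
        ∃ h : θ.pullbackForm θ.classifyingMap c ∈ θ.closedInvariant,
          m = θ.cohomologyClass _ h) ∨
      ((¬ ∃ ν : ∀ x : θ.ClassifyingSpace, TangentSpace (𝓡 d) x [⋀^Fin d]→L[ℝ] ℝ,
          RealizationData.IsNonvanishingSection ν) ∧
        ∃ σ c, RealizationData.IsNonvanishingSquareSection (d := d) σ ∧
          D.IsSquareModularCocycle σ c ∧
          ∃ h : θ.pullbackForm θ.classifyingMap c ∈ θ.closedInvariant,
            m = (1 / 2 : ℝ) • θ.cohomologyClass _ h))

open Classical in
/-- The modular class `mod(θ) ∈ H¹_θ(M)`. -/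
def modularClass (θ : Coframe n M) : θ.H1 :=
  if h : ∃ m, θ.IsModularClass m then h.choose else 0

end Coframe

end CoframeGeometry

end

/-! Everything rests on the function f = ⟨μ_G, ξ₁ ∧ … ∧ ξ_k⟩. A volume on the orbits forces the ξⱼ
to be pointwise independent, so f vanishes nowhere and ker dκ has constant dimension k.

Modular class. Contract the coframe volume θ¹ ∧ … ∧ θⁿ with ξ₁, …, ξ_k. The resulting (n - k)-form T
is killed by the orbit directions, that is, by ker dκ. Moreover T / f has invariant components: a
local equivalence maps the ξⱼ to another basis of the same kernel, which rescales T and f by the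
same determinant (`transverseForm_div_mem_Inv`). Hence T / f is the pullback of a nowhere zero top
form ν on X_θ (`exists_descended_form`), and the L ⊗ L alternative never occurs. The dual frame
field Eᵢ is κ-related to Fᵢ and commutes with the ξⱼ, so L_{Eᵢ} T = (∑ₗ C_il^l) T. This trace
cancels the action of αᵢ on ⋀ⁿ A, and ∇_{αᵢ} μ = -Eᵢ(log |f|) μ remains (`exists_modularCocycle`).
Over any compatible structure on X_θ, another section is g ν, and its cocycle differs by d log |g ∘
κ| (`pullbackForm_sub_exact`); so every choice gives -[d log |f|]. Although f itself need not be
invariant, its logarithmic differential is: the Leibniz rule for T = (T / f) f expresses Eᵢ(f) / f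
through invariant functions (`logarithmic_derivative_mem_Inv`).

Unimodularity. A symmetry η kills the frame components of μ_G, which are invariant functions, so
only the arguments ξⱼ are differentiated and η(f) = tr(ad_η) f (`mvfderiv_orbitVolume`). If d log
|f| = dh with h invariant, then tr(ad_η) = η(h) = 0. Conversely, unimodularity makes f constant
along orbits; if the fibers of κ are orbits, log |f| is invariant and the class is zero.

Smooth structure. Because ker dκ has constant dimension, invariant functions with independent
differentials complete to coordinates in which all invariant functions depend on the first factor
only (`exists_slice`, `Inv.apply_point`). Translations along the second factor are formal
equivalences, so the first factor gives charts of X_θ. -/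

set_option linter.unusedSectionVars false

noncomputable section

namespace CoframeGeometry

/-! ### Calculus of functions and determinants on a manifold -/

section Calculus

variable {n d : ℕ} {M : Type*} [TopologicalSpace M] [ChartedSpace (EuclideanSpace ℝ (Fin n)) M]
  [IsManifold (𝓡 n) ∞ M]
  {X : Type*} [TopologicalSpace X] [ChartedSpace (EuclideanSpace ℝ (Fin d)) X]
  [IsManifold (𝓡 d) ∞ X]

lemma mdifferentiableAt_of_contMDiffOn {F : Type*} [NormedAddCommGroup F] [NormedSpace ℝ F]
    {f : M → F} {U : Set M} {p : M}
    (hf : ContMDiffOn (𝓡 n) 𝓘(ℝ, F) ∞ f U) (hU : IsOpen U) (hp : p ∈ U) :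
    MDifferentiableAt (𝓡 n) 𝓘(ℝ, F) f p :=
  (hf.contMDiffAt (hU.mem_nhds hp)).mdifferentiableAt (by simp)

lemma mvfderiv_congr {F : Type*} [NormedAddCommGroup F] [NormedSpace ℝ F] {f g : M → F} {p : M}
    (h : f =ᶠ[𝓝 p] g) : mvfderiv (𝓡 n) f p = mvfderiv (𝓡 n) g p := by
  ext v
  exact congrArg (fun L : EuclideanSpace ℝ (Fin n) →L[ℝ] F => L v) h.mfderiv_eq

/-- A curve through `p` along which functions are differentiated in the direction `v`. -/
lemma exists_hasDerivAt_mvfderiv (p : M) (v : TangentSpace (𝓡 n) p) :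
    ∃ γ : ℝ → M, γ 0 = p ∧ ∀ f : M → ℝ, MDifferentiableAt (𝓡 n) 𝓘(ℝ, ℝ) f p →
      HasDerivAt (fun t => f (γ t)) (mvfderiv (𝓡 n) f p v) 0 := by
  let w : EuclideanSpace ℝ (Fin n) := v
  -- The curve is a straight line in the chart at p.
  refine ⟨fun t => (extChartAt (𝓡 n) p).symm (extChartAt (𝓡 n) p p + t • w), by simp,
    fun f hf => ?_⟩
  have h1 : HasFDerivAt (writtenInExtChartAt (𝓡 n) 𝓘(ℝ, ℝ) p f)
      (mfderiv (𝓡 n) 𝓘(ℝ, ℝ) f p : EuclideanSpace ℝ (Fin n) →L[ℝ] ℝ) (extChartAt (𝓡 n) p p) := by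
    have := hf.hasMFDerivAt.2
    rw [show Set.range (𝓡 n) = Set.univ by simp] at this
    exact hasFDerivWithinAt_univ.1 this
  have h2 : HasDerivAt (fun t : ℝ => extChartAt (𝓡 n) p p + t • w) w 0 := by
    simpa using ((hasDerivAt_id (0 : ℝ)).smul_const w).const_add (extChartAt (𝓡 n) p p)
  exact HasFDerivAt.comp_hasDerivAt_of_eq (0 : ℝ) h1 h2 (by simp)

lemma mvfderiv_fun_mul_apply {f g : M → ℝ} {p : M}
    (hf : MDifferentiableAt (𝓡 n) 𝓘(ℝ, ℝ) f p) (hg : MDifferentiableAt (𝓡 n) 𝓘(ℝ, ℝ) g p)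
    (v : TangentSpace (𝓡 n) p) :
    mvfderiv (𝓡 n) (fun q => f q * g q) p v =
      f p * mvfderiv (𝓡 n) g p v + g p * mvfderiv (𝓡 n) f p v := by
  rw [mvfderiv_fun_mul hf hg]
  rfl

/-- The derivative of a composition with a differentiable function of one variable. -/
lemma mvfderiv_comp_deriv {φ : ℝ → ℝ} {φ' : ℝ} {f : M → ℝ} {p : M}
    (hφ : HasDerivAt φ φ' (f p)) (hf : MDifferentiableAt (𝓡 n) 𝓘(ℝ, ℝ) f p)
    (v : TangentSpace (𝓡 n) p) :
    mvfderiv (𝓡 n) (fun q => φ (f q)) p v = φ' * mvfderiv (𝓡 n) f p v := by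
  obtain ⟨γ, h0, hγ⟩ := exists_hasDerivAt_mvfderiv p v
  have h1 : MDifferentiableAt (𝓡 n) 𝓘(ℝ, ℝ) (fun q => φ (f q)) p :=
    MDifferentiableAt.comp (I' := 𝓘(ℝ, ℝ)) p hφ.differentiableAt.mdifferentiableAt hf
  refine (hγ _ h1).unique ?_
  have h2 := hγ f hf
  exact HasDerivAt.comp (h := fun t => f (γ t)) (0 : ℝ) (by rw [h0]; exact hφ) h2

/-- The derivative of a determinant, row by row. -/
lemma hasDerivAt_det {ι : Type*} [Fintype ι] [DecidableEq ι] {N : ℝ → Matrix ι ι ℝ}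
    {N' : Matrix ι ι ℝ} {t : ℝ} (h : ∀ i j, HasDerivAt (fun s => N s i j) (N' i j) t) :
    HasDerivAt (fun s => (N s).det) (∑ j, ((N t).updateRow j (N' j)).det) t := by
  -- After transposition the Leibniz expansion runs over the entries N i (τ i), so the product rule
  -- groups terms by rows.
  have h1 : HasDerivAt (fun s => (N s).transpose.det)
      (∑ τ : Equiv.Perm ι, ((Equiv.Perm.sign τ : ℤ) : ℝ) *
        ∑ j, (∏ i ∈ Finset.univ.erase j, N t i (τ i)) • N' j (τ j)) t := by
    simp only [Matrix.det_apply', Matrix.transpose_apply]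
    refine HasDerivAt.fun_sum fun τ _ => HasDerivAt.const_mul _ ?_
    exact HasDerivAt.fun_finsetProd fun i _ => h i (τ i)
  simp only [Matrix.det_transpose] at h1
  refine h1.congr_deriv ?_
  have h2 : ∀ j, ((N t).updateRow j (N' j)).det = ∑ τ : Equiv.Perm ι,
      ((Equiv.Perm.sign τ : ℤ) : ℝ) * ((∏ i ∈ Finset.univ.erase j, N t i (τ i)) * N' j (τ j)) := by
    intro j
    rw [← Matrix.det_transpose, Matrix.det_apply']
    refine Finset.sum_congr rfl fun τ _ => ?_
    rw [← Finset.prod_erase_mul _ _ (Finset.mem_univ j)]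
    congr 2
    · refine Finset.prod_congr rfl fun i hi => ?_
      simp [Matrix.updateRow_apply, (Finset.mem_erase.1 hi).1]
    · simp [Matrix.updateRow_apply]
  simp_rw [h2, Finset.mul_sum, smul_eq_mul]
  rw [Finset.sum_comm]

lemma contMDiffOn_det {ι : Type*} [Fintype ι] [DecidableEq ι] {N : M → Matrix ι ι ℝ} {U : Set M}
    (h : ∀ i j, ContMDiffOn (𝓡 n) 𝓘(ℝ, ℝ) ∞ (fun p => N p i j) U) :
    ContMDiffOn (𝓡 n) 𝓘(ℝ, ℝ) ∞ (fun p => (N p).det) U := by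
  simp only [Matrix.det_apply']
  exact contMDiffOn_finsetSum fun τ _ => contMDiffOn_const.mul
    (contMDiffOn_finsetProd fun i _ => h _ _)

/-- Reduces to one variable along a curve with velocity v. -/
lemma mvfderiv_det {ι : Type*} [Fintype ι] [DecidableEq ι] {N : M → Matrix ι ι ℝ} {U : Set M}
    (hU : IsOpen U) {p : M} (hp : p ∈ U)
    (h : ∀ i j, ContMDiffOn (𝓡 n) 𝓘(ℝ, ℝ) ∞ (fun p => N p i j) U) (v : TangentSpace (𝓡 n) p) :
    mvfderiv (𝓡 n) (fun q => (N q).det) p v =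
      ∑ j, ((N p).updateRow j (fun i => mvfderiv (𝓡 n) (fun q => N q j i) p v)).det := by
  obtain ⟨γ, h0, hγ⟩ := exists_hasDerivAt_mvfderiv p v
  refine (hγ _ (mdifferentiableAt_of_contMDiffOn (contMDiffOn_det h) hU hp)).unique ?_
  have := hasDerivAt_det (N := fun t => N (γ t)) (t := 0)
    (N' := Matrix.of fun j i => mvfderiv (𝓡 n) (fun q => N q j i) p v)
    fun i j => hγ _ (mdifferentiableAt_of_contMDiffOn (h i j) hU hp)
  simp only [h0] at this
  exact this

/-- Differentiating each row of a determinant by a fixed endomorphism multiplies it by the trace. -/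
lemma sum_det_updateRow_mul {ι : Type*} [Fintype ι] [DecidableEq ι] (N C : Matrix ι ι ℝ) :
    ∑ j, (N.updateRow j ((N * C) j)).det = C.trace * N.det := by
  -- Cramer's rule. The sum then becomes a trace, and cyclicity brings N.adjugate next to N.
  have h : ∀ j, (N.updateRow j ((N * C) j)).det = (N * C * N.adjugate) j j := by
    intro j
    rw [← Matrix.cramer_transpose_apply, Matrix.cramer_eq_adjugate_mulVec,
      ← Matrix.adjugate_transpose, Matrix.mulVec_transpose]
    rfl
  simp_rw [h]
  change Matrix.trace (N * C * N.adjugate) = _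
  rw [Matrix.trace_mul_comm, ← Matrix.mul_assoc, Matrix.adjugate_mul, Matrix.smul_mul,
    Matrix.one_mul, Matrix.trace_smul, smul_eq_mul, mul_comm]

/-- The entries of the inverse are cofactors divided by the determinant. -/
lemma contMDiffOn_inv_matrix {ι : Type*} [Fintype ι] [DecidableEq ι] {N : M → Matrix ι ι ℝ}
    {U : Set M} (h : ∀ i j, ContMDiffOn (𝓡 n) 𝓘(ℝ, ℝ) ∞ (fun p => N p i j) U)
    (hN : ∀ p ∈ U, (N p).det ≠ 0) (i j : ι) :
    ContMDiffOn (𝓡 n) 𝓘(ℝ, ℝ) ∞ (fun p => (N p)⁻¹ i j) U := by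
  simp only [Matrix.inv_def, Ring.inverse_eq_inv', Matrix.smul_apply, smul_eq_mul,
    Matrix.adjugate_apply]
  refine ((contMDiffOn_det h).inv₀ hN).mul (contMDiffOn_det fun a b => ?_)
  by_cases hb : a = j
  · subst hb
    simpa using contMDiffOn_const
  · simpa [Matrix.updateRow_apply, hb] using h a b

end Calculus

/-! ### Related vector fields, submersions and local frames -/

section Fields

variable {n d : ℕ} {M : Type*} [TopologicalSpace M] [ChartedSpace (EuclideanSpace ℝ (Fin n)) M]
  [IsManifold (𝓡 n) ∞ M]
  {X : Type*} [TopologicalSpace X] [ChartedSpace (EuclideanSpace ℝ (Fin d)) X]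
  [IsManifold (𝓡 d) ∞ X]

/-- A chart, as a vector-valued function, has injective derivative. -/
lemma mvfderiv_extChartAt_injective (p : M) :
    Function.Injective (mvfderiv (𝓡 n) (extChartAt (𝓡 n) p : M → EuclideanSpace ℝ (Fin n)) p) := by
  have h := isInvertible_mfderiv_extChartAt (I := 𝓡 n) (mem_extChartAt_source (I := 𝓡 n) p)
  obtain ⟨L, hL⟩ := h
  intro v w hvw
  apply L.injective
  have h1 : mfderiv (𝓡 n) 𝓘(ℝ, EuclideanSpace ℝ (Fin n)) (extChartAt (𝓡 n) p) p v =
    mfderiv (𝓡 n) 𝓘(ℝ, EuclideanSpace ℝ (Fin n)) (extChartAt (𝓡 n) p) p w := hvw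
  rw [← hL] at h1
  exact h1

/-- A vector-valued function is differentiated component by component. -/
lemma mvfderiv_comp_continuousLinearMap {F F' : Type*} [NormedAddCommGroup F] [NormedSpace ℝ F]
    [NormedAddCommGroup F'] [NormedSpace ℝ F'] (L : F →L[ℝ] F') {f : M → F} {p : M}
    (hf : MDifferentiableAt (𝓡 n) 𝓘(ℝ, F) f p) (v : TangentSpace (𝓡 n) p) :
    mvfderiv (𝓡 n) (fun q => L (f q)) p v = L (mvfderiv (𝓡 n) f p v) := by
  have h := mfderiv_comp_apply (I := 𝓡 n) (I' := 𝓘(ℝ, F)) (I'' := 𝓘(ℝ, F')) p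
    L.mdifferentiableAt hf v
  rw [ContinuousLinearMap.mfderiv_eq] at h
  exact h

/-- Tangent vectors are separated by smooth functions defined nearby. -/
lemma tangentVector_ext {p : M} {v w : TangentSpace (𝓡 n) p}
    (h : ∀ (U : Set M) (f : M → ℝ), IsOpen U → p ∈ U → ContMDiffOn (𝓡 n) 𝓘(ℝ, ℝ) ∞ f U →
      mvfderiv (𝓡 n) f p v = mvfderiv (𝓡 n) f p w) : v = w := by
  apply mvfderiv_extChartAt_injective p
  have hs : ContMDiffOn (𝓡 n) 𝓘(ℝ, EuclideanSpace ℝ (Fin n)) ∞ (extChartAt (𝓡 n) p)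
      (extChartAt (𝓡 n) p).source := by
    rw [extChartAt_source]; exact contMDiffOn_extChartAt
  have hd := mdifferentiableAt_of_contMDiffOn hs (isOpen_extChartAt_source p)
    (mem_extChartAt_source p)
  ext i
  have h1 := h _ (fun q => EuclideanSpace.proj (𝕜 := ℝ) i (extChartAt (𝓡 n) p q))
    (isOpen_extChartAt_source p) (mem_extChartAt_source (I := 𝓡 n) p)
    ((EuclideanSpace.proj (𝕜 := ℝ) i).contMDiff.comp_contMDiffOn hs)
  rw [mvfderiv_comp_continuousLinearMap _ hd, mvfderiv_comp_continuousLinearMap _ hd] at h1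
  exact h1

lemma mvfderiv_comp_map {f : X → ℝ} {h : M → X} {p : M}
    (hf : MDifferentiableAt (𝓡 d) 𝓘(ℝ, ℝ) f (h p)) (hh : MDifferentiableAt (𝓡 n) (𝓡 d) h p)
    (v : TangentSpace (𝓡 n) p) :
    mvfderiv (𝓡 n) (fun q => f (h q)) p v = mvfderiv (𝓡 d) f (h p) (mfderiv (𝓡 n) (𝓡 d) h p v) :=
  mvfderiv_comp_apply p hf hh v

/-- Brackets of related vector fields are related. -/
lemma mfderiv_mlieBracket_of_related {h : M → X} {U : Set M} {U' : Set X} (hU : IsOpen U)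
    (hU' : IsOpen U') (hh : ContMDiffOn (𝓡 n) (𝓡 d) ∞ h U) (hUU' : ∀ q ∈ U, h q ∈ U')
    {A B : ∀ q : M, TangentSpace (𝓡 n) q} {A' B' : ∀ x : X, TangentSpace (𝓡 d) x}
    (hA : SmoothFieldOn A U) (hB : SmoothFieldOn B U) (hA' : SmoothFieldOn A' U')
    (hB' : SmoothFieldOn B' U') (rA : ∀ q ∈ U, mfderiv (𝓡 n) (𝓡 d) h q (A q) = A' (h q))
    (rB : ∀ q ∈ U, mfderiv (𝓡 n) (𝓡 d) h q (B q) = B' (h q)) {p : M} (hp : p ∈ U) :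
    mfderiv (𝓡 n) (𝓡 d) h p (mlieBracket (𝓡 n) A B p) = mlieBracket (𝓡 d) A' B' (h p) := by
  -- Both vectors are compared as derivations: on a local function they are commutators of iterated
  -- derivatives, and relatedness matches these term by term.
  refine tangentVector_ext fun O f hO hpO hf => ?_
  set O' := U ∩ h ⁻¹' (O ∩ U') with hO'
  have oO' : IsOpen O' := hh.continuousOn.isOpen_inter_preimage hU (hO.inter hU')
  have hpO' : p ∈ O' := ⟨hp, hpO, hUU' p hp⟩
  have dh : ∀ q ∈ O', MDifferentiableAt (𝓡 n) (𝓡 d) h q := fun q hq =>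
    (hh.contMDiffAt (hU.mem_nhds hq.1)).mdifferentiableAt (by simp)
  have hfh : ContMDiffOn (𝓡 n) 𝓘(ℝ, ℝ) ∞ (fun q => f (h q)) O' :=
    hf.comp (hh.mono Set.inter_subset_left) fun q hq => hq.2.1
  have df : ∀ q ∈ O', MDifferentiableAt (𝓡 d) 𝓘(ℝ, ℝ) f (h q) := fun q hq =>
    mdifferentiableAt_of_contMDiffOn hf hO hq.2.1
  have key : ∀ {A B : ∀ q : M, TangentSpace (𝓡 n) q} {A' B' : ∀ x : X, TangentSpace (𝓡 d) x},
      SmoothFieldOn B' U' → (∀ q ∈ U, mfderiv (𝓡 n) (𝓡 d) h q (A q) = A' (h q)) →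
      (∀ q ∈ U, mfderiv (𝓡 n) (𝓡 d) h q (B q) = B' (h q)) →
      mvfderiv (𝓡 n) (fun q => mvfderiv (𝓡 n) (fun r => f (h r)) q (B q)) p (A p) =
        mvfderiv (𝓡 d) (fun x => mvfderiv (𝓡 d) f x (B' x)) (h p) (A' (h p)) := by
    intro A B A' B' hB' rA rB
    have e : (fun q => mvfderiv (𝓡 n) (fun r => f (h r)) q (B q)) =ᶠ[𝓝 p]
        fun q => (fun x => mvfderiv (𝓡 d) f x (B' x)) (h q) := by
      filter_upwards [oO'.mem_nhds hpO'] with q hq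
      rw [mvfderiv_comp_map (df q hq) (dh q hq), rB q hq.1]
    rw [mvfderiv_congr e,
      mvfderiv_comp_map (f := fun x => mvfderiv (𝓡 d) f x (B' x)) _ (dh p hpO'), rA p hp]
    exact mdifferentiableAt_of_contMDiffOn (contMDiffOn_mvfderiv (hB'.mono Set.inter_subset_right)
      (hf.mono Set.inter_subset_left) (hO.inter hU')) (hO.inter hU') hpO'.2
  rw [← mvfderiv_comp_map (df p hpO') (dh p hpO'),
    mvfderiv_mlieBracket (hA.mono Set.inter_subset_left) (hB.mono Set.inter_subset_left) hfh
      oO' hpO', key hB' rA rB, key hA' rB rA,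
    mvfderiv_mlieBracket (hA'.mono Set.inter_subset_right) (hB'.mono Set.inter_subset_right)
      (hf.mono Set.inter_subset_left) (hO.inter hU') hpO'.2]

/-- A submersion has smooth local sections. -/
lemma exists_local_section {h : M → X} {p : M} (hh : IsSubmersionAt (𝓡 n) (𝓡 d) ∞ h p) :
    ∃ (s : X → M) (O : Set X), IsOpen O ∧ h p ∈ O ∧ s (h p) = p ∧
      ContMDiffOn (𝓡 d) (𝓡 n) ∞ s O ∧ ∀ x ∈ O, h (s x) = x := by
  set D := hh.domChart
  set K := hh.codChart
  set L := hh.equiv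
  have hpD : p ∈ D.source := hh.mem_domChart_source
  have hpK : h p ∈ K.source := hh.mem_codChart_source
  have hw : ∀ y ∈ D.target, K (h (D.symm y)) = (L y).1 := fun y hy => by
    have := hh.writtenInCharts (show y ∈ (hh.domChart.extend (𝓡 n)).target by simpa using hy)
    simpa [D, K, L] using this
  -- The section freezes the second coordinate at its value at p.
  let j : EuclideanSpace ℝ (Fin d) → EuclideanSpace ℝ (Fin n) := fun y => L.symm (y, (L (D p)).2)
  have hj : ContDiff ℝ ∞ j := L.symm.contDiff.comp (contDiff_id.prodMk contDiff_const)
  have hLp : (L (D p)).1 = K (h p) := by rw [← hw _ (D.map_source hpD), D.left_inv hpD]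
  have hjp : j (K (h p)) = D p := by simp [j, ← hLp]
  set O := K.source ∩ K ⁻¹' (j ⁻¹' D.target) with hO
  have oO : IsOpen O := K.isOpen_inter_preimage (D.open_target.preimage hj.continuous)
  have hK := contMDiffOn_of_mem_maximalAtlas hh.codChart_mem_maximalAtlas
  have hD := contMDiffOn_symm_of_mem_maximalAtlas hh.domChart_mem_maximalAtlas
  refine ⟨fun x => D.symm (j (K x)), O, oO, ⟨hpK, ?_⟩, ?_, ?_, fun x hx => ?_⟩
  · simp only [Set.mem_preimage, hjp]; exact D.map_source hpD
  · simp only [hjp]; exact D.left_inv hpD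
  · exact hD.comp (hj.contMDiff.comp_contMDiffOn (hK.mono Set.inter_subset_left))
      fun x hx => hx.2
  · have h1 := hw _ hx.2
    have h2 : h (D.symm (j (K x))) ∈ K.source :=
      hh.source_subset_preimage_source (D.map_target hx.2)
    rw [show (L (j (K x))).1 = K x by simp [j]] at h1
    exact K.injOn h2 hx.1 h1

/-- Differentiate h ∘ s = id for a local section s through p. -/
lemma mfderiv_surjective_of_isSubmersionAt {h : M → X} {p : M}
    (hh : IsSubmersionAt (𝓡 n) (𝓡 d) ∞ h p) :
    Function.Surjective (mfderiv (𝓡 n) (𝓡 d) h p) := by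
  obtain ⟨s, O, hO, hpO, hsp, hs, hhs⟩ := exists_local_section hh
  have ds : MDifferentiableAt (𝓡 d) (𝓡 n) s (h p) :=
    (hs.contMDiffAt (hO.mem_nhds hpO)).mdifferentiableAt (by simp)
  have dh : MDifferentiableAt (𝓡 n) (𝓡 d) h p := hh.contMDiffAt.mdifferentiableAt (by simp)
  have e : (fun x => h (s x)) =ᶠ[𝓝 (h p)] id := by
    filter_upwards [hO.mem_nhds hpO] with x hx using hhs x hx
  intro w
  have h1 := mfderiv_comp_apply_of_eq (I := 𝓡 d) (I' := 𝓡 n) (I'' := 𝓡 d) (g := h) (f := s) (h p)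
    dh ds hsp w
  have h2 : mfderiv (𝓡 d) (𝓡 d) (fun x => h (s x)) (h p) =
    (mfderiv (𝓡 d) (𝓡 d) id (h p) : EuclideanSpace ℝ (Fin d) →L[ℝ] EuclideanSpace ℝ (Fin d)) :=
    e.mfderiv_eq
  rw [mfderiv_id] at h2
  refine ⟨mfderiv (𝓡 d) (𝓡 n) s (h p) w, h1.symm.trans ?_⟩
  exact congrArg (fun L : EuclideanSpace ℝ (Fin d) →L[ℝ] EuclideanSpace ℝ (Fin d) => L w) h2

/-- Near every point there are a smooth frame and its dual coordinates on tangent spaces. -/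
lemma exists_local_frame (x : X) :
    ∃ (O : Set X) (b : Fin d → ∀ y : X, TangentSpace (𝓡 d) y)
      (c : Fin d → ∀ y : X, TangentSpace (𝓡 d) y →ₗ[ℝ] ℝ), IsOpen O ∧ x ∈ O ∧
      (∀ i, SmoothFieldOn (b i) O) ∧
      (∀ y ∈ O, ∀ v : TangentSpace (𝓡 d) y, v = ∑ i, c i y v • b i y) ∧
      ∀ i (U : Set X) (V : ∀ y : X, TangentSpace (𝓡 d) y), IsOpen U → U ⊆ O →
        SmoothFieldOn V U → ContMDiffOn (𝓡 d) 𝓘(ℝ, ℝ) ∞ (fun y => c i y (V y)) U := by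
  have : ContMDiffVectorBundle ∞ (EuclideanSpace ℝ (Fin d))
    (TangentSpace (𝓡 d) : X → Type _) (𝓡 d) := inferInstance
  have : ContMDiffVectorBundle 1 (EuclideanSpace ℝ (Fin d))
    (TangentSpace (𝓡 d) : X → Type _) (𝓡 d) := inferInstance
  let e := trivializationAt (EuclideanSpace ℝ (Fin d)) (TangentSpace (𝓡 d) : X → Type _) x
  let b := (EuclideanSpace.basisFun (Fin d) ℝ).toBasis
  refine ⟨e.baseSet, e.localFrame b, fun i y => e.localFrameCoeff (𝓡 d) b i y, e.open_baseSet,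
    FiberBundle.mem_baseSet_trivializationAt' x,
    fun i => e.contMDiffOn_localFrame_baseSet (I := 𝓡 d) ∞ b i, fun y hy v => ?_,
    fun i U V hU hUO hV => ?_⟩
  · classical
    -- The expansion is available for sections, so the single vector v is extended by zero away from
    -- y.
    have h1 := (e.isLocalFrameOn_localFrame_baseSet (𝓡 d) 1 b).coeff_sum_eq
      (fun z => if h : z = y then h ▸ v else 0) hy
    simp only [dite_true] at h1
    exact h1
  · exact contMDiffOn_localFrameCoeff (I := 𝓡 d) (k := ∞) b hU hUO hV i

/-- The coefficients of a smooth field with respect to smooth fields that form a basis are smooth. -/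
lemma exists_smooth_coeff {V : Fin d → ∀ x : X, TangentSpace (𝓡 d) x}
    {W : ∀ x : X, TangentSpace (𝓡 d) x} {U : Set X} (hU : IsOpen U) {x : X} (hx : x ∈ U)
    (hV : ∀ j, SmoothFieldOn (V j) U) (hW : SmoothFieldOn W U)
    (hli : LinearIndependent ℝ fun j => V j x) :
    ∃ (O : Set X) (g : Fin d → X → ℝ), IsOpen O ∧ x ∈ O ∧ O ⊆ U ∧
      (∀ j, ContMDiffOn (𝓡 d) 𝓘(ℝ, ℝ) ∞ (g j) O) ∧ ∀ y ∈ O, W y = ∑ j, g j y • V j y := by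
  obtain ⟨O₁, b, c, hO₁, hxO₁, -, hbc, hc⟩ := exists_local_frame (d := d) x
  have hc' := fun i {V : ∀ y : X, TangentSpace (𝓡 d) y} (hV : SmoothFieldOn V (U ∩ O₁)) => hc i (U ∩ O₁) V (hU.inter hO₁) Set.inter_subset_right hV
  let A : X → Matrix (Fin d) (Fin d) ℝ := fun y => Matrix.of fun i j => c i y (V j y)
  have hA : ∀ i j, ContMDiffOn (𝓡 d) 𝓘(ℝ, ℝ) ∞ (fun y => A y i j) (U ∩ O₁) :=
    fun i j => hc' i ((hV j).mono Set.inter_subset_left)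
  have hdet := contMDiffOn_det hA
  let O := (U ∩ O₁) ∩ (fun y => (A y).det) ⁻¹' {0}ᶜ
  have hO : IsOpen O := hdet.continuousOn.isOpen_inter_preimage (hU.inter hO₁)
    isOpen_compl_singleton
  -- A kernel vector of A x would be a linear relation among the V j x.
  have hxdet : (A x).det ≠ 0 := by
    intro h0
    obtain ⟨v, hv, hv0⟩ := Matrix.exists_mulVec_eq_zero_iff.2 h0
    refine hv (funext (Fintype.linearIndependent_iff.1 hli v ?_))
    rw [hbc x hxO₁ (∑ j, v j • V j x)]
    refine Finset.sum_eq_zero fun i _ => ?_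
    have := congrFun hv0 i
    simp only [Matrix.mulVec, dotProduct, A, Matrix.of_apply, Pi.zero_apply] at this
    rw [map_sum]
    simp only [map_smul, smul_eq_mul, mul_comm (v _), this, zero_smul]
  refine ⟨O, fun j y => ∑ i, (A y)⁻¹ j i * c i y (W y), hO, ⟨⟨hx, hxO₁⟩, hxdet⟩,
    fun y hy => hy.1.1, fun j => contMDiffOn_finsetSum fun i _ => ?_, fun y hy => ?_⟩
  · exact (contMDiffOn_inv_matrix (fun i j => (hA i j).mono Set.inter_subset_left)
      (fun y hy => hy.2) j i).mul
      ((hc' i (hW.mono Set.inter_subset_left)).mono Set.inter_subset_left)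
  · have h1 : (A y).mulVec ((A y)⁻¹.mulVec fun i => c i y (W y)) = fun i => c i y (W y) := by
      rw [Matrix.mulVec_mulVec, Matrix.mul_nonsing_inv _ (isUnit_iff_ne_zero.2 hy.2),
        Matrix.one_mulVec]
    have key : ∀ i, c i y (∑ j, (∑ i, (A y)⁻¹ j i * c i y (W y)) • V j y) = c i y (W y) := by
      intro i
      have := congrFun h1 i
      simp only [Matrix.mulVec, dotProduct, A, Matrix.of_apply] at this
      rw [map_sum]
      simp only [map_smul, smul_eq_mul]
      refine Eq.trans (Finset.sum_congr rfl fun j _ => mul_comm _ _) this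
    refine (hbc y hy.1.2 (W y)).trans (Eq.trans ?_ (hbc y hy.1.2 _).symm)
    exact Finset.sum_congr rfl fun i _ => congrArg (· • b i y) (key i).symm

end Fields

/-! ### Dimension of tangent spaces and brackets of combinations of fields -/

section Brackets

variable {n : ℕ} {M : Type*} [TopologicalSpace M] [ChartedSpace (EuclideanSpace ℝ (Fin n)) M]
  [IsManifold (𝓡 n) ∞ M]

instance (p : M) : FiniteDimensional ℝ (TangentSpace (𝓡 n) p) :=
  inferInstanceAs (FiniteDimensional ℝ (EuclideanSpace ℝ (Fin n)))

lemma finrank_tangentSpace (p : M) : Module.finrank ℝ (TangentSpace (𝓡 n) p) = n :=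
  finrank_euclideanSpace_fin (𝕜 := ℝ) (n := n)

lemma smoothFieldOn_sum {ι : Type*} (s : Finset ι) {g : ι → M → ℝ}
    {Z : ι → ∀ p : M, TangentSpace (𝓡 n) p} {U : Set M}
    (hg : ∀ i, ContMDiffOn (𝓡 n) 𝓘(ℝ, ℝ) ∞ (g i) U) (hZ : ∀ i, SmoothFieldOn (Z i) U) :
    SmoothFieldOn (fun p => ∑ i ∈ s, g i p • Z i p) U :=
  ContMDiffOn.sum_section fun i _ => ContMDiffOn.smul_section (hg i) (hZ i)

lemma SmoothFieldOn.congr {V W : ∀ p : M, TangentSpace (𝓡 n) p} {U : Set M}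
    (hV : SmoothFieldOn V U) (h : ∀ p ∈ U, W p = V p) : SmoothFieldOn W U :=
  ContMDiffOn.congr hV fun p hp => by rw [h p hp]

lemma mlieBracket_sum_smul {ι : Type*} (s : Finset ι) {g : ι → M → ℝ}
    {V : ∀ p : M, TangentSpace (𝓡 n) p}
    {Z : ι → ∀ p : M, TangentSpace (𝓡 n) p} {U : Set M} (hU : IsOpen U)
    (hg : ∀ i, ContMDiffOn (𝓡 n) 𝓘(ℝ, ℝ) ∞ (g i) U) (hZ : ∀ i, SmoothFieldOn (Z i) U)
    {p : M} (hp : p ∈ U) :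
    mlieBracket (𝓡 n) V (fun q => ∑ i ∈ s, g i q • Z i q) p =
      ∑ i ∈ s, (mvfderiv (𝓡 n) (g i) p (V p) • Z i p + g i p • mlieBracket (𝓡 n) V (Z i) p) := by
  induction s using Finset.cons_induction with
  | empty =>
    simp only [Finset.sum_empty]
    exact congrFun mlieBracket_zero_right p
  | cons a s ha ih =>
    simp only [Finset.sum_cons]
    rw [← ih]
    have h1 : SmoothFieldOn (g a • Z a) U := ContMDiffOn.smul_section (hg a) (hZ a)
    have h2 := smoothFieldOn_sum s hg hZ
    have h3 := mlieBracket_add_right (V := V) (h1.mdifferentiableAt hU hp)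
      (h2.mdifferentiableAt hU hp)
    have h4 := mlieBracket_smul_right (V := V) (mdifferentiableAt_of_contMDiffOn (hg a) hU hp)
      ((hZ a).mdifferentiableAt hU hp)
    rw [h4] at h3
    exact h3

end Brackets

/-! ### The dual frame and the structure functions -/

namespace Coframe

variable {n : ℕ} {M : Type*} [TopologicalSpace M] [ChartedSpace (EuclideanSpace ℝ (Fin n)) M]
  [IsManifold (𝓡 n) ∞ M] (θ : Coframe n M)

/-- The linear coordinates on a tangent space given by the coframe. -/
def coord (p : M) : TangentSpace (𝓡 n) p →ₗ[ℝ] (Fin n → ℝ) :=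
  LinearMap.pi fun i => (θ.form i p).toLinearMap

/-- A functional vanishing on the range would be a linear relation among the forms of the coframe.
-/
lemma coord_surjective (p : M) : Function.Surjective (θ.coord p) := by
  rw [← LinearMap.range_eq_top]
  by_contra h
  obtain ⟨f, hf, hle⟩ := Submodule.exists_le_ker_of_lt_top _ (lt_top_iff_ne_top.2 h)
  apply hf
  have h1 : ∑ i, f (Pi.single i 1) • θ.form i p = 0 := by
    ext v
    have h2 : f (θ.coord p v) = 0 := hle ⟨v, rfl⟩
    have h3 : θ.coord p v = ∑ i, θ.form i p v • Pi.single i (1 : ℝ) := by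
      ext j
      simp [coord, Finset.sum_apply, Pi.single_apply]
    rw [h3, map_sum] at h2
    simp only [map_smul, smul_eq_mul] at h2
    rw [sum_apply]
    exact (Finset.sum_congr rfl fun i _ => mul_comm _ _).trans h2
  have h3 := Fintype.linearIndependent_iff.1 (θ.linearIndependent p) _ h1
  refine LinearMap.pi_ext' fun i => LinearMap.ext_ring ?_
  simpa using h3 i

/-- The coordinates as a linear equivalence. -/
def coordEquiv (p : M) : TangentSpace (𝓡 n) p ≃ₗ[ℝ] (Fin n → ℝ) :=
  LinearEquiv.ofBijective (θ.coord p)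
    ⟨(LinearMap.injective_iff_surjective_of_finrank_eq_finrank
      (by rw [finrank_tangentSpace, Module.finrank_fin_fun])).2 (θ.coord_surjective p),
      θ.coord_surjective p⟩

/-- The frame of vector fields dual to the coframe. -/
def frame (i : Fin n) (p : M) : TangentSpace (𝓡 n) p :=
  (θ.coordEquiv p).symm (Pi.single i 1)

lemma form_frame (i j : Fin n) (p : M) :
    θ.form i p (θ.frame j p) = if i = j then 1 else 0 := by
  have h : θ.coordEquiv p (θ.frame j p) = Pi.single j 1 := LinearEquiv.apply_symm_apply _ _
  have h1 := congrFun h i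
  rw [Pi.single_apply] at h1
  exact h1

variable {θ} in
lemma ext_form {p : M} {v w : TangentSpace (𝓡 n) p}
    (h : ∀ i, θ.form i p v = θ.form i p w) : v = w :=
  (θ.coordEquiv p).injective (funext h)

lemma eq_sum_frame {p : M} (v : TangentSpace (𝓡 n) p) :
    v = ∑ i, θ.form i p v • θ.frame i p := by
  refine ext_form (θ := θ) fun j => ?_
  rw [map_sum]
  simp [form_frame]

/-- In a local smooth frame, the dual frame is given by the inverse of the matrix of values of the
coframe. -/
lemma smooth_frame (i : Fin n) : SmoothFieldOn (θ.frame i) Set.univ := by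
  intro p _
  obtain ⟨O, b, c, hO, hpO, hb, hbc, -⟩ := exists_local_frame (d := n) p
  let A : M → Matrix (Fin n) (Fin n) ℝ := fun q => Matrix.of fun i j => θ.form i q (b j q)
  have hA : ∀ i j, ContMDiffOn (𝓡 n) 𝓘(ℝ, ℝ) ∞ (fun q => A q i j) O :=
    fun i j => θ.smooth i O (b j) hO (hb j)
  have hdet : ∀ q ∈ O, (A q).det ≠ 0 := by
    intro q hq h0
    obtain ⟨v, hv, hv0⟩ := Matrix.exists_vecMul_eq_zero_iff.2 h0
    refine hv (funext (Fintype.linearIndependent_iff.1 (θ.linearIndependent q) v ?_))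
    ext w
    rw [hbc q hq w, map_sum]
    refine Finset.sum_eq_zero fun j _ => ?_
    have := congrFun hv0 j
    simp only [Matrix.vecMul, dotProduct, A, Matrix.of_apply, Pi.zero_apply] at this
    rw [map_smul, sum_apply]
    simp only [smul_apply, smul_eq_mul, this, mul_zero]
  have hs : SmoothFieldOn (fun q => ∑ j, (A q)⁻¹ j i • b j q) O :=
    smoothFieldOn_sum _ (fun j => contMDiffOn_inv_matrix hA hdet j i) hb
  have h1 : SmoothFieldOn (θ.frame i) O := hs.congr fun q hq => by
    refine ext_form (θ := θ) fun l => ?_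
    rw [form_frame, map_sum]
    have := congrFun (congrFun (Matrix.mul_nonsing_inv (A q) (isUnit_iff_ne_zero.2 (hdet q hq))) l) i
    rw [Matrix.mul_apply, Matrix.one_apply] at this
    rw [← this]
    refine Finset.sum_congr rfl fun j _ => ?_
    rw [map_smul, smul_eq_mul, mul_comm]
    rfl
  exact (h1.contMDiffAt hO hpO).contMDiffWithinAt

lemma contMDiff_form {V : ∀ p : M, TangentSpace (𝓡 n) p} (hV : SmoothFieldOn V Set.univ)
    (i : Fin n) : ContMDiff (𝓡 n) 𝓘(ℝ, ℝ) ∞ (fun p => θ.form i p (V p)) :=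
  contMDiffOn_univ.1 (θ.smooth i _ V isOpen_univ hV)

variable {θ}

lemma IsLocalEquivalence.mfderiv_frame {e : OpenPartialHomeomorph M M}
    (he : θ.IsLocalEquivalence e) {p : M} (hp : p ∈ e.source) (i : Fin n) :
    mfderiv (𝓡 n) (𝓡 n) e p (θ.frame i p) = θ.frame i (e p) :=
  ext_form (θ := θ) fun j => by rw [he.2.2 j p hp, form_frame, form_frame]

lemma IsLocalEquivalence.mdifferentiableAt {e : OpenPartialHomeomorph M M}
    (he : θ.IsLocalEquivalence e) {p : M} (hp : p ∈ e.source) :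
    MDifferentiableAt (𝓡 n) (𝓡 n) e p :=
  (he.1.contMDiffAt (e.open_source.mem_nhds hp)).mdifferentiableAt (by simp)

lemma Inv.mdifferentiableAt {f : M → ℝ} (hf : f ∈ θ.Inv) (p : M) :
    MDifferentiableAt (𝓡 n) 𝓘(ℝ, ℝ) f p :=
  hf.1.mdifferentiable (by simp) p

lemma Inv.mvfderiv_localEquivalence {f : M → ℝ} (hf : f ∈ θ.Inv) {e : OpenPartialHomeomorph M M}
    (he : θ.IsLocalEquivalence e) {p : M} (hp : p ∈ e.source) (v : TangentSpace (𝓡 n) p) :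
    mvfderiv (𝓡 n) f (e p) (mfderiv (𝓡 n) (𝓡 n) e p v) = mvfderiv (𝓡 n) f p v := by
  rw [← mvfderiv_comp_map (Inv.mdifferentiableAt hf _) (he.mdifferentiableAt hp)]
  refine congrArg (fun L : EuclideanSpace ℝ (Fin n) →L[ℝ] ℝ => L v) (mvfderiv_congr ?_)
  filter_upwards [e.open_source.mem_nhds hp] with q hq using hf.2 e he q hq

/-- Local equivalences carry the dual frame to itself. This closure property is what makes the
anchor well defined on the classifying space. -/
lemma Inv.frame_derivative {f : M → ℝ} (hf : f ∈ θ.Inv) (i : Fin n) :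
    (fun p => mvfderiv (𝓡 n) f p (θ.frame i p)) ∈ θ.Inv := by
  refine ⟨contMDiffOn_univ.1 (contMDiffOn_mvfderiv (θ.smooth_frame i) hf.1.contMDiffOn
    isOpen_univ), fun e he p hp => ?_⟩
  dsimp only
  rw [← he.mfderiv_frame hp, Inv.mvfderiv_localEquivalence hf he hp]

variable (θ)

/-- The structure functions of the coframe, `[Eᵢ, Eⱼ] = -∑ₖ C i j k Eₖ` for the dual frame. -/
def structureFunction (i j k : Fin n) (p : M) : ℝ :=
  -θ.form k p (mlieBracket (𝓡 n) (θ.frame i) (θ.frame j) p)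

lemma structureFunction_skew (i j k : Fin n) (p : M) :
    θ.structureFunction i j k p = -θ.structureFunction j i k p := by
  rw [structureFunction, structureFunction, mlieBracket_swap_apply, map_neg]

/-- A map that preserves the dual frame preserves its brackets. -/
lemma structureFunction_mem_Inv (i j k : Fin n) : θ.structureFunction i j k ∈ θ.Inv := by
  refine ⟨(θ.contMDiff_form ((θ.smooth_frame i).mlieBracket (θ.smooth_frame j) isOpen_univ) k).neg,
    fun e he p hp => ?_⟩
  rw [structureFunction, structureFunction, ← he.2.2 k p hp]
  congr 2
  exact (mfderiv_mlieBracket_of_related e.open_source isOpen_univ he.1 (fun _ _ => trivial)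
    ((θ.smooth_frame i).mono (Set.subset_univ _)) ((θ.smooth_frame j).mono (Set.subset_univ _))
    (θ.smooth_frame i) (θ.smooth_frame j) (fun q hq => he.mfderiv_frame hq i)
    (fun q hq => he.mfderiv_frame hq j) hp).symm

lemma mlieBracket_frame (i j : Fin n) (p : M) :
    mlieBracket (𝓡 n) (θ.frame i) (θ.frame j) p =
      ∑ k, (-θ.structureFunction i j k p) • θ.frame k p := by
  refine (θ.eq_sum_frame _).trans (Finset.sum_congr rfl fun k _ => ?_)
  rw [structureFunction, neg_neg]

/-- The Leibniz rule for the bracket, after expanding W in the dual frame. -/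
lemma form_mlieBracket_right {V W : ∀ p : M, TangentSpace (𝓡 n) p} {U : Set M} (hU : IsOpen U)
    (hW : SmoothFieldOn W U) {p : M} (hp : p ∈ U) (l : Fin n) :
    θ.form l p (mlieBracket (𝓡 n) V W p) = mvfderiv (𝓡 n) (fun q => θ.form l q (W q)) p (V p) +
      ∑ j, θ.form j p (W p) * θ.form l p (mlieBracket (𝓡 n) V (θ.frame j) p) := by
  have e : W = fun q => ∑ j, θ.form j q (W q) • θ.frame j q :=
    funext fun q => θ.eq_sum_frame (W q)
  have h1 := mlieBracket_sum_smul (V := V) Finset.univ hU (fun j => θ.smooth j U W hU hW)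
    (fun j => (θ.smooth_frame j).mono (Set.subset_univ U)) hp
  rw [← e] at h1
  rw [h1, map_sum]
  simp only [map_add, map_smul, smul_eq_mul, form_frame, mul_ite, mul_one, mul_zero,
    Finset.sum_add_distrib]
  simp

/-- The bracket with a frame field. -/
lemma mvfderiv_form_frame {W : ∀ p : M, TangentSpace (𝓡 n) p} {U : Set M} (hU : IsOpen U)
    (hW : SmoothFieldOn W U) {p : M} (hp : p ∈ U) (i l : Fin n) :
    mvfderiv (𝓡 n) (fun q => θ.form l q (W q)) p (θ.frame i p) =
      θ.form l p (mlieBracket (𝓡 n) (θ.frame i) W p) +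
        ∑ j, θ.structureFunction i j l p * θ.form j p (W p) := by
  rw [θ.form_mlieBracket_right hU hW hp, add_assoc, ← Finset.sum_add_distrib,
    Finset.sum_eq_zero, add_zero]
  intro j _
  rw [structureFunction]
  ring

/-- The structure equation. -/
lemma extDerivOneForm_form {V W : ∀ p : M, TangentSpace (𝓡 n) p} {U : Set M} (hU : IsOpen U)
    (hV : SmoothFieldOn V U) (hW : SmoothFieldOn W U) {p : M} (hp : p ∈ U) (l : Fin n) :
    extDerivOneForm (θ.form l) V W p =
      ∑ i, ∑ j, θ.structureFunction i j l p * (θ.form i p (V p) * θ.form j p (W p)) := by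
  have h1 : ∀ j, θ.form l p (mlieBracket (𝓡 n) V (θ.frame j) p) =
      -mvfderiv (𝓡 n) (fun q => θ.form l q (V q)) p (θ.frame j p) +
        ∑ i, θ.structureFunction j i l p * θ.form i p (V p) := by
    intro j
    rw [mlieBracket_swap_apply, map_neg, θ.mvfderiv_form_frame hU hV hp]
    ring
  have h2 : mvfderiv (𝓡 n) (fun q => θ.form l q (V q)) p (W p) =
      ∑ j, θ.form j p (W p) * mvfderiv (𝓡 n) (fun q => θ.form l q (V q)) p (θ.frame j p) := by
    conv_lhs => rw [θ.eq_sum_frame (W p), map_sum]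
    simp only [map_smul, smul_eq_mul]
  rw [extDerivOneForm, θ.form_mlieBracket_right hU hW hp, h2]
  simp only [h1, mul_add, Finset.sum_add_distrib, mul_neg, Finset.sum_neg_distrib]
  have h3 : ∑ i, ∑ j, θ.structureFunction i j l p * (θ.form i p (V p) * θ.form j p (W p)) =
      -∑ j, θ.form j p (W p) * ∑ i, θ.structureFunction j i l p * θ.form i p (V p) := by
    rw [Finset.sum_comm, ← Finset.sum_neg_distrib]
    refine Finset.sum_congr rfl fun j _ => ?_
    rw [Finset.mul_sum, ← Finset.sum_neg_distrib]
    refine Finset.sum_congr rfl fun i _ => ?_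
    rw [θ.structureFunction_skew i j]
    ring
  rw [h3]
  ring

/-- Passes between the structure equation written with i < j and the full double sum; skewness kills
the diagonal and pairs (i, j) with (j, i). -/
lemma sum_Ioi_skew (C : Fin n → Fin n → ℝ) (hC : ∀ i j, C i j = -C j i) (v w : Fin n → ℝ) :
    ∑ i, ∑ j ∈ Finset.Ioi i, C i j * (v i * w j - w i * v j) =
      ∑ i, ∑ j, C i j * (v i * w j) := by
  have hd : ∀ i, C i i = 0 := fun i => by linarith [hC i i]
  have h1 : ∀ i, ∑ j, C i j * (v i * w j) = ∑ j ∈ Finset.Ioi i, C i j * (v i * w j) +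
      ∑ j ∈ Finset.Iio i, C i j * (v i * w j) := by
    intro i
    rw [← Finset.sum_union (Finset.disjoint_left.2 fun a h h' => by
      simp only [Finset.mem_Ioi, Finset.mem_Iio] at h h'; exact absurd h (not_lt_of_gt h'))]
    symm
    refine Finset.sum_subset (Finset.subset_univ _) fun j _ hj => ?_
    have : i = j := by
      simp only [Finset.mem_union, Finset.mem_Ioi, Finset.mem_Iio, not_or, not_lt] at hj
      exact le_antisymm hj.2 hj.1
    rw [← this, hd, zero_mul]
  simp_rw [h1, mul_sub, Finset.sum_sub_distrib, Finset.sum_add_distrib]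
  rw [sub_eq_add_neg]
  congr 1
  rw [← Finset.sum_neg_distrib]
  simp_rw [← Finset.sum_neg_distrib]
  rw [Finset.sum_comm' (t' := Finset.univ) (s' := fun j => Finset.Iio j) (by simp)]
  refine Finset.sum_congr rfl fun i _ => Finset.sum_congr rfl fun j _ => ?_
  rw [hC j i]
  ring

end Coframe

/-! ### Invariant forms, the orbit volume and the trace of the adjoint action -/

namespace Coframe

variable {n k : ℕ} {M : Type*} [TopologicalSpace M] [ChartedSpace (EuclideanSpace ℝ (Fin n)) M]
  [IsManifold (𝓡 n) ∞ M] {θ : Coframe n M}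

/-- The function f need not be invariant: since local equivalences preserve the dual frame, it is
enough that its frame derivatives are. -/
lemma differential_mem_closedInvariant {f : M → ℝ} (hf : ContMDiff (𝓡 n) 𝓘(ℝ, ℝ) ∞ f)
    (h : ∀ e : OpenPartialHomeomorph M M, θ.IsLocalEquivalence e → ∀ p ∈ e.source, ∀ i,
      mvfderiv (𝓡 n) f (e p) (θ.frame i (e p)) = mvfderiv (𝓡 n) f p (θ.frame i p)) :
    differential f ∈ θ.closedInvariant := by
  refine ⟨fun U V hU hV => contMDiffOn_mvfderiv hV hf.contMDiffOn hU, fun e he p hp v => ?_,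
    fun U V W hU hV hW p hp => ?_⟩
  · conv_lhs => rw [θ.eq_sum_frame v]
    conv_rhs => rw [θ.eq_sum_frame v]
    simp only [map_sum, map_smul]
    refine Finset.sum_congr rfl fun i _ => ?_
    rw [he.mfderiv_frame hp]
    exact congrArg _ (h e he p hp i)
  · have := mvfderiv_mlieBracket hV hW hf.contMDiffOn hU hp
    simp only [extDerivOneForm, differential]
    rw [this]
    ring

lemma cohomologyClass_eq_zero_iff {β : OneForm n M} (h : β ∈ θ.closedInvariant) :
    θ.cohomologyClass β h = 0 ↔ ∃ f ∈ θ.Inv, β = differential f := by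
  rw [cohomologyClass, Submodule.Quotient.mk_eq_zero]
  exact exists_congr fun _ => and_congr_right fun _ =>
    ⟨fun h => funext h, fun h p => congrFun h p⟩

/-- A local equivalence preserves every invariant function, so it is itself a witness of formal
equivalence. -/
lemma classifyingMap_localEquivalence {e : OpenPartialHomeomorph M M}
    (he : θ.IsLocalEquivalence e) {p : M} (hp : p ∈ e.source) :
    θ.classifyingMap (e p) = θ.classifyingMap p :=
  (Quotient.sound (s := θ.formalSetoid) ⟨e, he.1, he.2.1, hp, rfl,
    fun q hq _ hf => hf.2 e he q hq⟩).symm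

lemma Inv.eq_of_classifyingMap_eq {f : M → ℝ} (hf : f ∈ θ.Inv) {p q : M}
    (h : θ.classifyingMap p = θ.classifyingMap q) : f p = f q := by
  obtain ⟨e, -, -, hp, rfl, he⟩ := Quotient.exact h
  exact (he p hp f hf).symm

/-! ### Invariant forms and symmetries -/

lemma mlieBracket_symmetry_eq {η : ∀ p : M, TangentSpace (𝓡 n) p} (hη : η ∈ θ.symmetryAlgebra)
    {V : ∀ p : M, TangentSpace (𝓡 n) p} {U : Set M} (hU : IsOpen U) (hV : SmoothFieldOn V U)
    {p : M} (hp : p ∈ U) (l : Fin n) :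
    mvfderiv (𝓡 n) (fun q => θ.form l q (V q)) p (η p) =
      θ.form l p (mlieBracket (𝓡 n) η V p) :=
  sub_eq_zero.1 (hη.2 l U V hU hV p hp)

/-- Symmetries commute with the dual frame. -/
lemma mlieBracket_symmetry_frame {η : ∀ p : M, TangentSpace (𝓡 n) p}
    (hη : η ∈ θ.symmetryAlgebra) (i : Fin n) (p : M) :
    mlieBracket (𝓡 n) η (θ.frame i) p = 0 := by
  refine ext_form (θ := θ) fun l => ?_
  rw [← mlieBracket_symmetry_eq hη isOpen_univ (θ.smooth_frame i) trivial, map_zero]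
  simp only [form_frame]
  rw [mvfderiv_const]
  rfl

variable (θ) in
lemma form_eq_sum_frame (β : ∀ p : M, TangentSpace (𝓡 n) p [⋀^Fin k]→L[ℝ] ℝ) (p : M)
    (v : Fin k → TangentSpace (𝓡 n) p) :
    β p v = ∑ I : Fin k → Fin n, (∏ a, θ.form (I a) p (v a)) * β p (fun a => θ.frame (I a) p) := by
  have h1 : v = fun a => ∑ i, θ.form i p (v a) • θ.frame i p := funext fun a => θ.eq_sum_frame _
  have h2 := (β p).toMultilinearMap.map_sum (fun a i => θ.form i p (v a) • θ.frame i p)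
  rw [← h1] at h2
  refine h2.trans (Finset.sum_congr rfl fun I _ => ?_)
  exact (β p).toMultilinearMap.map_smul_univ _ _

/-- Leibniz rule for the evaluation of a form whose components are constant to first order. -/
lemma mvfderiv_form_apply {β : ∀ p : M, TangentSpace (𝓡 n) p [⋀^Fin k]→L[ℝ] ℝ}
    (hβ : SmoothForm β) {Z : Fin k → ∀ p : M, TangentSpace (𝓡 n) p} {U : Set M} (hU : IsOpen U)
    (hZ : ∀ a, SmoothFieldOn (Z a) U) {p : M} (hp : p ∈ U) {v : TangentSpace (𝓡 n) p}
    (hv : ∀ I : Fin k → Fin n, mvfderiv (𝓡 n) (fun q => β q fun a => θ.frame (I a) q) p v = 0)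
    (w : Fin k → TangentSpace (𝓡 n) p)
    (hw : ∀ a l, mvfderiv (𝓡 n) (fun q => θ.form l q (Z a q)) p v = θ.form l p (w a)) :
    mvfderiv (𝓡 n) (fun q => β q fun a => Z a q) p v =
      ∑ a, β p (Function.update (fun a => Z a p) a (w a)) := by
  obtain ⟨γ, h0, hγ⟩ := exists_hasDerivAt_mvfderiv p v
  refine (hγ _ (mdifferentiableAt_of_contMDiffOn (hβ U Z hU hZ) hU hp)).unique ?_
  have h1 : ∀ a l, HasDerivAt (fun t => θ.form l (γ t) (Z a (γ t))) (θ.form l p (w a)) 0 :=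
    fun a l => hw a l ▸ hγ _ (mdifferentiableAt_of_contMDiffOn (θ.smooth l U _ hU (hZ a)) hU hp)
  have h2 : ∀ I : Fin k → Fin n,
      HasDerivAt (fun t => β (γ t) fun a => θ.frame (I a) (γ t)) 0 0 := fun I =>
    hv I ▸ hγ _ (mdifferentiableAt_of_contMDiffOn (hβ Set.univ _ isOpen_univ
      fun a => θ.smooth_frame (I a)) isOpen_univ trivial)
  -- In the expansion over the frame the components have zero derivative, so only the coordinates of
  -- the arguments contribute.
  have h3 : (fun t => β (γ t) fun a => Z a (γ t)) = fun t => ∑ I : Fin k → Fin n,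
      (∏ a, θ.form (I a) (γ t) (Z a (γ t))) * β (γ t) (fun a => θ.frame (I a) (γ t)) :=
    funext fun t => θ.form_eq_sum_frame β _ _
  rw [h3]
  have h4 := HasDerivAt.fun_sum (u := Finset.univ) fun (I : Fin k → Fin n) _ =>
    (HasDerivAt.fun_finsetProd (u := Finset.univ) fun a _ => h1 a (I a)).mul (h2 I)
  refine h4.congr_deriv ?_
  simp only [mul_zero, add_zero]
  rw [Finset.sum_congr rfl fun a _ => θ.form_eq_sum_frame β p _, Finset.sum_comm]
  refine Finset.sum_congr rfl fun I _ => ?_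
  rw [Finset.sum_mul]
  refine Finset.sum_congr rfl fun a _ => ?_
  congr 1
  · rw [← Finset.prod_erase_mul _ _ (Finset.mem_univ a), smul_eq_mul, Function.update_self]
    congr 1
    refine Finset.prod_congr rfl fun b hb => ?_
    rw [Function.update_of_ne (Finset.mem_erase.1 hb).1, h0]
  · rw [h0]

variable {ξ : Module.Basis (Fin k) ℝ θ.symmetryAlgebra}
  {μG : ∀ p : M, TangentSpace (𝓡 n) p [⋀^Fin k]→L[ℝ] ℝ}

lemma IsInvariantForm.component_mem_Inv (hsmooth : SmoothForm μG) (hinv : θ.IsInvariantForm μG)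
    (I : Fin k → Fin n) : (fun q => μG q fun a => θ.frame (I a) q) ∈ θ.Inv := by
  refine ⟨contMDiffOn_univ.1 (hsmooth _ _ isOpen_univ fun a => θ.smooth_frame (I a)),
    fun e he p hp => ?_⟩
  dsimp only
  rw [← hinv e he p hp]
  simp only [he.mfderiv_frame hp]

lemma symmetry_apply_mem (horb : ∀ p, θ.orbitTangent p = θ.classifyingKernel p)
    (η : θ.symmetryAlgebra) (p : M) : η.1 p ∈ θ.classifyingKernel p :=
  horb p ▸ ⟨η.1, η.2, rfl⟩

lemma contMDiff_orbitVolume (hsmooth : SmoothForm μG) :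
    ContMDiff (𝓡 n) 𝓘(ℝ, ℝ) ∞ (fun p => μG p fun j => (ξ j).1 p) :=
  contMDiffOn_univ.1 (hsmooth _ _ isOpen_univ fun j => (ξ j).2.1)

/-- A symmetry scales the orbit volume of a basis of symmetries by the trace of its adjoint. -/
lemma mvfderiv_orbitVolume (horb : ∀ p, θ.orbitTangent p = θ.classifyingKernel p)
    (hsmooth : SmoothForm μG) (hinv : θ.IsInvariantForm μG) (η : θ.symmetryAlgebra) (p : M) :
    mvfderiv (𝓡 n) (fun q => μG q fun j => (ξ j).1 q) p (η.1 p) =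
      LinearMap.trace ℝ θ.symmetryAlgebra (LieAlgebra.ad ℝ _ η) * μG p fun j => (ξ j).1 p := by
  -- The components of `μG` are invariant functions and η is tangent to the classifying kernel, so
  -- they are killed by η; differentiating an argument ξ a along η gives the bracket.
  rw [mvfderiv_form_apply (θ := θ) hsmooth isOpen_univ (fun j => (ξ j).2.1) trivial
    (fun I => symmetry_apply_mem horb η p _ (hinv.component_mem_Inv hsmooth I))
    (fun a => (⁅η, ξ a⁆ : θ.symmetryAlgebra).1 p)
    (fun a l => mlieBracket_symmetry_eq η.2 isOpen_univ (ξ a).2.1 trivial l)]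
  rw [LinearMap.trace_eq_matrix_trace ℝ ξ, Matrix.trace, Finset.sum_mul]
  refine Finset.sum_congr rfl fun a _ => ?_
  rw [Matrix.diag_apply, LinearMap.toMatrix_apply, LieAlgebra.ad_apply]
  have h1 : (⁅η, ξ a⁆ : θ.symmetryAlgebra).1 p = ∑ b, ξ.repr ⁅η, ξ a⁆ b • (ξ b).1 p := by
    have h2 := congrArg (fun ζ : θ.symmetryAlgebra => LinearMap.proj (R := ℝ) p ζ.1)
      (ξ.sum_repr ⁅η, ξ a⁆)
    simp only [Submodule.coe_sum, Submodule.coe_smul, map_sum, map_smul] at h2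
    exact h2.symm
  rw [h1]
  have h3 := (μG p).toMultilinearMap.map_update_sum Finset.univ a
    (fun b => ξ.repr ⁅η, ξ a⁆ b • (ξ b).1 p) (fun j => (ξ j).1 p)
  refine h3.trans ?_
  -- Only the diagonal coefficient of ad η survives: every other term repeats an argument.
  rw [Finset.sum_eq_single a]
  · rw [(μG p).toMultilinearMap.map_update_smul, Function.update_eq_self]
    rfl
  · intro b _ hb
    rw [(μG p).toMultilinearMap.map_update_smul]
    refine smul_eq_zero_of_right _ ((μG p).map_eq_zero_of_eq _ (i := a) (j := b) ?_ hb.symm)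
    rw [Function.update_self, Function.update_of_ne hb]
  · simp

lemma orbitTangent_eq_span (ξ : Module.Basis (Fin k) ℝ θ.symmetryAlgebra) (p : M) :
    θ.orbitTangent p = Submodule.span ℝ (Set.range fun j => (ξ j).1 p) := by
  have h : θ.orbitTangent p =
      LinearMap.range ((LinearMap.proj p).comp θ.symmetryAlgebra.subtype) := by
    rw [LinearMap.range_comp, Submodule.range_subtype]
    rfl
  rw [h, LinearMap.range_eq_map, ← ξ.span_eq, Submodule.map_span, ← Set.range_comp]
  rfl

/-- `μG` restricts to a volume form on the orbits. -/
def IsOrbitVolume (θ : Coframe n M)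
    (μG : ∀ p : M, TangentSpace (𝓡 n) p [⋀^Fin k]→L[ℝ] ℝ) : Prop :=
  ∀ p, ∃ v : Fin k → TangentSpace (𝓡 n) p, (∀ j, v j ∈ θ.orbitTangent p) ∧ μG p v ≠ 0

/-- A nonzero value of `μG` exhibits k independent vectors in the orbit tangent space, which is
spanned by the k vectors ξ j at p. -/
lemma IsOrbitVolume.linearIndependent (hvol : θ.IsOrbitVolume μG)
    (ξ : Module.Basis (Fin k) ℝ θ.symmetryAlgebra) (p : M) :
    LinearIndependent ℝ fun j => (ξ j).1 p := by
  obtain ⟨v, hv, h⟩ := hvol p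
  have h1 : LinearIndependent ℝ v := by
    by_contra h0
    exact h ((μG p).toAlternatingMap.map_linearDependent v h0)
  rw [linearIndependent_iff_card_le_finrank_span, Set.finrank, ← orbitTangent_eq_span ξ p]
  have h2 : LinearIndependent ℝ fun j => (⟨v j, hv j⟩ : θ.orbitTangent p) :=
    LinearIndependent.of_comp (θ.orbitTangent p).subtype h1
  exact h2.fintype_card_le_finrank

lemma IsOrbitVolume.finrank_orbitTangent (hvol : θ.IsOrbitVolume μG)
    (ξ : Module.Basis (Fin k) ℝ θ.symmetryAlgebra) (p : M) :
    Module.finrank ℝ (θ.orbitTangent p) = k := by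
  rw [orbitTangent_eq_span ξ p, finrank_span_eq_card (hvol.linearIndependent ξ p),
    Fintype.card_fin]

/-- Two alternating maps on a space are proportional on the span of a family of the right size. -/
lemma alternatingMap_proportional {V : Type*} [AddCommGroup V] [Module ℝ V]
    (α β : V [⋀^Fin k]→ₗ[ℝ] ℝ) {u : Fin k → V} (hu : LinearIndependent ℝ u) {v : Fin k → V}
    (hv : ∀ j, v j ∈ Submodule.span ℝ (Set.range u)) : α v * β u = α u * β v := by
  set S := Submodule.span ℝ (Set.range u)
  let b : Module.Basis (Fin k) ℝ S := Module.Basis.span hu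
  have hb : ∀ j, (b j : V) = u j := fun j => congrArg Subtype.val (Module.Basis.span_apply hu j)
  let g : S [⋀^Fin k]→ₗ[ℝ] ℝ := (β u • α - α u • β).compLinearMap S.subtype
  have hg : g = 0 := by
    rw [← g.map_basis_eq_zero_iff b]
    simp [g, hb, mul_comm]
  have h1 := congrArg (fun g : S [⋀^Fin k]→ₗ[ℝ] ℝ => g fun j => ⟨v j, hv j⟩) hg
  simp only [g, AlternatingMap.compLinearMap_apply, AlternatingMap.sub_apply,
    AlternatingMap.smul_apply, AlternatingMap.zero_apply, smul_eq_mul, Submodule.subtype_apply] at h1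
  linarith

/-- An alternating k-form on the k-dimensional orbit tangent space that vanishes on one basis
vanishes identically. -/
lemma IsOrbitVolume.orbitVolume_ne_zero (hvol : θ.IsOrbitVolume μG)
    (ξ : Module.Basis (Fin k) ℝ θ.symmetryAlgebra) (p : M) :
    (μG p fun j => (ξ j).1 p) ≠ 0 := by
  intro h0
  obtain ⟨v, hv, h⟩ := hvol p
  apply h
  simp only [orbitTangent_eq_span ξ p] at hv
  set S := Submodule.span ℝ (Set.range fun j => (ξ j).1 p)
  let b : Module.Basis (Fin k) ℝ S := Module.Basis.span (hvol.linearIndependent ξ p)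
  have hb : ∀ j, (b j : TangentSpace (𝓡 n) p) = (ξ j).1 p :=
    fun j => congrArg Subtype.val (Module.Basis.span_apply (hvol.linearIndependent ξ p) j)
  let g : S [⋀^Fin k]→ₗ[ℝ] ℝ := (μG p).toAlternatingMap.compLinearMap S.subtype
  have hg : g = 0 := by
    rw [← g.map_basis_eq_zero_iff b]
    simpa [g, hb] using h0
  exact congrArg (fun g : S [⋀^Fin k]→ₗ[ℝ] ℝ => g fun j => ⟨v j, hv j⟩) hg

lemma contMDiff_log_orbitVolume (hsmooth : SmoothForm μG) (hvol : θ.IsOrbitVolume μG)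
    (ξ : Module.Basis (Fin k) ℝ θ.symmetryAlgebra) :
    ContMDiff (𝓡 n) 𝓘(ℝ, ℝ) ∞ (fun p => Real.log |μG p fun j => (ξ j).1 p|) := by
  simp only [Real.log_abs]
  intro p
  exact ((Real.contDiffAt_log.2 (hvol.orbitVolume_ne_zero ξ p)).contMDiffAt).comp p
    (contMDiff_orbitVolume hsmooth p)

lemma mvfderiv_log_abs {f : M → ℝ} {p : M} (hf : MDifferentiableAt (𝓡 n) 𝓘(ℝ, ℝ) f p)
    (h0 : f p ≠ 0) (v : TangentSpace (𝓡 n) p) :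
    mvfderiv (𝓡 n) (fun q => Real.log |f q|) p v = (f p)⁻¹ * mvfderiv (𝓡 n) f p v := by
  simp only [Real.log_abs]
  exact mvfderiv_comp_deriv (Real.hasDerivAt_log h0) hf v

/-- The link between the modular class and unimodularity: along the orbits, d log |f| is the
character η ↦ tr (ad η). -/
lemma mvfderiv_log_orbitVolume (horb : ∀ p, θ.orbitTangent p = θ.classifyingKernel p)
    (hsmooth : SmoothForm μG) (hinv : θ.IsInvariantForm μG) (hvol : θ.IsOrbitVolume μG)
    (ξ : Module.Basis (Fin k) ℝ θ.symmetryAlgebra) (η : θ.symmetryAlgebra) (p : M) :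
    mvfderiv (𝓡 n) (fun q => Real.log |μG q fun j => (ξ j).1 q|) p (η.1 p) =
      LinearMap.trace ℝ θ.symmetryAlgebra (LieAlgebra.ad ℝ _ η) := by
  have h0 := hvol.orbitVolume_ne_zero ξ p
  rw [mvfderiv_log_abs ((contMDiff_orbitVolume hsmooth).mdifferentiable (by simp) p) h0,
    mvfderiv_orbitVolume horb hsmooth hinv]
  field_simp

lemma unimodular_of_isEmpty [IsEmpty M] : θ.Unimodular := by
  intro η
  have : Subsingleton θ.symmetryAlgebra :=
    ⟨fun a b => Subtype.ext (funext fun p => isEmptyElim p)⟩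
  rw [Subsingleton.elim (LieAlgebra.ad ℝ _ η : Module.End ℝ θ.symmetryAlgebra) 0, map_zero]

/-- Symmetries are tangent to the classifying kernel and so annihilate the invariant primitive h.
Evaluating at one point suffices, which is why empty M is treated apart. -/
lemma unimodular_of_exact (horb : ∀ p, θ.orbitTangent p = θ.classifyingKernel p)
    (hsmooth : SmoothForm μG) (hinv : θ.IsInvariantForm μG) (hvol : θ.IsOrbitVolume μG)
    (ξ : Module.Basis (Fin k) ℝ θ.symmetryAlgebra) {h : M → ℝ} (hh : h ∈ θ.Inv)
    (heq : differential (n := n) (fun q => Real.log |μG q fun j => (ξ j).1 q|) =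
      differential h) :
    θ.Unimodular := by
  obtain hM | ⟨⟨p⟩⟩ := isEmpty_or_nonempty M
  · exact unimodular_of_isEmpty (θ := θ)
  intro η
  rw [← mvfderiv_log_orbitVolume horb hsmooth hinv hvol ξ η p]
  refine Eq.trans ?_ (symmetry_apply_mem horb η p h hh)
  exact congrArg (fun L : EuclideanSpace ℝ (Fin n) →L[ℝ] ℝ => L (η.1 p)) (congrFun heq p)

/-- A function annihilated by all symmetries is constant on orbits. -/
lemma SameOrbit.apply_eq {f : M → ℝ} (hf : ContMDiff (𝓡 n) 𝓘(ℝ, ℝ) ∞ f)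
    (h : ∀ (η : θ.symmetryAlgebra) (p : M), mvfderiv (𝓡 n) f p (η.1 p) = 0) {p q : M}
    (hpq : θ.SameOrbit p q) : f p = f q := by
  induction hpq with
  | refl => rfl
  | tail _ hs ih =>
    rw [ih]
    obtain ⟨η, hη, γ, hγ, rfl, rfl⟩ := hs
    have h1 : ∀ t ∈ Set.Icc (0 : ℝ) 1,
        HasDerivWithinAt (fun s => f (γ s)) 0 (Set.Icc 0 1) t := by
      intro t ht
      have h2 := (hf.mdifferentiable (by simp) (γ t)).hasMFDerivAt.comp_hasMFDerivWithinAt t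
        (hγ t ht)
      let L : ℝ →L[ℝ] ℝ := (mfderiv (𝓡 n) 𝓘(ℝ, ℝ) f (γ t)).comp
        (ContinuousLinearMap.smulRight (1 : ℝ →L[ℝ] ℝ) (η (γ t)))
      have h3 : HasFDerivWithinAt (fun s => f (γ s)) L (Set.Icc 0 1) t :=
        hasMFDerivWithinAt_iff_hasFDerivWithinAt.1 h2
      have h4 : L 1 = 0 := by
        have h5 := h ⟨η, hη⟩ (γ t)
        refine Eq.trans ?_ h5
        exact congrArg (mfderiv (𝓡 n) 𝓘(ℝ, ℝ) f (γ t)) (one_smul ℝ (η (γ t)))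
      exact h4 ▸ h3.hasDerivWithinAt
    have h2 := constant_of_derivWithin_zero (f := fun s => f (γ s)) (a := 0) (b := 1)
      (fun t ht => (h1 t ht).differentiableWithinAt)
      (fun t ht => (h1 t ⟨ht.1, ht.2.le⟩).derivWithin
        (uniqueDiffOn_Icc zero_lt_one t ⟨ht.1, ht.2.le⟩))
    exact (h2 1 (by simp)).symm

lemma log_orbitVolume_mem_Inv (horb : ∀ p, θ.orbitTangent p = θ.classifyingKernel p)
    (hsmooth : SmoothForm μG) (hinv : θ.IsInvariantForm μG) (hvol : θ.IsOrbitVolume μG)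
    (ξ : Module.Basis (Fin k) ℝ θ.symmetryAlgebra)
    (hfib : ∀ p q, θ.classifyingMap p = θ.classifyingMap q → θ.SameOrbit p q)
    (huni : θ.Unimodular) :
    (fun q => Real.log |μG q fun j => (ξ j).1 q|) ∈ θ.Inv := by
  refine ⟨contMDiff_log_orbitVolume hsmooth hvol ξ, fun e he p hp => ?_⟩
  -- A local equivalence moves points within fibers of κ, here contained in orbits; along orbits log
  -- |f| changes by traces, which vanish.
  refine (hfib _ _ (classifyingMap_localEquivalence he hp)).apply_eq
    (contMDiff_log_orbitVolume hsmooth hvol ξ) fun η q => ?_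
  rw [mvfderiv_log_orbitVolume horb hsmooth hinv hvol ξ, huni]

end Coframe

/-! ### Contractions of alternating maps -/

section Linear

variable {V ι ι' : Type*} [AddCommGroup V] [Module ℝ V]

/-- Fixing the first group of arguments of an alternating map. -/
def alternatingRight (g : V [⋀^ι ⊕ ι']→ₗ[ℝ] ℝ) (v : ι → V) : V [⋀^ι']→ₗ[ℝ] ℝ where
  toFun w := g (Sum.elim v w)
  map_update_add' w a x y := by
    classical
    simp only [← Sum.update_elim_inr]
    exact g.map_update_add _ _ _ _
  map_update_smul' w a c x := by
    classical
    simp only [← Sum.update_elim_inr]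
    exact g.map_update_smul _ _ _ _
  map_eq_zero_of_eq' w a b h hab :=
    g.map_eq_zero_of_eq _ (i := Sum.inr a) (j := Sum.inr b) h fun h => hab (Sum.inr_injective h)

/-- Fixing the last group of arguments of an alternating map. -/
def alternatingLeft (g : V [⋀^ι ⊕ ι']→ₗ[ℝ] ℝ) (w : ι' → V) : V [⋀^ι]→ₗ[ℝ] ℝ where
  toFun v := g (Sum.elim v w)
  map_update_add' v a x y := by
    classical
    simp only [← Sum.update_elim_inl]
    exact g.map_update_add _ _ _ _
  map_update_smul' v a c x := by
    classical
    simp only [← Sum.update_elim_inl]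
    exact g.map_update_smul _ _ _ _
  map_eq_zero_of_eq' v a b h hab :=
    g.map_eq_zero_of_eq _ (i := Sum.inl a) (j := Sum.inl b) h fun h => hab (Sum.inl_injective h)

/-- An alternating map killed by the vectors of `K` depends on its arguments modulo `K` only. -/
lemma alternatingMap_congr_of_sub_mem [Fintype ι] [DecidableEq ι] (g : V [⋀^ι]→ₗ[ℝ] ℝ)
    (K : Submodule ℝ V) (hK : ∀ w : ι → V, ∀ a, w a ∈ K → g w = 0) {w w' : ι → V}
    (h : ∀ a, w a - w' a ∈ K) : g w = g w' := by
  -- The arguments are exchanged one at a time.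
  have key : ∀ s : Finset ι, g (s.piecewise w w') = g w' := by
    intro s
    induction s using Finset.induction_on with
    | empty => simp
    | insert a s ha ih =>
      rw [Finset.piecewise_insert, ← ih]
      have h1 : w a = (w a - w' a) + w' a := by abel
      rw [h1, g.map_update_add, hK _ a (by simpa using h a), zero_add]
      congr 1
      rw [Function.update_eq_self_iff]
      simp [ha]
  simpa using key Finset.univ

/-- Fixed arguments kill their span. -/
lemma alternatingRight_eq_zero [DecidableEq ι'] (g : V [⋀^ι ⊕ ι']→ₗ[ℝ] ℝ) (v : ι → V) (w : ι' → V)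
    {a : ι'} (h : w a ∈ Submodule.span ℝ (Set.range v)) : alternatingRight g v w = 0 := by
  have h1 : Submodule.span ℝ (Set.range v) ≤
      LinearMap.ker ((alternatingRight g v).toMultilinearMap.toLinearMap w a) := by
    rw [Submodule.span_le]
    rintro _ ⟨j, rfl⟩
    change g (Sum.elim v (Function.update w a (v j))) = 0
    exact g.map_eq_zero_of_eq _ (i := Sum.inl j) (j := Sum.inr a) (by simp) (by simp)
  have h2 : alternatingRight g v (Function.update w a (w a)) = 0 := h1 h
  rwa [Function.update_eq_self] at h2

end Linear

/-! ### The volume form of the coframe and its contraction with the symmetries -/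

namespace Coframe

variable {n k d : ℕ} {M : Type*} [TopologicalSpace M] [ChartedSpace (EuclideanSpace ℝ (Fin n)) M]
  [IsManifold (𝓡 n) ∞ M] (θ : Coframe n M) (σ : Fin k ⊕ Fin d ≃ Fin n)

/-- The volume form of the coframe, with arguments split into two groups. -/
def volumeForm (p : M) : TangentSpace (𝓡 n) p [⋀^Fin k ⊕ Fin d]→ₗ[ℝ] ℝ :=
  Matrix.detRowAlternating.compLinearMap
    (LinearMap.pi fun i => (θ.form (σ i) p).toLinearMap)

lemma volumeForm_apply (p : M) (u : Fin k ⊕ Fin d → TangentSpace (𝓡 n) p) :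
    θ.volumeForm σ p u = (Matrix.of fun j i => θ.form (σ i) p (u j)).det := rfl

/-- The value on the dual frame is 1, and a nonzero alternating map of top degree is nonzero on
every basis. -/
lemma volumeForm_ne_zero (p : M) {u : Fin k ⊕ Fin d → TangentSpace (𝓡 n) p}
    (hu : LinearIndependent ℝ u) : θ.volumeForm σ p u ≠ 0 := by
  have h1 : θ.volumeForm σ p (fun j => θ.frame (σ j) p) = 1 := by
    rw [volumeForm_apply]
    convert Matrix.det_one (n := Fin k ⊕ Fin d) (R := ℝ)
    ext j i
    simp [form_frame, Matrix.one_apply, eq_comm]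
  have h2 : θ.volumeForm σ p ≠ 0 := fun h => by simp [h] at h1
  have h3 : Fintype.card (Fin k ⊕ Fin d) = Module.finrank ℝ (TangentSpace (𝓡 n) p) := by
    rw [finrank_tangentSpace, Fintype.card_congr σ, Fintype.card_fin]
  have h4 := ((θ.volumeForm σ p).map_basis_ne_zero_iff (Module.Basis.mk hu
    (hu.span_eq_top_of_card_eq_finrank' h3).ge)).2 h2
  simpa using h4

lemma volumeForm_localEquivalence {e : OpenPartialHomeomorph M M} (he : θ.IsLocalEquivalence e)
    {p : M} (hp : p ∈ e.source) (u : Fin k ⊕ Fin d → TangentSpace (𝓡 n) p) :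
    θ.volumeForm σ (e p) (fun j => mfderiv (𝓡 n) (𝓡 n) e p (u j)) = θ.volumeForm σ p u := by
  simp only [volumeForm_apply, he.2.2 _ p hp]

lemma contMDiffOn_volumeForm {Z : Fin k ⊕ Fin d → ∀ p : M, TangentSpace (𝓡 n) p} {U : Set M}
    (hU : IsOpen U) (hZ : ∀ j, SmoothFieldOn (Z j) U) :
    ContMDiffOn (𝓡 n) 𝓘(ℝ, ℝ) ∞ (fun q => θ.volumeForm σ q fun j => Z j q) U :=
  contMDiffOn_det fun j i => θ.smooth (σ i) U _ hU (hZ j)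

/-- The Lie derivative of the volume form of a coframe along a dual frame field. -/
lemma mvfderiv_volumeForm {Z : Fin k ⊕ Fin d → ∀ p : M, TangentSpace (𝓡 n) p} {U : Set M}
    (hU : IsOpen U) (hZ : ∀ j, SmoothFieldOn (Z j) U) {p : M} (hp : p ∈ U) (i : Fin n) :
    mvfderiv (𝓡 n) (fun q => θ.volumeForm σ q fun j => Z j q) p (θ.frame i p) =
      (∑ l, θ.structureFunction i l l p) * θ.volumeForm σ p (fun j => Z j p) +
        ∑ j, θ.volumeForm σ p (Function.update (fun j => Z j p) j
          (mlieBracket (𝓡 n) (θ.frame i) (Z j) p)) := by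
  let N : M → Matrix (Fin k ⊕ Fin d) (Fin k ⊕ Fin d) ℝ :=
    fun q => Matrix.of fun j l => θ.form (σ l) q (Z j q)
  let C : Matrix (Fin k ⊕ Fin d) (Fin k ⊕ Fin d) ℝ :=
    Matrix.of fun m l => θ.structureFunction i (σ m) (σ l) p
  have hN : ∀ j l, ContMDiffOn (𝓡 n) 𝓘(ℝ, ℝ) ∞ (fun q => N q j l) U :=
    fun j l => θ.smooth (σ l) U _ hU (hZ j)
  have h1 := mvfderiv_det hU hp hN (θ.frame i p)
  -- Each differentiated row splits into the coordinates of the bracket and a row of N * C. The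
  -- second parts add up to the trace of C times the determinant.
  have h2 : ∀ j, (fun l => mvfderiv (𝓡 n) (fun q => N q j l) p (θ.frame i p)) =
      (fun l => θ.form (σ l) p (mlieBracket (𝓡 n) (θ.frame i) (Z j) p)) + (N p * C) j := by
    intro j
    ext l
    refine (θ.mvfderiv_form_frame hU (hZ j) hp i (σ l)).trans ?_
    rw [Pi.add_apply, Matrix.mul_apply, ← σ.sum_comp]
    congr 1
    exact Finset.sum_congr rfl fun m _ => mul_comm _ _
  have h3 : C.trace = ∑ l, θ.structureFunction i l l p := by
    rw [← σ.sum_comp]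
    rfl
  refine h1.trans ?_
  simp only [h2, Matrix.det_updateRow_add, Finset.sum_add_distrib]
  rw [sum_det_updateRow_mul, h3, add_comm]
  congr 1
  refine Finset.sum_congr rfl fun j _ => ?_
  rw [volumeForm_apply]
  congr 1
  ext a l
  by_cases ha : a = j
  · subst ha
    simp
  · simp [Matrix.updateRow_apply, ha, N]

variable {θ}

/-- The volume form contracted with a basis of symmetries. -/
def transverseForm (ξ : Module.Basis (Fin k) ℝ θ.symmetryAlgebra) (p : M) :
    TangentSpace (𝓡 n) p [⋀^Fin d]→ₗ[ℝ] ℝ :=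
  alternatingRight (θ.volumeForm σ p) fun j => (ξ j).1 p

variable (ξ : Module.Basis (Fin k) ℝ θ.symmetryAlgebra)

lemma smooth_sumElim {Y : Fin d → ∀ p : M, TangentSpace (𝓡 n) p} {U : Set M}
    (hY : ∀ a, SmoothFieldOn (Y a) U) (j : Fin k ⊕ Fin d) :
    SmoothFieldOn (Sum.elim (fun j => (ξ j).1) Y j) U := by
  rcases j with j | a
  · exact (ξ j).2.1.mono (Set.subset_univ U)
  · exact hY a

lemma transverseForm_apply (Y : Fin d → ∀ p : M, TangentSpace (𝓡 n) p) (q : M) :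
    transverseForm σ ξ q (fun a => Y a q) =
      θ.volumeForm σ q fun j => Sum.elim (fun j => (ξ j).1) Y j q := by
  change θ.volumeForm σ q _ = _
  congr 1
  ext1 j
  rcases j with j | a <;> rfl

lemma contMDiffOn_transverseForm {Y : Fin d → ∀ p : M, TangentSpace (𝓡 n) p} {U : Set M}
    (hU : IsOpen U) (hY : ∀ a, SmoothFieldOn (Y a) U) :
    ContMDiffOn (𝓡 n) 𝓘(ℝ, ℝ) ∞ (fun q => transverseForm σ ξ q fun a => Y a q) U := by
  simp only [transverseForm_apply]
  exact θ.contMDiffOn_volumeForm σ hU (smooth_sumElim ξ hY)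

lemma mvfderiv_transverseForm {Y : Fin d → ∀ p : M, TangentSpace (𝓡 n) p} {U : Set M}
    (hU : IsOpen U) (hY : ∀ a, SmoothFieldOn (Y a) U) {p : M} (hp : p ∈ U) (i : Fin n) :
    mvfderiv (𝓡 n) (fun q => transverseForm σ ξ q fun a => Y a q) p (θ.frame i p) =
      (∑ l, θ.structureFunction i l l p) * transverseForm σ ξ p (fun a => Y a p) +
        ∑ a, transverseForm σ ξ p (Function.update (fun a => Y a p) a
          (mlieBracket (𝓡 n) (θ.frame i) (Y a) p)) := by
  simp only [transverseForm_apply]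
  -- Symmetries commute with the dual frame, so the contracted slots contribute nothing.
  have hz : ∀ j : Fin k, θ.volumeForm σ p (Function.update
      (fun j => Sum.elim (fun j => (ξ j).1) Y j p) (Sum.inl j)
      (mlieBracket (𝓡 n) (θ.frame i) (Sum.elim (fun j => (ξ j).1) Y (Sum.inl j)) p)) = 0 := by
    intro j
    refine (θ.volumeForm σ p).map_coord_zero (Sum.inl j) ?_
    rw [Function.update_self, mlieBracket_swap_apply, neg_eq_zero]
    exact mlieBracket_symmetry_frame (ξ j).2 i p
  rw [θ.mvfderiv_volumeForm σ hU (smooth_sumElim ξ hY) hp i, Fintype.sum_sum_type,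
    Finset.sum_eq_zero fun j _ => hz j, zero_add]
  congr 1
  refine Finset.sum_congr rfl fun a _ => ?_
  change _ = θ.volumeForm σ p _
  congr 1
  rw [← Sum.update_elim_inr]
  congr 1
  ext1 j
  rcases j with j | a <;> rfl

variable {ξ} {μG : ∀ p : M, TangentSpace (𝓡 n) p [⋀^Fin k]→L[ℝ] ℝ}

lemma mfderiv_mem_classifyingKernel {e : OpenPartialHomeomorph M M} (he : θ.IsLocalEquivalence e)
    {p : M} (hp : p ∈ e.source) {v : TangentSpace (𝓡 n) p} (hv : v ∈ θ.classifyingKernel p) :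
    mfderiv (𝓡 n) (𝓡 n) e p v ∈ θ.classifyingKernel (e p) := fun f hf => by
  rw [Inv.mvfderiv_localEquivalence hf he hp]
  exact hv f hf

/-- The components of the contracted volume form relative to the orbit volume. -/
lemma transverseForm_div_mem_Inv (horb : ∀ p, θ.orbitTangent p = θ.classifyingKernel p)
    (hsmooth : SmoothForm μG) (hinv : θ.IsInvariantForm μG) (hvol : θ.IsOrbitVolume μG)
    (I : Fin d → Fin n) :
    (fun p => transverseForm σ ξ p (fun a => θ.frame (I a) p) / μG p fun j => (ξ j).1 p) ∈
      θ.Inv := by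
  refine ⟨contMDiffOn_univ.1 ((contMDiffOn_transverseForm σ ξ isOpen_univ
    fun a => θ.smooth_frame (I a)).div₀ (contMDiff_orbitVolume hsmooth).contMDiffOn
    fun p _ => hvol.orbitVolume_ne_zero ξ p), fun e he p hp => ?_⟩
  dsimp only
  rw [div_eq_div_iff (hvol.orbitVolume_ne_zero ξ _) (hvol.orbitVolume_ne_zero ξ _)]
  -- The images of the ξ j under e lie in the span of the ξ j at e p. The volume form with frame
  -- vectors in its last slots and `μG` are alternating of degree k on this span, so both change by
  -- the same factor.
  have h1 := alternatingMap_proportional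
    (alternatingLeft (θ.volumeForm σ (e p)) fun a => θ.frame (I a) (e p))
    (μG (e p)).toAlternatingMap (hvol.linearIndependent ξ (e p))
    (v := fun j => mfderiv (𝓡 n) (𝓡 n) e p ((ξ j).1 p)) fun j => by
      rw [← orbitTangent_eq_span ξ, horb]
      exact mfderiv_mem_classifyingKernel he hp (symmetry_apply_mem horb (ξ j) p)
  have h2 : alternatingLeft (θ.volumeForm σ (e p)) (fun a => θ.frame (I a) (e p))
      (fun j => mfderiv (𝓡 n) (𝓡 n) e p ((ξ j).1 p)) =
      transverseForm σ ξ p (fun a => θ.frame (I a) p) := by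
    refine Eq.trans ?_ (θ.volumeForm_localEquivalence σ he hp _)
    change θ.volumeForm σ (e p) _ = _
    congr 1
    ext1 j
    rcases j with j | a
    · rfl
    · exact (he.mfderiv_frame hp (I a)).symm
  have h3 : (μG (e p)).toAlternatingMap (fun j => mfderiv (𝓡 n) (𝓡 n) e p ((ξ j).1 p)) =
      μG p fun j => (ξ j).1 p := hinv e he p hp _
  rw [h2, h3] at h1
  exact h1.symm

end Coframe

/-! ### Descent of the transverse form to the classifying space -/

namespace Coframe

variable {n k d : ℕ} {M : Type*} [TopologicalSpace M] [ChartedSpace (EuclideanSpace ℝ (Fin n)) M]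
  [IsManifold (𝓡 n) ∞ M] {θ : Coframe n M}
  {X : Type*} [TopologicalSpace X] [ChartedSpace (EuclideanSpace ℝ (Fin d)) X]
  [IsManifold (𝓡 d) ∞ X]

/-- The properties of the classifying map, for any compatible smooth structure on its target. -/
structure IsClassifyingRealization (θ : Coframe n M) (D : RealizationData n d X) (κ : M → X) :
    Prop where
  surjective : Function.Surjective κ
  submersion : ∀ p, IsSubmersionAt (𝓡 n) (𝓡 d) ∞ κ p
  realization : D.IsRealization θ κ
  inv_eq : ∀ f ∈ θ.Inv, ∀ p q, κ p = κ q → f p = f q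
  localEquivalence : ∀ e : OpenPartialHomeomorph M M, θ.IsLocalEquivalence e →
    ∀ p ∈ e.source, κ (e p) = κ p
  ker : ∀ p v, mfderiv (𝓡 n) (𝓡 d) κ p v = 0 ↔ v ∈ θ.classifyingKernel p

/-- Smoothness of a function may be checked after composition with a submersion. -/
lemma contMDiffAt_of_comp_submersion {κ : M → X} {p : M}
    (hκ : IsSubmersionAt (𝓡 n) (𝓡 d) ∞ κ p) {g : X → ℝ}
    (hg : ContMDiffAt (𝓡 n) 𝓘(ℝ, ℝ) ∞ (fun q => g (κ q)) p) :
    ContMDiffAt (𝓡 d) 𝓘(ℝ, ℝ) ∞ g (κ p) := by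
  obtain ⟨s, O, hO, hpO, hsp, hs, hκs⟩ := exists_local_section hκ
  have h1 : ContMDiffAt (𝓡 d) 𝓘(ℝ, ℝ) ∞ (fun x => g (κ (s x))) (κ p) :=
    ContMDiffAt.comp (g := fun q => g (κ q)) (f := s) (I' := 𝓡 n) (κ p) (by rw [hsp]; exact hg)
      (hs.contMDiffAt (hO.mem_nhds hpO))
  refine h1.congr_of_eventuallyEq ?_
  filter_upwards [hO.mem_nhds hpO] with x hx
  rw [hκs x hx]

namespace IsClassifyingRealization

variable {D : RealizationData n d X} {κ : M → X} (h : IsClassifyingRealization θ D κ)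

include h

lemma contMDiff : ContMDiff (𝓡 n) (𝓡 d) ∞ κ := h.realization.1

lemma mdifferentiableAt (p : M) : MDifferentiableAt (𝓡 n) (𝓡 d) κ p :=
  h.contMDiff.mdifferentiable (by simp) p

lemma mfderiv_frame (i : Fin n) (p : M) :
    mfderiv (𝓡 n) (𝓡 d) κ p (θ.frame i p) = D.F i (κ p) := by
  rw [h.realization.2.2]
  simp [form_frame]

/-- Evaluating the structure equation on the dual frame shows that the functions C of any
realization are forced. -/
lemma structureFunction_eq (i j l : Fin n) (p : M) :
    θ.structureFunction i j l p = D.C i j l (κ p) := by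
  have h1 := h.realization.2.1 l Set.univ _ _ isOpen_univ (θ.smooth_frame i) (θ.smooth_frame j)
    p trivial
  rw [θ.extDerivOneForm_form isOpen_univ (θ.smooth_frame i) (θ.smooth_frame j) trivial] at h1
  have h2 := sum_Ioi_skew (fun i j => D.C i j l (κ p)) (fun i j => D.skew i j l _)
    (fun a => θ.form a p (θ.frame i p)) (fun a => θ.form a p (θ.frame j p))
  rw [h2] at h1
  simpa [form_frame] using h1

lemma topWeight_eq (i : Fin n) (p : M) :
    D.topWeight i (κ p) = -∑ l, θ.structureFunction i l l p := by
  simp only [RealizationData.topWeight, h.structureFunction_eq, Finset.sum_neg_distrib]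

lemma surjective_mfderiv (p : M) : Function.Surjective (mfderiv (𝓡 n) (𝓡 d) κ p) :=
  mfderiv_surjective_of_isSubmersionAt (h.submersion p)

/-- Surjectivity of dκ = ∑ᵢ Fᵢ θⁱ. Thus some d of the Fᵢ form a basis at a given point, and fields
on X can be lifted. -/
lemma span_F (p : M) : Submodule.span ℝ (Set.range fun i => D.F i (κ p)) = ⊤ := by
  rw [eq_top_iff]
  rintro w -
  obtain ⟨v, rfl⟩ := h.surjective_mfderiv p w
  rw [h.realization.2.2]
  exact Submodule.sum_mem _ fun i _ => Submodule.smul_mem _ _ (Submodule.subset_span ⟨i, rfl⟩)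

lemma exists_linearIndependent_F (p : M) :
    ∃ I : Fin d → Fin n, LinearIndependent ℝ fun a => D.F (I a) (κ p) := by
  obtain ⟨f, hf, -, hli⟩ := Submodule.exists_fun_fin_finrank_span_eq ℝ
    (Set.range fun i => D.F i (κ p))
  choose I hI using hf
  have hd : Module.finrank ℝ (Submodule.span ℝ (Set.range fun i => D.F i (κ p))) = d := by
    rw [h.span_F p, finrank_top, finrank_tangentSpace]
  refine ⟨fun a => I (Fin.cast hd.symm a), ?_⟩
  have h1 := hli.comp (Fin.cast hd.symm) (Fin.cast_injective _)
  have e : (fun a => D.F (I (Fin.cast hd.symm a)) (κ p)) = f ∘ Fin.cast hd.symm :=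
    funext fun a => hI _
  rw [e]
  exact h1

/-- Vector fields on the target lift locally. -/
lemma exists_lift {V : ∀ x : X, TangentSpace (𝓡 d) x} {U : Set X} (hU : IsOpen U)
    (hV : SmoothFieldOn V U) {p : M} (hp : κ p ∈ U) :
    ∃ (O : Set M) (Y : ∀ q : M, TangentSpace (𝓡 n) q), IsOpen O ∧ p ∈ O ∧ (∀ q ∈ O, κ q ∈ U) ∧
      SmoothFieldOn Y O ∧ ∀ q ∈ O, mfderiv (𝓡 n) (𝓡 d) κ q (Y q) = V (κ q) := by
  obtain ⟨I, hI⟩ := h.exists_linearIndependent_F p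
  obtain ⟨O, g, hO, hpO, hOU, hg, hgV⟩ := exists_smooth_coeff hU hp
    (fun a => (D.smooth_F (I a)).mono (Set.subset_univ U)) hV hI
  -- The coefficients are pulled back and each F (I a) is replaced by the frame field related to it.
  refine ⟨κ ⁻¹' O, fun q => ∑ a, g a (κ q) • θ.frame (I a) q,
    hO.preimage h.contMDiff.continuous, hpO, fun q hq => hOU hq,
    smoothFieldOn_sum _ (fun a => (hg a).comp h.contMDiff.contMDiffOn fun q hq => hq)
      (fun a => (θ.smooth_frame (I a)).mono (Set.subset_univ _)), fun q hq => ?_⟩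
  rw [hgV _ hq, map_sum]
  simp only [map_smul, h.mfderiv_frame]

lemma exists_lifts {V : Fin d → ∀ x : X, TangentSpace (𝓡 d) x} {U : Set X} (hU : IsOpen U)
    (hV : ∀ a, SmoothFieldOn (V a) U) {p : M} (hp : κ p ∈ U) :
    ∃ (O : Set M) (Y : Fin d → ∀ q : M, TangentSpace (𝓡 n) q), IsOpen O ∧ p ∈ O ∧
      (∀ q ∈ O, κ q ∈ U) ∧ (∀ a, SmoothFieldOn (Y a) O) ∧
      ∀ a, ∀ q ∈ O, mfderiv (𝓡 n) (𝓡 d) κ q (Y a q) = V a (κ q) := by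
  choose O Y hO hpO hOU hY hYV using fun a => h.exists_lift hU (hV a) hp
  refine ⟨κ ⁻¹' U ∩ ⋂ a, O a, Y, (hU.preimage h.contMDiff.continuous).inter
    (isOpen_iInter_of_finite hO), ⟨hp, Set.mem_iInter.2 hpO⟩, fun q hq => hq.1,
    fun a => (hY a).mono fun q hq => Set.mem_iInter.1 hq.2 a,
    fun a q hq => hYV a q (Set.mem_iInter.1 hq.2 a)⟩

lemma mfderiv_mlieBracket_frame {V : ∀ x : X, TangentSpace (𝓡 d) x} {U : Set X} (hU : IsOpen U)
    (hV : SmoothFieldOn V U) {Y : ∀ q : M, TangentSpace (𝓡 n) q} {O : Set M} (hO : IsOpen O)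
    (hOU : ∀ q ∈ O, κ q ∈ U) (hY : SmoothFieldOn Y O)
    (hYV : ∀ q ∈ O, mfderiv (𝓡 n) (𝓡 d) κ q (Y q) = V (κ q)) {p : M} (hp : p ∈ O) (i : Fin n) :
    mfderiv (𝓡 n) (𝓡 d) κ p (mlieBracket (𝓡 n) (θ.frame i) Y p) =
      mlieBracket (𝓡 d) (D.F i) V (κ p) :=
  mfderiv_mlieBracket_of_related hO hU h.contMDiff.contMDiffOn hOU
    ((θ.smooth_frame i).mono (Set.subset_univ _)) hY ((D.smooth_F i).mono (Set.subset_univ _)) hV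
    (fun q _ => h.mfderiv_frame i q) hYV hp

/-- Invariant functions descend. -/
lemma exists_descent {f : M → ℝ} (hf : f ∈ θ.Inv) :
    ∃ g : X → ℝ, ContMDiff (𝓡 d) 𝓘(ℝ, ℝ) ∞ g ∧ ∀ p, g (κ p) = f p := by
  have h1 : ∀ p, f (Function.surjInv h.surjective (κ p)) = f p := fun p =>
    h.inv_eq f hf _ _ (Function.surjInv_eq h.surjective _)
  refine ⟨fun x => f (Function.surjInv h.surjective x), fun x => ?_, h1⟩
  obtain ⟨p, rfl⟩ := h.surjective x
  refine contMDiffAt_of_comp_submersion (h.submersion p) ?_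
  simp only [h1]
  exact hf.1 p

variable (σ : Fin k ⊕ Fin d ≃ Fin n) {ξ : Module.Basis (Fin k) ℝ θ.symmetryAlgebra}
  {μG : ∀ p : M, TangentSpace (𝓡 n) p [⋀^Fin k]→L[ℝ] ℝ}

/-- The kernel of dκ is spanned by the ξ j, which already occupy the contracted slots. -/
lemma transverseForm_congr (horb : ∀ p, θ.orbitTangent p = θ.classifyingKernel p) {p : M}
    {w w' : Fin d → TangentSpace (𝓡 n) p}
    (hw : ∀ a, mfderiv (𝓡 n) (𝓡 d) κ p (w a) = mfderiv (𝓡 n) (𝓡 d) κ p (w' a)) :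
    transverseForm σ ξ p w = transverseForm σ ξ p w' := by
  refine alternatingMap_congr_of_sub_mem _ (θ.classifyingKernel p) (fun w a ha => ?_) fun a => ?_
  · refine alternatingRight_eq_zero _ _ w (a := a) ?_
    rwa [← orbitTangent_eq_span ξ p, horb]
  · rw [← h.ker, map_sub, hw, sub_self]

/-- Lifting a basis through a linear right inverse of dκ complements the ξ j to a basis of the
tangent space, where the volume form is nonzero. -/
lemma transverseForm_ne_zero (horb : ∀ p, θ.orbitTangent p = θ.classifyingKernel p)
    (hvol : θ.IsOrbitVolume μG) (p : M) :
    transverseForm (d := d) σ ξ p ≠ 0 := by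
  obtain ⟨s, hs⟩ := LinearMap.exists_rightInverse_of_surjective
    (mfderiv (𝓡 n) (𝓡 d) κ p).toLinearMap (LinearMap.range_eq_top.2 (h.surjective_mfderiv p))
  have hs' : ∀ w, mfderiv (𝓡 n) (𝓡 d) κ p (s w) = w := fun w => LinearMap.congr_fun hs w
  let b : Module.Basis (Fin d) ℝ (TangentSpace (𝓡 d) (κ p)) :=
    (EuclideanSpace.basisFun (Fin d) ℝ).toBasis
  have hsinj : Function.Injective s := Function.LeftInverse.injective hs'
  have h1 : LinearIndependent ℝ (Sum.elim (fun j => (ξ j).1 p) fun a => s (b a)) := by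
    refine (hvol.linearIndependent ξ p).sum_type
      (b.linearIndependent.map' s (LinearMap.ker_eq_bot.2 hsinj)) ?_
    rw [← orbitTangent_eq_span ξ p, horb, Submodule.disjoint_def]
    intro v hv hv'
    have h2 : Submodule.span ℝ (Set.range fun a => s (b a)) ≤ LinearMap.range s := by
      rw [Submodule.span_le]
      rintro _ ⟨a, rfl⟩
      exact ⟨_, rfl⟩
    obtain ⟨w, rfl⟩ := h2 hv'
    rw [← h.ker, hs'] at hv
    rw [hv, map_zero]
  intro h0
  refine θ.volumeForm_ne_zero σ p h1 ?_
  exact congrArg (fun g : TangentSpace (𝓡 n) p [⋀^Fin d]→ₗ[ℝ] ℝ => g fun a => s (b a)) h0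

/-- The transverse volume form on the target determined by an invariant orbit volume. -/
lemma exists_descended_form (horb : ∀ p, θ.orbitTangent p = θ.classifyingKernel p)
    (hsmooth : SmoothForm μG) (hinv : θ.IsInvariantForm μG) (hvol : θ.IsOrbitVolume μG) :
    ∃ ν : ∀ x : X, TangentSpace (𝓡 d) x [⋀^Fin d]→L[ℝ] ℝ,
      ∀ p (w : Fin d → TangentSpace (𝓡 n) p),
        (μG p fun j => (ξ j).1 p) * ν (κ p) (fun a => mfderiv (𝓡 n) (𝓡 d) κ p (w a)) =
          transverseForm σ ξ p w := by
  have key : ∀ x : X, ∃ ν : TangentSpace (𝓡 d) x [⋀^Fin d]→L[ℝ] ℝ, ∀ p, κ p = x →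
      ∀ I : Fin d → Fin n, ν (fun a => D.F (I a) x) =
        transverseForm σ ξ p (fun a => θ.frame (I a) p) / μG p fun j => (ξ j).1 p := by
    intro x
    obtain ⟨p, rfl⟩ := h.surjective x
    obtain ⟨s, hs⟩ := LinearMap.exists_rightInverse_of_surjective
      (mfderiv (𝓡 n) (𝓡 d) κ p).toLinearMap (LinearMap.range_eq_top.2 (h.surjective_mfderiv p))
    have hs' : ∀ w, mfderiv (𝓡 n) (𝓡 d) κ p (s w) = w := fun w => LinearMap.congr_fun hs w
    let g : TangentSpace (𝓡 d) (κ p) [⋀^Fin d]→ₗ[ℝ] ℝ :=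
      (μG p fun j => (ξ j).1 p)⁻¹ • (transverseForm σ ξ p).compLinearMap s
    have hg : Continuous g := by
      let s' : EuclideanSpace ℝ (Fin d) →ₗ[ℝ] EuclideanSpace ℝ (Fin n) := s
      have hs' : Continuous s' := s'.continuous_of_finiteDimensional
      let u : (Fin d → EuclideanSpace ℝ (Fin d)) → Fin k ⊕ Fin d → EuclideanSpace ℝ (Fin n) :=
        fun w => Sum.elim (fun j => (ξ j).1 p) fun a => s' (w a)
      have hu : ∀ j, Continuous fun w => u w j := by
        rintro (j | a)
        · exact continuous_const
        · exact hs'.comp (continuous_apply a)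
      have hA : Continuous fun w => Matrix.of fun j i => θ.form (σ i) p (u w j) :=
        continuous_matrix fun j i => (θ.form (σ i) p).continuous.comp (hu j)
      have hd := Continuous.const_smul hA.matrix_det (μG p fun j => (ξ j).1 p)⁻¹
      refine hd.congr fun w => ?_
      rfl
    refine ⟨⟨⟨g.toMultilinearMap, hg⟩, g.map_eq_zero_of_eq'⟩, fun q hq I => ?_⟩
    -- The components of T / f are invariant functions, so the form built at p has the same
    -- components at any other point of the fiber.
    have h1 := h.inv_eq _ (transverseForm_div_mem_Inv (ξ := ξ) σ horb hsmooth hinv hvol I) _ _ hq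
    refine Eq.trans ?_ h1.symm
    change (μG p fun j => (ξ j).1 p)⁻¹ * transverseForm σ ξ p (fun a => s (D.F (I a) (κ p))) = _
    rw [h.transverseForm_congr σ horb (w' := fun a => θ.frame (I a) p)
      fun a => by rw [hs', h.mfderiv_frame], div_eq_inv_mul]
  choose ν hν using key
  refine ⟨ν, fun p w => ?_⟩
  let L : TangentSpace (𝓡 n) p →ₗ[ℝ] TangentSpace (𝓡 d) (κ p) :=
    (mfderiv (𝓡 n) (𝓡 d) κ p).toLinearMap
  have h1 : (μG p fun j => (ξ j).1 p) • (ν (κ p)).toAlternatingMap.compLinearMap L =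
      transverseForm σ ξ p := by
    let b : Module.Basis (Fin n) ℝ (TangentSpace (𝓡 n) p) :=
      (Pi.basisFun ℝ (Fin n)).map (θ.coordEquiv p).symm
    have hb : ∀ i, b i = θ.frame i p := fun i => by
      rw [Module.Basis.map_apply, Pi.basisFun_apply]; rfl
    refine Module.Basis.ext_alternating b fun I _ => ?_
    simp only [hb]
    change (μG p fun j => (ξ j).1 p) *
      ν (κ p) (fun a => mfderiv (𝓡 n) (𝓡 d) κ p (θ.frame (I a) p)) = _
    simp only [h.mfderiv_frame]
    rw [hν _ p rfl, mul_div_cancel₀ _ (hvol.orbitVolume_ne_zero ξ p)]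
  exact congrArg (fun g : TangentSpace (𝓡 n) p [⋀^Fin d]→ₗ[ℝ] ℝ => g w) h1

end IsClassifyingRealization

end Coframe

/-! ### Modular cocycles -/

namespace Coframe

/-- In top degree, d independent vectors form a basis, and a form vanishing on a basis is zero. -/
lemma topForm_apply_ne_zero {d : ℕ} {X : Type*} [TopologicalSpace X]
    [ChartedSpace (EuclideanSpace ℝ (Fin d)) X] [IsManifold (𝓡 d) ∞ X] {x : X}
    {τ : TangentSpace (𝓡 d) x [⋀^Fin d]→L[ℝ] ℝ} (hτ : τ ≠ 0) {u : Fin d → TangentSpace (𝓡 d) x}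
    (hu : LinearIndependent ℝ u) : τ u ≠ 0 := by
  have h3 : Fintype.card (Fin d) = Module.finrank ℝ (TangentSpace (𝓡 d) x) := by
    rw [finrank_tangentSpace, Fintype.card_fin]
  have h2 : τ.toAlternatingMap ≠ 0 := fun h0 =>
    hτ (ContinuousAlternatingMap.toAlternatingMap_injective h0)
  have h4 := (τ.toAlternatingMap.map_basis_ne_zero_iff (Module.Basis.mk hu
    (hu.span_eq_top_of_card_eq_finrank' h3).ge)).2 h2
  simpa using h4

namespace IsClassifyingRealization

variable {n k d : ℕ} {M : Type*} [TopologicalSpace M] [ChartedSpace (EuclideanSpace ℝ (Fin n)) M]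
  [IsManifold (𝓡 n) ∞ M] {θ : Coframe n M}
  {X : Type*} [TopologicalSpace X] [ChartedSpace (EuclideanSpace ℝ (Fin d)) X]
  [IsManifold (𝓡 d) ∞ X]
  {D : RealizationData n d X} {κ : M → X} (h : IsClassifyingRealization θ D κ)
  (σ : Fin k ⊕ Fin d ≃ Fin n) {ξ : Module.Basis (Fin k) ℝ θ.symmetryAlgebra}
  {μG : ∀ p : M, TangentSpace (𝓡 n) p [⋀^Fin k]→L[ℝ] ℝ}

include h

lemma exists_transverseForm_frame_ne_zero
    (horb : ∀ p, θ.orbitTangent p = θ.classifyingKernel p) (hvol : θ.IsOrbitVolume μG) (p : M) :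
    ∃ I : Fin d → Fin n, transverseForm σ ξ p (fun a => θ.frame (I a) p) ≠ 0 := by
  by_contra! h0
  refine h.transverseForm_ne_zero σ (ξ := ξ) horb hvol p ?_
  let b : Module.Basis (Fin n) ℝ (TangentSpace (𝓡 n) p) :=
    (Pi.basisFun ℝ (Fin n)).map (θ.coordEquiv p).symm
  have hb : ∀ i, b i = θ.frame i p := fun i => by
    rw [Module.Basis.map_apply, Pi.basisFun_apply]; rfl
  refine Module.Basis.ext_alternating b fun I _ => ?_
  simp only [hb]
  exact h0 I

/-- The frame derivatives of the orbit volume, relative to it, are invariant. -/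
lemma logarithmic_derivative_mem_Inv (σ : Fin k ⊕ Fin d ≃ Fin n)
    (horb : ∀ p, θ.orbitTangent p = θ.classifyingKernel p)
    (hsmooth : SmoothForm μG) (hinv : θ.IsInvariantForm μG) (hvol : θ.IsOrbitVolume μG)
    (ξ : Module.Basis (Fin k) ℝ θ.symmetryAlgebra) (i : Fin n) :
    (fun p => (μG p fun j => (ξ j).1 p)⁻¹ *
      mvfderiv (𝓡 n) (fun q => μG q fun j => (ξ j).1 q) p (θ.frame i p)) ∈ θ.Inv := by
  set f : M → ℝ := fun p => μG p fun j => (ξ j).1 p with hf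
  have hf0 : ∀ p, f p ≠ 0 := hvol.orbitVolume_ne_zero ξ
  have hfs : ContMDiff (𝓡 n) 𝓘(ℝ, ℝ) ∞ f := contMDiff_orbitVolume hsmooth
  let ρ : (Fin d → Fin n) → M → ℝ := fun I p =>
    transverseForm σ ξ p (fun a => θ.frame (I a) p) / f p
  have hρ : ∀ I, ρ I ∈ θ.Inv := transverseForm_div_mem_Inv σ horb hsmooth hinv hvol
  have hT : ∀ I q, transverseForm σ ξ q (fun a => θ.frame (I a) q) = ρ I q * f q := fun I q =>
    (div_mul_cancel₀ _ (hf0 q)).symm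
  -- The Leibniz rule for T = ρ f along the frame field. Everything on the right is built from
  -- structure functions, the ρ's and frame derivatives of the ρ's, all of them invariant.
  have key : ∀ I p, ρ I p * ((f p)⁻¹ * mvfderiv (𝓡 n) f p (θ.frame i p)) =
      (∑ l, θ.structureFunction i l l p) * ρ I p +
        ∑ a, ∑ l, -θ.structureFunction i (I a) l p * ρ (Function.update I a l) p -
        mvfderiv (𝓡 n) (ρ I) p (θ.frame i p) := by
    intro I p
    have h1 := mvfderiv_transverseForm σ ξ isOpen_univ (fun a => θ.smooth_frame (I a))
      (Set.mem_univ p) i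
    have h2 : ∀ a, transverseForm σ ξ p (Function.update (fun a => θ.frame (I a) p) a
        (mlieBracket (𝓡 n) (θ.frame i) (θ.frame (I a)) p)) =
        ∑ l, -θ.structureFunction i (I a) l p * (ρ (Function.update I a l) p * f p) := by
      intro a
      rw [mlieBracket_frame, AlternatingMap.map_update_sum]
      refine Finset.sum_congr rfl fun l _ => ?_
      rw [AlternatingMap.map_update_smul, smul_eq_mul, ← hT]
      congr 2
      ext1 b
      by_cases hb : b = a
      · subst hb; simp
      · simp [hb]
    simp only [h2, hT] at h1
    rw [mvfderiv_fun_mul_apply (Inv.mdifferentiableAt (hρ I) p)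
      (hfs.mdifferentiable (by simp) p)] at h1
    have h3 : ∑ a, ∑ l, -θ.structureFunction i (I a) l p * (ρ (Function.update I a l) p * f p) =
        f p * ∑ a, ∑ l, -θ.structureFunction i (I a) l p * ρ (Function.update I a l) p := by
      rw [Finset.mul_sum]
      refine Finset.sum_congr rfl fun a _ => ?_
      rw [Finset.mul_sum]
      exact Finset.sum_congr rfl fun l _ => by ring
    rw [h3] at h1
    refine mul_left_cancel₀ (hf0 p) ?_
    linear_combination h1 + ρ I p * mvfderiv (𝓡 n) f p (θ.frame i p) * mul_inv_cancel₀ (hf0 p)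
  refine ⟨?_, fun e he p hp => ?_⟩
  · have h1 := contMDiffOn_mvfderiv (θ.smooth_frame i) hfs.contMDiffOn isOpen_univ
    exact (hfs.inv₀ hf0).mul (contMDiffOn_univ.1 h1)
  -- Some component of T is nonzero at p, and the corresponding ρ can be cancelled.
  · obtain ⟨I, hI⟩ := h.exists_transverseForm_frame_ne_zero σ (ξ := ξ) horb hvol p
    have hI' : ρ I p ≠ 0 := div_ne_zero hI (hf0 p)
    refine mul_left_cancel₀ hI' ?_
    rw [← (hρ I).2 e he p hp, key, (hρ I).2 e he p hp, key]
    simp only [(structureFunction_mem_Inv θ _ _ _).2 e he p hp, (hρ _).2 e he p hp]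
    exact congrArg _ ((Inv.frame_derivative (hρ I) i).2 e he p hp)

lemma differential_log_orbitVolume_mem (σ : Fin k ⊕ Fin d ≃ Fin n)
    (horb : ∀ p, θ.orbitTangent p = θ.classifyingKernel p)
    (hsmooth : SmoothForm μG) (hinv : θ.IsInvariantForm μG) (hvol : θ.IsOrbitVolume μG)
    (ξ : Module.Basis (Fin k) ℝ θ.symmetryAlgebra) :
    differential (n := n) (fun q => Real.log |μG q fun j => (ξ j).1 q|) ∈ θ.closedInvariant := by
  refine differential_mem_closedInvariant (contMDiff_log_orbitVolume hsmooth hvol ξ)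
    fun e he p hp i => ?_
  have hfs := (contMDiff_orbitVolume (ξ := ξ) hsmooth).mdifferentiable (by simp)
  rw [mvfderiv_log_abs (hfs _) (hvol.orbitVolume_ne_zero ξ _),
    mvfderiv_log_abs (hfs _) (hvol.orbitVolume_ne_zero ξ _)]
  exact (h.logarithmic_derivative_mem_Inv σ horb hsmooth hinv hvol ξ i).2 e he p hp

/-- The transverse form is a section of the line bundle, with modular cocycle given by the orbit
volume. -/
lemma exists_modularCocycle (σ : Fin k ⊕ Fin d ≃ Fin n)
    (horb : ∀ p, θ.orbitTangent p = θ.classifyingKernel p)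
    (hsmooth : SmoothForm μG) (hinv : θ.IsInvariantForm μG) (hvol : θ.IsOrbitVolume μG)
    (ξ : Module.Basis (Fin k) ℝ θ.symmetryAlgebra) :
    ∃ (ν : ∀ x : X, TangentSpace (𝓡 d) x [⋀^Fin d]→L[ℝ] ℝ) (c : Fin n → X → ℝ),
      RealizationData.IsNonvanishingSection ν ∧ D.IsModularCocycle ν c ∧
      θ.pullbackForm κ c =
        -differential (n := n) (fun q => Real.log |μG q fun j => (ξ j).1 q|) := by
  obtain ⟨ν, hν⟩ := h.exists_descended_form σ (ξ := ξ) horb hsmooth hinv hvol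
  choose c hc hcκ using fun i =>
    h.exists_descent (h.logarithmic_derivative_mem_Inv σ horb hsmooth hinv hvol ξ i)
  set f : M → ℝ := fun p => μG p fun j => (ξ j).1 p with hf
  have hf0 : ∀ p, f p ≠ 0 := hvol.orbitVolume_ne_zero ξ
  have hfs : ContMDiff (𝓡 n) 𝓘(ℝ, ℝ) ∞ f := contMDiff_orbitVolume hsmooth
  have hνs : SmoothForm ν := by
    intro U V hU hV x hx
    obtain ⟨p, rfl⟩ := h.surjective x
    -- Smoothness is tested after pullback by κ, where the value of ν on V becomes T / f on the
    -- lifts Y.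
    obtain ⟨O, Y, hO, hpO, hOU, hY, hYV⟩ := h.exists_lifts hU hV hx
    refine (contMDiffAt_of_comp_submersion (h.submersion p) ?_).contMDiffWithinAt
    have h1 := ((contMDiffOn_transverseForm σ ξ hO hY).div₀ hfs.contMDiffOn
      fun q _ => hf0 q).contMDiffAt (hO.mem_nhds hpO)
    refine h1.congr_of_eventuallyEq ?_
    filter_upwards [hO.mem_nhds hpO] with q hq
    simp only [← hYV _ q hq]
    refine (eq_div_iff (hf0 q)).2 ?_
    rw [mul_comm]
    exact hν q _
  refine ⟨ν, fun i x => -c i x, ⟨hνs, fun x hx => ?_⟩, ⟨fun i => (hc i).neg, ?_⟩, ?_⟩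
  · obtain ⟨p, rfl⟩ := h.surjective x
    refine h.transverseForm_ne_zero σ (ξ := ξ) horb hvol p (AlternatingMap.ext fun w => ?_)
    rw [← hν, hx]
    exact mul_zero _
  · intro i U V hU hV x hx
    obtain ⟨p, rfl⟩ := h.surjective x
    obtain ⟨O, Y, hO, hpO, hOU, hY, hYV⟩ := h.exists_lifts hU hV hx
    let N : X → ℝ := fun x => ν x fun j => V j x
    have hN : ContMDiffOn (𝓡 d) 𝓘(ℝ, ℝ) ∞ N U := hνs U V hU hV
    have hNd := mdifferentiableAt_of_contMDiffOn hN hU hx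
    have hNκ : MDifferentiableAt (𝓡 n) 𝓘(ℝ, ℝ) (fun q => N (κ q)) p :=
      hNd.comp p (h.mdifferentiableAt p)
    -- This identity is differentiated along the i-th frame field. Brackets with the lifts project
    -- to brackets with F i, and the structure trace cancels against `topWeight`.
    have h1 : (fun q => f q * N (κ q)) =ᶠ[𝓝 p] fun q => transverseForm σ ξ q fun a => Y a q := by
      filter_upwards [hO.mem_nhds hpO] with q hq
      rw [← hν]
      simp only [hYV _ q hq]
      rfl
    have h2 := congrArg (fun g : TangentSpace (𝓡 n) p →L[ℝ] ℝ => g (θ.frame i p))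
      (mvfderiv_congr h1)
    rw [mvfderiv_fun_mul_apply (hfs.mdifferentiable (by simp) p) hNκ,
      mvfderiv_comp_map hNd (h.mdifferentiableAt p), h.mfderiv_frame,
      mvfderiv_transverseForm σ ξ hO hY hpO i] at h2
    have h3 : ∀ a, transverseForm σ ξ p (Function.update (fun a => Y a p) a
        (mlieBracket (𝓡 n) (θ.frame i) (Y a) p)) =
        f p * ν (κ p) (Function.update (fun j => V j (κ p)) a
          (mlieBracket (𝓡 d) (D.F i) (V a) (κ p))) := by
      intro a
      rw [← hν]
      congr 2
      ext1 b
      by_cases hb : b = a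
      · subst hb
        simp only [Function.update_self]
        exact h.mfderiv_mlieBracket_frame hU (hV b) hO hOU (hY b) (hYV b) hpO i
      · simp only [Function.update_of_ne hb]
        exact hYV b p hpO
    have h4 : transverseForm σ ξ p (fun a => Y a p) = f p * N (κ p) := (h1.self_of_nhds).symm
    simp only [h3, h4, ← Finset.mul_sum] at h2
    rw [h.topWeight_eq]
    beta_reduce
    rw [hcκ]
    unfold lieDerivForm
    refine mul_left_cancel₀ (hf0 p) ?_
    change f p * (-(∑ l, θ.structureFunction i l l p) * N (κ p) +
      (mvfderiv (𝓡 d) N (κ p) (D.F i (κ p)) - _)) = f p * (-((f p)⁻¹ * _) * N (κ p))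
    linear_combination h2 + N (κ p) * mvfderiv (𝓡 n) f p (θ.frame i p) * mul_inv_cancel₀ (hf0 p)
  · funext p
    refine ContinuousLinearMap.ext fun v => ?_
    change _ = -(mvfderiv (𝓡 n) (fun q => Real.log |f q|) p v)
    rw [mvfderiv_log_abs (hfs.mdifferentiable (by simp) p) (hf0 p)]
    conv_rhs => rw [θ.eq_sum_frame v]
    simp only [pullbackForm, map_sum, map_smul, hcκ, Finset.mul_sum, ← Finset.sum_neg_distrib,
      _root_.sum_apply, _root_.smul_apply, smul_eq_mul]
    exact Finset.sum_congr rfl fun i _ => by ring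

/-- Two modular cocycles differ by an exact form. -/
lemma pullbackForm_sub_exact {ν ν' : ∀ x : X, TangentSpace (𝓡 d) x [⋀^Fin d]→L[ℝ] ℝ}
    {c c' : Fin n → X → ℝ} (hν : RealizationData.IsNonvanishingSection ν)
    (hν' : RealizationData.IsNonvanishingSection ν') (hc : D.IsModularCocycle ν c)
    (hc' : D.IsModularCocycle ν' c') :
    ∃ φ ∈ θ.Inv, θ.pullbackForm κ c' = θ.pullbackForm κ c + differential φ := by
  have hI : ∀ x : X, ∃ I : Fin d → Fin n, LinearIndependent ℝ fun a => D.F (I a) x := fun x => by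
    obtain ⟨p, rfl⟩ := h.surjective x
    exact h.exists_linearIndependent_F p
  -- Top forms at a point are proportional; g is the ratio ν' / ν.
  have hex : ∀ x : X, ∃ g : ℝ, g ≠ 0 ∧ ∀ w, ν' x w = g * ν x w := by
    intro x
    obtain ⟨I, hI⟩ := hI x
    refine ⟨ν' x (fun a => D.F (I a) x) / ν x (fun a => D.F (I a) x),
      div_ne_zero (topForm_apply_ne_zero (hν'.2 _) hI) (topForm_apply_ne_zero (hν.2 _) hI),
      fun w => ?_⟩
    rw [div_mul_eq_mul_div, eq_div_iff (topForm_apply_ne_zero (hν.2 _) hI)]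
    refine alternatingMap_proportional (ν' x).toAlternatingMap (ν x).toAlternatingMap hI
      fun j => ?_
    rw [hI.span_eq_top_of_card_eq_finrank' (by rw [Fintype.card_fin, finrank_tangentSpace])]
    trivial
  choose g hg0 hg using hex
  have hs : ∀ {τ : ∀ x : X, TangentSpace (𝓡 d) x [⋀^Fin d]→L[ℝ] ℝ} (_ : SmoothForm τ)
      (I : Fin d → Fin n), ContMDiff (𝓡 d) 𝓘(ℝ, ℝ) ∞ fun x => τ x fun a => D.F (I a) x :=
    fun hτ I => contMDiffOn_univ.1 (hτ _ _ isOpen_univ fun a => D.smooth_F (I a))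
  have hgs : ContMDiff (𝓡 d) 𝓘(ℝ, ℝ) ∞ g := by
    intro x
    obtain ⟨I, hI⟩ := hI x
    have h1 := topForm_apply_ne_zero (hν.2 x) hI
    refine ((hs hν'.1 I x).div₀ (hs hν.1 I x) h1).congr_of_eventuallyEq ?_
    filter_upwards [(hs hν.1 I).continuous.continuousAt.eventually_ne h1] with y hy
    exact (eq_div_iff hy).2 (hg y _).symm
  have hgd : ∀ x, MDifferentiableAt (𝓡 d) 𝓘(ℝ, ℝ) g x := hgs.mdifferentiable (by simp)
  -- Subtracting g times the equation for ν from the one for g ν cancels the weight and bracket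
  -- terms and leaves the derivative of g.
  have hgF : ∀ i x, mvfderiv (𝓡 d) g x (D.F i x) = (c' i x - c i x) * g x := by
    intro i x
    obtain ⟨I, hI⟩ := hI x
    have h1 := topForm_apply_ne_zero (hν.2 x) hI
    have h2 := hc.2 i Set.univ (fun a => D.F (I a)) isOpen_univ (fun a => D.smooth_F (I a)) x
      trivial
    have h3 := hc'.2 i Set.univ (fun a => D.F (I a)) isOpen_univ (fun a => D.smooth_F (I a)) x
      trivial
    simp only [lieDerivForm, hg] at h2 h3
    rw [mvfderiv_fun_mul_apply (hgd x) ((hs hν.1 I).mdifferentiable (by simp) x),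
      ← Finset.mul_sum] at h3
    refine mul_left_cancel₀ h1 ?_
    linear_combination h3 - g x * h2
  refine ⟨fun p => Real.log |g (κ p)|, ⟨fun p => ?_, fun e he p hp => ?_⟩, ?_⟩
  · have h1 : ContMDiffAt (𝓡 n) 𝓘(ℝ, ℝ) ∞ (fun q => g (κ q)) p :=
      (hgs.comp h.contMDiff) p
    simp only [Real.log_abs]
    exact (Real.contDiffAt_log.2 (hg0 (κ p))).contMDiffAt.comp p h1
  · dsimp only
    rw [h.localEquivalence e he p hp]
  · funext p
    refine ContinuousLinearMap.ext fun v => ?_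
    have h1 : MDifferentiableAt (𝓡 n) 𝓘(ℝ, ℝ) (fun q => g (κ q)) p :=
      ((hgs.comp h.contMDiff).mdifferentiable (by simp)) p
    rw [OneForm.add_apply]
    change _ = _ + mvfderiv (𝓡 n) (fun q => Real.log |g (κ q)|) p v
    rw [mvfderiv_log_abs h1 (hg0 _), mvfderiv_comp_map (hgd _) (h.mdifferentiableAt p),
      h.realization.2.2]
    simp only [pullbackForm, map_sum, map_smul, hgF, Finset.mul_sum, ← Finset.sum_add_distrib,
      _root_.sum_apply, _root_.smul_apply, smul_eq_mul]
    refine Finset.sum_congr rfl fun i _ => ?_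
    linear_combination (-(θ.form i p v * (c' i (κ p) - c i (κ p)))) * inv_mul_cancel₀ (hg0 (κ p))

end IsClassifyingRealization

end Coframe

/-! ### Straightening a map with surjective derivative -/

/-- A map with surjective derivative becomes a projection in suitable coordinates. -/
lemma exists_straightening {E A B : Type*} [NormedAddCommGroup E] [NormedSpace ℝ E]
    [CompleteSpace E] [NormedAddCommGroup A] [NormedSpace ℝ A] [NormedAddCommGroup B]
    [NormedSpace ℝ B] {F : E → A} {T : Set E} (hT : IsOpen T) (hF : ContDiffOn ℝ ∞ F T) {a : E}
    (ha : a ∈ T) (L : E ≃L[ℝ] A × B)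
    (hL : HasFDerivAt F ((ContinuousLinearMap.fst ℝ A B).comp (L : E →L[ℝ] A × B)) a) :
    ∃ G : OpenPartialHomeomorph E E, a ∈ G.source ∧ G.source ⊆ T ∧ ContDiffOn ℝ ∞ G G.source ∧
      ContDiffOn ℝ ∞ G.symm G.target ∧ ∀ x ∈ G.source, (L (G x)).1 = F x := by
  -- The first component of L is replaced by F and the second is kept; by `hL` the derivative at a
  -- is the identity.
  let Ψ : E → E := fun x => L.symm (F x, (L x).2)
  have hΨ : ContDiffOn ℝ ∞ Ψ T :=
    L.symm.contDiff.comp_contDiffOn (hF.prodMk (contDiff_snd.comp L.contDiff).contDiffOn)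
  have hΨa : HasFDerivAt Ψ (ContinuousLinearEquiv.refl ℝ E : E →L[ℝ] E) a := by
    have h1 := (L.symm : A × B →L[ℝ] E).hasFDerivAt.comp a (hL.prodMk
      ((ContinuousLinearMap.snd ℝ A B).comp (L : E →L[ℝ] A × B)).hasFDerivAt)
    refine h1.congr_fderiv ?_
    ext v
    simp
  have hΨat : ContDiffAt ℝ ∞ Ψ a := hΨ.contDiffAt (hT.mem_nhds ha)
  have hne : (∞ : WithTop ℕ∞) ≠ 0 := by simp
  let P := hΨat.toOpenPartialHomeomorph Ψ hΨa hne
  have hP : ∀ x, P x = Ψ x := fun x => rfl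
  -- The inverse has to be smooth on the whole target, so the domain is cut down to the open set
  -- where the derivative is invertible.
  let W : Set E := T ∩ fderiv ℝ Ψ ⁻¹' Set.range ((↑) : (E ≃L[ℝ] E) → E →L[ℝ] E)
  have hW : IsOpen W := (hΨ.continuousOn_fderiv_of_isOpen hT (by simp)).isOpen_inter_preimage hT
    ContinuousLinearEquiv.isOpen
  have haW : a ∈ W := ⟨ha, ⟨_, hΨa.fderiv.symm⟩⟩
  refine ⟨P.restrOpen W hW, ⟨hΨat.mem_toOpenPartialHomeomorph_source hΨa hne, haW⟩,
    fun x hx => hx.2.1, fun x hx => (hΨ.mono fun y hy => hy.2.1) x hx, fun y hy => ?_,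
    fun x _ => ?_⟩
  · have hx := (P.restrOpen W hW).map_target hy
    set x := (P.restrOpen W hW).symm y
    obtain ⟨e, he⟩ := hx.2.2
    have h1 : ContDiffAt ℝ ∞ Ψ x := hΨ.contDiffAt (hT.mem_nhds hx.2.1)
    have h2 : HasFDerivAt (P.restrOpen W hW) (e : E →L[ℝ] E) x := by
      rw [he]
      exact (h1.differentiableAt (by simp)).hasFDerivAt
    exact ((P.restrOpen W hW).contDiffAt_symm hy h2 h1).contDiffWithinAt
  · change (L (L.symm (F x, (L x).2))).1 = F x
    simp

/-- A surjective linear map is the first component of a linear isomorphism. -/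
lemma exists_equivProd {E A B : Type*} [NormedAddCommGroup E] [NormedSpace ℝ E]
    [FiniteDimensional ℝ E] [NormedAddCommGroup A] [NormedSpace ℝ A] [FiniteDimensional ℝ A]
    [NormedAddCommGroup B] [NormedSpace ℝ B] [FiniteDimensional ℝ B] (f : E →L[ℝ] A)
    (hf : Function.Surjective f)
    (hd : Module.finrank ℝ E = Module.finrank ℝ A + Module.finrank ℝ B) :
    ∃ L : E ≃L[ℝ] A × B, (ContinuousLinearMap.fst ℝ A B).comp (L : E →L[ℝ] A × B) = f := by
  obtain ⟨q, hq⟩ := Submodule.exists_isCompl (LinearMap.ker f.toLinearMap)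
  have h1 : Module.finrank ℝ (LinearMap.ker f.toLinearMap) = Module.finrank ℝ B := by
    have h2 := f.toLinearMap.finrank_range_add_finrank_ker
    rw [LinearMap.range_eq_top.2 hf, finrank_top] at h2
    omega
  let g : E →ₗ[ℝ] B := (LinearEquiv.ofFinrankEq _ _ h1).toLinearMap ∘ₗ
    Submodule.projectionOnto _ _ hq
  have hg : LinearMap.range g = ⊤ := by
    rw [LinearMap.range_comp, Submodule.range_projectionOnto, Submodule.map_top,
      LinearEquiv.range]
  have hgk : LinearMap.ker g = q := by
    rw [LinearMap.ker_comp, LinearEquiv.ker]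
    exact Submodule.ker_projectionOnto hq
  let L := LinearMap.equivProdOfSurjectiveOfIsCompl f.toLinearMap g (LinearMap.range_eq_top.2 hf)
    hg (by rwa [hgk])
  exact ⟨L.toContinuousLinearEquiv, rfl⟩

/-! ### Coordinates adapted to the invariant functions -/

namespace Coframe

variable {n k d : ℕ} {M : Type*} [TopologicalSpace M] [ChartedSpace (EuclideanSpace ℝ (Fin n)) M]
  [IsManifold (𝓡 n) ∞ M] (θ : Coframe n M)

/-- Coordinates in which the invariant functions are those depending on the first factor. -/
structure Slice (k d : ℕ) where
  chart : OpenPartialHomeomorph M (EuclideanSpace ℝ (Fin n))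
  smooth : ContMDiffOn (𝓡 n) (𝓡 n) ∞ chart chart.source
  smooth_symm : ContMDiffOn (𝓡 n) (𝓡 n) ∞ chart.symm chart.target
  L : EuclideanSpace ℝ (Fin n) ≃L[ℝ] EuclideanSpace ℝ (Fin d) × EuclideanSpace ℝ (Fin k)
  base : Set (EuclideanSpace ℝ (Fin d))
  fiber : Set (EuclideanSpace ℝ (Fin k))
  isOpen_base : IsOpen base
  isOpen_fiber : IsOpen fiber
  convex_fiber : Convex ℝ fiber
  center : EuclideanSpace ℝ (Fin k)
  center_mem : center ∈ fiber
  target_eq : chart.target = L ⁻¹' (base ×ˢ fiber)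
  map : M → EuclideanSpace ℝ (Fin d)
  map_mem_Inv : ∀ a, (fun q => map q a) ∈ θ.Inv
  map_eq : ∀ q ∈ chart.source, map q = (L (chart q)).1

variable {θ}

/-- Invariant functions with independent differentials. -/
lemma exists_independent_invariants (hk : k + d = n) {p : M}
    (hp : Module.finrank ℝ (θ.classifyingKernel p) = k) :
    ∃ φ : M → EuclideanSpace ℝ (Fin d), (∀ a, (fun q => φ q a) ∈ θ.Inv) ∧
      Function.Surjective (fun (v : TangentSpace (𝓡 n) p) (a : Fin d) =>
        mvfderiv (𝓡 n) (fun q => φ q a) p v) := by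
  let Q : Set (Module.Dual ℝ (TangentSpace (𝓡 n) p)) :=
    (fun f : M → ℝ => (mvfderiv (𝓡 n) f p).toLinearMap) '' θ.Inv
  have hQ : (Submodule.span ℝ Q).dualCoannihilator = θ.classifyingKernel p := by
    ext v
    rw [Submodule.mem_dualCoannihilator]
    refine ⟨fun h f hf => h _ (Submodule.subset_span ⟨f, hf, rfl⟩), fun h g hg => ?_⟩
    have h1 : Submodule.span ℝ Q ≤ LinearMap.ker (Module.Dual.eval ℝ _ v) := by
      rw [Submodule.span_le]
      rintro _ ⟨f, hf, rfl⟩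
      exact h f hf
    exact h1 hg
  -- The span of the differentials is the annihilator of the classifying kernel, so its dimension is
  -- n - k.
  have hd : Module.finrank ℝ (Submodule.span ℝ Q) = d := by
    have h1 := Subspace.finrank_add_finrank_dualCoannihilator_eq (Submodule.span ℝ Q)
    rw [hQ, hp, finrank_tangentSpace] at h1
    omega
  obtain ⟨g, hg, -, hli⟩ := Submodule.exists_fun_fin_finrank_span_eq ℝ Q
  choose f hf hfg using hg
  have hli' := hli.comp (Fin.cast hd.symm) (Fin.cast_injective _)
  refine ⟨fun q => WithLp.toLp 2 fun a => f (Fin.cast hd.symm a) q, fun a => hf _, ?_⟩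
  let T : TangentSpace (𝓡 n) p →ₗ[ℝ] (Fin d → ℝ) :=
    LinearMap.pi fun a => (g ∘ Fin.cast hd.symm) a
  have hT : Function.Surjective T := by
    rw [← LinearMap.range_eq_top]
    by_contra h
    obtain ⟨u, hu, hle⟩ := Submodule.exists_le_ker_of_lt_top _ (lt_top_iff_ne_top.2 h)
    apply hu
    have h1 : ∑ i, u (Pi.single i 1) • (g ∘ Fin.cast hd.symm) i = 0 := by
      refine LinearMap.ext fun v => ?_
      have h2 : u (T v) = 0 := hle ⟨v, rfl⟩
      have h3 : T v = ∑ i, (g ∘ Fin.cast hd.symm) i v • Pi.single i (1 : ℝ) := by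
        ext j
        simp [T, Finset.sum_apply, Pi.single_apply]
      rw [h3, map_sum] at h2
      simp only [map_smul, smul_eq_mul] at h2
      rw [LinearMap.sum_apply]
      exact (Finset.sum_congr rfl fun i _ => mul_comm _ _).trans h2
    have h3 := Fintype.linearIndependent_iff.1 hli' _ h1
    refine LinearMap.pi_ext' fun i => LinearMap.ext_ring ?_
    simpa using h3 i
  intro y
  obtain ⟨v, hv⟩ := hT y
  refine ⟨v, ?_⟩
  rw [← hv]
  ext a
  exact congrArg (fun u : Module.Dual ℝ (TangentSpace (𝓡 n) p) => u v) (hfg (Fin.cast hd.symm a))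

/-- The slices cover the manifold. -/
lemma exists_slice (hk : k + d = n) {p : M}
    (hp : Module.finrank ℝ (θ.classifyingKernel p) = k) :
    ∃ S : θ.Slice k d, p ∈ S.chart.source := by
  obtain ⟨φ, hφ, hsurj⟩ := exists_independent_invariants hk hp
  have hφs : ContMDiff (𝓡 n) (𝓡 d) ∞ φ := by
    have h1 : ContMDiff (𝓡 n) 𝓘(ℝ, Fin d → ℝ) ∞ fun q a => φ q a :=
      contMDiff_pi_space.2 fun a => (hφ a).1
    exact (EuclideanSpace.equiv (Fin d) ℝ).symm.contDiff.contMDiff.comp h1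
  let c := chartAt (EuclideanSpace ℝ (Fin n)) p
  have hpc : p ∈ c.source := mem_chart_source _ p
  let F : EuclideanSpace ℝ (Fin n) → EuclideanSpace ℝ (Fin d) := fun x => φ (c.symm x)
  have hc : ContMDiffOn (𝓡 n) (𝓡 n) ∞ c c.source := contMDiffOn_chart
  have hcs : ContMDiffOn (𝓡 n) (𝓡 n) ∞ c.symm c.target := contMDiffOn_chart_symm
  have hF : ContDiffOn ℝ ∞ F c.target :=
    (hφs.comp_contMDiffOn hcs).contDiffOn
  have hFa : DifferentiableAt ℝ F (c p) :=
    (hF.contDiffAt (c.open_target.mem_nhds (c.map_source hpc))).differentiableAt (by simp)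
  have hFv : ∀ (v : EuclideanSpace ℝ (Fin n)) a,
      fderiv ℝ F (c p) v a = mvfderiv (𝓡 n) (fun q => φ q a) p v := by
    intro v a
    have h1 : HasFDerivAt (fun x => F x a) ((EuclideanSpace.proj a).comp (fderiv ℝ F (c p))) (c p) :=
      (EuclideanSpace.proj a : EuclideanSpace ℝ (Fin d) →L[ℝ] ℝ).hasFDerivAt.comp (c p)
        hFa.hasFDerivAt
    have h2 : mfderiv (𝓡 n) 𝓘(ℝ, ℝ) (fun q => φ q a) p = fderiv ℝ (fun x => F x a) (c p) := by
      rw [(Inv.mdifferentiableAt (hφ a) p).mfderiv]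
      simp only [mfld_simps, fderivWithin_univ]
      rfl
    change _ = mfderiv (𝓡 n) 𝓘(ℝ, ℝ) (fun q => φ q a) p v
    rw [h2, h1.fderiv]
    rfl
  have hFs : Function.Surjective (fderiv ℝ F (c p)) := by
    intro y
    obtain ⟨v, hv⟩ := hsurj y
    refine ⟨v, ?_⟩
    ext a
    exact (hFv v a).trans (congrFun hv a)
  obtain ⟨L, hL⟩ := exists_equivProd (B := EuclideanSpace ℝ (Fin k)) (fderiv ℝ F (c p)) hFs
    (by simp only [finrank_euclideanSpace_fin]; omega)
  obtain ⟨G, hGa, hGT, hG, hGs, hGF⟩ := exists_straightening c.open_target hF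
    (c.map_source hpc) L (by rw [hL]; exact hFa.hasFDerivAt)
  let D₀ := c.trans G
  have hpD : p ∈ D₀.source := ⟨hpc, hGa⟩
  have hD : ContMDiffOn (𝓡 n) (𝓡 n) ∞ D₀ D₀.source :=
    hG.contMDiffOn.comp (hc.mono fun q hq => hq.1) fun q hq => hq.2
  have hDs : ContMDiffOn (𝓡 n) (𝓡 n) ∞ D₀.symm D₀.target :=
    hcs.comp (hGs.contMDiffOn.mono fun q hq => hq.1) fun q hq => hq.2
  have hopen : IsOpen (L.symm ⁻¹' D₀.target) := D₀.open_target.preimage L.symm.continuous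
  have hmem : ((L (D₀ p)).1, (L (D₀ p)).2) ∈ L.symm ⁻¹' D₀.target := by
    simpa using D₀.map_source hpD
  obtain ⟨A, hA, B, hB, hAB⟩ := mem_nhds_prod_iff.1 (hopen.mem_nhds hmem)
  obtain ⟨ε, hε, hBε⟩ := Metric.mem_nhds_iff.1 hB
  obtain ⟨A', hA'A, hA', hxA'⟩ := mem_nhds_iff.1 hA
  -- The chart is shrunk to a box whose fiber factor is a ball; connectedness of the fibers makes
  -- invariant functions constant along them.
  let W : Set (EuclideanSpace ℝ (Fin n)) := L ⁻¹' (A' ×ˢ Metric.ball (L (D₀ p)).2 ε)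
  have hW : IsOpen W := (hA'.prod Metric.isOpen_ball).preimage L.continuous
  have hWD : W ⊆ D₀.target := fun x hx => by
    have h1 := hAB (Set.mk_mem_prod (hA'A hx.1) (hBε hx.2))
    simpa using h1
  let D := (D₀.symm.restrOpen W hW).symm
  have hsrc : ∀ q ∈ D.source, q ∈ D₀.source := fun q hq => by
    have h1 : q ∈ (D₀.symm.restrOpen W hW).target := hq
    have h2 := (D₀.symm.restrOpen W hW).map_target h1
    have h3 : D₀.symm ((D₀.symm.restrOpen W hW).symm q) = q :=
      (D₀.symm.restrOpen W hW).right_inv h1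
    rw [← h3]
    exact D₀.map_target h2.1
  refine ⟨⟨D, hD.mono hsrc, hDs.mono fun x hx => hx.1, L, A', Metric.ball (L (D₀ p)).2 ε, hA',
    Metric.isOpen_ball, convex_ball _ _, (L (D₀ p)).2, Metric.mem_ball_self hε, ?_, φ, hφ,
    fun q hq => ?_⟩, ?_⟩
  · exact Set.inter_eq_right.2 hWD
  · have h1 := hsrc q hq
    refine Eq.trans ?_ (hGF (c q) h1.2).symm
    change φ q = φ (c.symm (c q))
    rw [c.left_inv h1.1]
  · have h1 : D₀ p ∈ (D₀.symm.restrOpen W hW).source :=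
      ⟨D₀.map_source hpD, hxA', Metric.mem_ball_self hε⟩
    have h2 := (D₀.symm.restrOpen W hW).map_source h1
    rwa [show (D₀.symm.restrOpen W hW) (D₀ p) = p from D₀.left_inv hpD] at h2

end Coframe

/-! ### Invariant functions and formal equivalence inside a slice -/

namespace Coframe

variable {n k d : ℕ} {M : Type*} [TopologicalSpace M] [ChartedSpace (EuclideanSpace ℝ (Fin n)) M]
  [IsManifold (𝓡 n) ∞ M] {θ : Coframe n M}

namespace Slice

variable (S : θ.Slice k d)

lemma contMDiff_map : ContMDiff (𝓡 n) (𝓡 d) ∞ S.map := by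
  have h1 : ContMDiff (𝓡 n) 𝓘(ℝ, Fin d → ℝ) ∞ fun q a => S.map q a :=
    contMDiff_pi_space.2 fun a => (S.map_mem_Inv a).1
  exact (EuclideanSpace.equiv (Fin d) ℝ).symm.contDiff.contMDiff.comp h1

lemma mdifferentiableAt_map (q : M) : MDifferentiableAt (𝓡 n) (𝓡 d) S.map q :=
  S.contMDiff_map.mdifferentiable (by simp) q

/-- The point of the slice with given coordinates. -/
def point (y : EuclideanSpace ℝ (Fin d)) (z : EuclideanSpace ℝ (Fin k)) : M :=
  S.chart.symm (S.L.symm (y, z))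

variable {S}

lemma symm_mem_target {y : EuclideanSpace ℝ (Fin d)} {z : EuclideanSpace ℝ (Fin k)}
    (hy : y ∈ S.base) (hz : z ∈ S.fiber) : S.L.symm (y, z) ∈ S.chart.target := by
  rw [S.target_eq]
  exact ⟨by simpa using hy, by simpa using hz⟩

lemma point_mem {y : EuclideanSpace ℝ (Fin d)} {z : EuclideanSpace ℝ (Fin k)}
    (hy : y ∈ S.base) (hz : z ∈ S.fiber) : S.point y z ∈ S.chart.source :=
  S.chart.map_target (symm_mem_target hy hz)

lemma chart_point {y : EuclideanSpace ℝ (Fin d)} {z : EuclideanSpace ℝ (Fin k)}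
    (hy : y ∈ S.base) (hz : z ∈ S.fiber) : S.chart (S.point y z) = S.L.symm (y, z) :=
  S.chart.right_inv (symm_mem_target hy hz)

lemma map_point {y : EuclideanSpace ℝ (Fin d)} {z : EuclideanSpace ℝ (Fin k)}
    (hy : y ∈ S.base) (hz : z ∈ S.fiber) : S.map (S.point y z) = y := by
  rw [S.map_eq _ (point_mem hy hz), chart_point hy hz]
  simp

lemma map_mem_base {q : M} (hq : q ∈ S.chart.source) : S.map q ∈ S.base := by
  have h1 := S.chart.map_source hq
  rw [S.target_eq] at h1
  rw [S.map_eq q hq]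
  exact h1.1

lemma snd_mem_fiber {q : M} (hq : q ∈ S.chart.source) : (S.L (S.chart q)).2 ∈ S.fiber := by
  have h1 := S.chart.map_source hq
  rw [S.target_eq] at h1
  exact h1.2

lemma point_map {q : M} (hq : q ∈ S.chart.source) :
    S.point (S.map q) (S.L (S.chart q)).2 = q := by
  rw [S.map_eq q hq, point]
  simp [S.chart.left_inv hq]

lemma contMDiffOn_point_left {z : EuclideanSpace ℝ (Fin k)} (hz : z ∈ S.fiber) :
    ContMDiffOn (𝓡 d) (𝓡 n) ∞ (fun y => S.point y z) S.base :=
  S.smooth_symm.comp (S.L.symm.contDiff.comp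
    (contDiff_id.prodMk contDiff_const)).contMDiff.contMDiffOn fun _ hy => symm_mem_target hy hz

lemma contMDiffOn_point_right {y : EuclideanSpace ℝ (Fin d)} (hy : y ∈ S.base) :
    ContMDiffOn (𝓡 k) (𝓡 n) ∞ (fun z => S.point y z) S.fiber :=
  S.smooth_symm.comp (S.L.symm.contDiff.comp
    (contDiff_const.prodMk contDiff_id)).contMDiff.contMDiffOn fun _ hz => symm_mem_target hy hz

variable (S) in
lemma isSubmersionAt_map {q : M} (hq : q ∈ S.chart.source) :
    IsSubmersionAt (𝓡 n) (𝓡 d) ∞ S.map q := by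
  refine IsSubmersionAt.mk_of_charts S.L S.chart (OpenPartialHomeomorph.refl _) hq trivial
    (S.chart.mem_maximalAtlas_of_contMDiffOn S.smooth S.smooth_symm)
    (IsManifold.chart_mem_maximalAtlas (I := 𝓡 d) (n := ∞) (0 : EuclideanSpace ℝ (Fin d)))
    (fun _ _ => trivial) fun x hx => ?_
  have hx' : x ∈ S.chart.target := by simpa using hx
  have h1 := S.map_eq _ (S.chart.map_target hx')
  rw [S.chart.right_inv hx'] at h1
  simpa using h1

lemma mvfderiv_map_apply (q : M) (v : TangentSpace (𝓡 n) q) (a : Fin d) :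
    mvfderiv (𝓡 n) S.map q v a =
      mvfderiv (𝓡 n) (fun q => S.map q a) q v :=
  (mvfderiv_comp_continuousLinearMap (EuclideanSpace.proj a : EuclideanSpace ℝ (Fin d) →L[ℝ] ℝ)
    (S.mdifferentiableAt_map q) v).symm

lemma mfderiv_map_eq_zero {q : M} {v : TangentSpace (𝓡 n) q} (hv : v ∈ θ.classifyingKernel q) :
    mfderiv (𝓡 n) (𝓡 d) S.map q v = 0 := by
  have h : mvfderiv (𝓡 n) S.map q v = (0 : EuclideanSpace ℝ (Fin d)) := PiLp.ext fun a => by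
    exact (mvfderiv_map_apply q v a).trans (hv _ (S.map_mem_Inv a))
  exact h

/-- The kernel of the differential of `S.map` contains the classifying kernel, and both have
dimension k. This is where constancy of the rank enters. -/
lemma mem_classifyingKernel (hk : k + d = n)
    (hrk : ∀ p, Module.finrank ℝ (θ.classifyingKernel p) = k) {q : M} (hq : q ∈ S.chart.source)
    {v : TangentSpace (𝓡 n) q} (hv : mfderiv (𝓡 n) (𝓡 d) S.map q v = 0) :
    v ∈ θ.classifyingKernel q := by
  let T : TangentSpace (𝓡 n) q →ₗ[ℝ] TangentSpace (𝓡 d) (S.map q) :=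
    (mfderiv (𝓡 n) (𝓡 d) S.map q).toLinearMap
  have h1 : Module.finrank ℝ (LinearMap.ker T) = k := by
    have h2 := T.finrank_range_add_finrank_ker
    rw [LinearMap.range_eq_top.2 (mfderiv_surjective_of_isSubmersionAt (S.isSubmersionAt_map hq)),
      finrank_top, finrank_tangentSpace, finrank_tangentSpace] at h2
    omega
  have h2 : θ.classifyingKernel q = LinearMap.ker T :=
    Submodule.eq_of_le_of_finrank_eq (fun w hw => mfderiv_map_eq_zero hw) ((hrk q).trans h1.symm)
  rw [h2]
  exact hv

/-- Invariant functions are constant along the second factor of a slice. -/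
lemma Inv.apply_point (hk : k + d = n) (hrk : ∀ p, Module.finrank ℝ (θ.classifyingKernel p) = k)
    {f : M → ℝ} (hf : f ∈ θ.Inv) {y : EuclideanSpace ℝ (Fin d)} (hy : y ∈ S.base)
    {z z' : EuclideanSpace ℝ (Fin k)} (hz : z ∈ S.fiber) (hz' : z' ∈ S.fiber) :
    f (S.point y z) = f (S.point y z') := by
  have hpt : ∀ w ∈ S.fiber, MDifferentiableAt (𝓡 k) (𝓡 n) (fun z => S.point y z) w := fun w hw =>
    ((contMDiffOn_point_right hy).contMDiffAt (S.isOpen_fiber.mem_nhds hw)).mdifferentiableAt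
      (by simp)
  have hd : ∀ w ∈ S.fiber, HasFDerivAt (fun z => f (S.point y z)) (0 : _ →L[ℝ] ℝ) w := by
    intro w hw
    have h1 : MDifferentiableAt (𝓡 k) 𝓘(ℝ, ℝ) (fun z => f (S.point y z)) w :=
      (Inv.mdifferentiableAt hf _).comp w (hpt w hw)
    have h2 := (mdifferentiableAt_iff_differentiableAt.1 h1).hasFDerivAt
    refine h2.congr_fderiv ?_
    ext u
    have h3 := mvfderiv_comp_map (Inv.mdifferentiableAt hf (S.point y w)) (hpt w hw) u
    have h4 : mfderiv (𝓡 k) (𝓡 n) (fun z => S.point y z) w u ∈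
        θ.classifyingKernel (S.point y w) := by
      refine mem_classifyingKernel hk hrk (point_mem hy hw) ?_
      have h5 := mfderiv_comp_apply (I := 𝓡 k) (I' := 𝓡 n) (I'' := 𝓡 d) (g := S.map)
        (f := fun z => S.point y z) w (S.mdifferentiableAt_map _) (hpt w hw) u
      refine h5.symm.trans ?_
      have h6 : (fun z => S.map (S.point y z)) =ᶠ[𝓝 w] fun _ => y := by
        filter_upwards [S.isOpen_fiber.mem_nhds hw] with z hz using map_point hy hz
      have h7 : mfderiv (𝓡 k) (𝓡 d) (fun z => S.map (S.point y z)) w =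
          (mfderiv (𝓡 k) (𝓡 d) (fun _ : EuclideanSpace ℝ (Fin k) => y) w :
            EuclideanSpace ℝ (Fin k) →L[ℝ] EuclideanSpace ℝ (Fin d)) := h6.mfderiv_eq
      rw [mfderiv_const] at h7
      exact congrArg
        (fun L : EuclideanSpace ℝ (Fin k) →L[ℝ] EuclideanSpace ℝ (Fin d) => L u) h7
    have h8 := h3.trans (h4 f hf)
    refine Eq.trans ?_ h8
    change _ = mfderiv (𝓡 k) 𝓘(ℝ, ℝ) (fun z => f (S.point y z)) w u
    rw [mfderiv_eq_fderiv]
    rfl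
  exact S.isOpen_fiber.is_const_of_fderiv_eq_zero S.convex_fiber.isPreconnected
    (fun w hw => (hd w hw).differentiableAt.differentiableWithinAt) (fun w hw => (hd w hw).fderiv)
    hz hz'

/-- Points of a slice with the same coordinates are formally equivalent. -/
lemma formallyEquivalent (hk : k + d = n)
    (hrk : ∀ p, Module.finrank ℝ (θ.classifyingKernel p) = k) {q q' : M}
    (hq : q ∈ S.chart.source) (hq' : q' ∈ S.chart.source) (h : S.map q = S.map q') :
    θ.FormallyEquivalent q q' := by
  -- Translation by u in the chart takes q to q' and leaves the first factor unchanged, so it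
  -- preserves all invariant functions.
  set u : EuclideanSpace ℝ (Fin n) := S.chart q' - S.chart q with hu
  have hLu : (S.L u).1 = 0 := by
    rw [hu, map_sub, Prod.fst_sub, ← S.map_eq q hq, ← S.map_eq q' hq', h, sub_self]
  let τ : OpenPartialHomeomorph (EuclideanSpace ℝ (Fin n)) (EuclideanSpace ℝ (Fin n)) :=
    (Homeomorph.addRight u).toOpenPartialHomeomorph
  have hτ : ContDiff ℝ ∞ τ := contDiff_id.add contDiff_const
  have hτs : ContDiff ℝ ∞ τ.symm := contDiff_id.add contDiff_const
  let e := (S.chart.trans τ).trans S.chart.symm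
  have hes : ∀ p ∈ e.source, p ∈ S.chart.source ∧ S.chart p + u ∈ S.chart.target := fun p hp =>
    ⟨hp.1.1, hp.2⟩
  have het : ∀ p ∈ e.target, p ∈ S.chart.source ∧ τ.symm (S.chart p) ∈ S.chart.target :=
    fun p hp => ⟨hp.1, hp.2.2⟩
  refine ⟨e, ?_, ?_, ?_, ?_, fun p hp f hf => ?_⟩
  · exact S.smooth_symm.comp (hτ.contMDiff.comp_contMDiffOn
      (S.smooth.mono fun p hp => (hes p hp).1)) fun p hp => (hes p hp).2
  · exact S.smooth_symm.comp (hτs.contMDiff.comp_contMDiffOn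
      (S.smooth.mono fun p hp => (het p hp).1)) fun p hp => (het p hp).2
  · refine ⟨⟨hq, trivial⟩, ?_⟩
    change S.chart q + u ∈ S.chart.target
    rw [hu, add_sub_cancel]
    exact S.chart.map_source hq'
  · change S.chart.symm (S.chart q + u) = q'
    rw [hu, add_sub_cancel, S.chart.left_inv hq']
  · obtain ⟨h1, h2⟩ := hes p hp
    have h3 : e p = S.point (S.map p) (S.L (S.chart p + u)).2 := by
      change S.chart.symm (S.chart p + u) = S.chart.symm (S.L.symm _)
      congr 1
      rw [ContinuousLinearEquiv.eq_symm_apply]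
      ext1
      · rw [map_add, Prod.fst_add, hLu, add_zero, S.map_eq p h1]
      · rfl
    have h4 : (S.L (S.chart p + u)).2 ∈ S.fiber := by
      rw [S.target_eq] at h2
      exact h2.2
    rw [h3]
    conv_rhs => rw [← point_map h1]
    exact Inv.apply_point hk hrk hf (map_mem_base h1) h4 (snd_mem_fiber h1)

lemma classifyingMap_eq (hk : k + d = n)
    (hrk : ∀ p, Module.finrank ℝ (θ.classifyingKernel p) = k) {q q' : M}
    (hq : q ∈ S.chart.source) (hq' : q' ∈ S.chart.source) (h : S.map q = S.map q') :
    θ.classifyingMap q = θ.classifyingMap q' :=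
  Quotient.sound (formallyEquivalent hk hrk hq hq' h)

end Slice

end Coframe

/-! ### The smooth structure of the classifying space -/

namespace Coframe

variable {n k d : ℕ} {M : Type*} [TopologicalSpace M] [ChartedSpace (EuclideanSpace ℝ (Fin n)) M]
  [IsManifold (𝓡 n) ∞ M] {θ : Coframe n M}

variable (θ) in
lemma classifyingMap_surjective : Function.Surjective θ.classifyingMap := Quotient.mk_surjective

variable (θ) in
lemma continuous_classifyingMap : Continuous θ.classifyingMap := continuous_quotient_mk'

variable (θ) in
-- If e is a formal equivalence from a point of U to q, then e maps the part of U in its source onto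
-- a neighborhood of q consisting of points equivalent to points of U.
lemma isOpenMap_classifyingMap : IsOpenMap θ.classifyingMap := by
  intro U hU
  have h1 : IsOpen (θ.classifyingMap ⁻¹' (θ.classifyingMap '' U)) := by
    rw [isOpen_iff_mem_nhds]
    rintro q ⟨p, hp, hpq⟩
    obtain ⟨e, h1, h2, hpe, rfl, he⟩ : θ.FormallyEquivalent p q := Quotient.exact hpq
    filter_upwards [(e.isOpen_image_source_inter hU).mem_nhds ⟨p, ⟨hpe, hp⟩, rfl⟩]
    rintro _ ⟨q, ⟨hqe, hq⟩, rfl⟩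
    exact ⟨q, hq, Quotient.sound ⟨e, h1, h2, hqe, rfl, he⟩⟩
  exact isQuotientMap_quot_mk.isOpen_preimage.1 h1

variable (θ) in
/-- A point over a given point of the classifying space. -/
def lift (x : θ.ClassifyingSpace) : M := Function.surjInv θ.classifyingMap_surjective x

lemma classifyingMap_lift (x : θ.ClassifyingSpace) : θ.classifyingMap (θ.lift x) = x :=
  Function.surjInv_eq _ _

lemma Inv.lift_classifyingMap {f : M → ℝ} (hf : f ∈ θ.Inv) (p : M) :
    f (θ.lift (θ.classifyingMap p)) = f p :=
  Inv.eq_of_classifyingMap_eq hf (classifyingMap_lift _)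

namespace Slice

variable (S : θ.Slice k d) (hk : k + d = n)
  (hrk : ∀ p, Module.finrank ℝ (θ.classifyingKernel p) = k)

/-- The components of `S.map` are invariant, hence insensitive to the choice of lift. -/
lemma map_lift (p : M) : S.map (θ.lift (θ.classifyingMap p)) = S.map p :=
  PiLp.ext fun a => Inv.lift_classifyingMap (S.map_mem_Inv a) p

/-- The chart of the classifying space determined by a slice. -/
def quotientChart : OpenPartialHomeomorph θ.ClassifyingSpace (EuclideanSpace ℝ (Fin d)) where
  toFun x := S.map (θ.lift x)
  invFun y := θ.classifyingMap (S.point y S.center)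
  source := θ.classifyingMap '' S.chart.source
  target := S.base
  map_source' := by
    rintro _ ⟨q, hq, rfl⟩
    rw [S.map_lift]
    exact map_mem_base hq
  map_target' y hy := ⟨_, point_mem hy S.center_mem, rfl⟩
  left_inv' := by
    rintro _ ⟨q, hq, rfl⟩
    rw [S.map_lift]
    exact classifyingMap_eq hk hrk (point_mem (map_mem_base hq) S.center_mem) hq
      (map_point (map_mem_base hq) S.center_mem)
  right_inv' y hy := by
    rw [S.map_lift]
    exact map_point hy S.center_mem
  open_source := θ.isOpenMap_classifyingMap _ S.chart.open_source
  open_target := S.isOpen_base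
  continuousOn_toFun := by
    refine Continuous.continuousOn (isQuotientMap_quot_mk.continuous_iff.2 ?_)
    exact S.contMDiff_map.continuous.congr fun q => (S.map_lift q).symm
  continuousOn_invFun :=
    θ.continuous_classifyingMap.comp_continuousOn (contMDiffOn_point_left S.center_mem).continuousOn

lemma quotientChart_classifyingMap (p : M) :
    S.quotientChart hk hrk (θ.classifyingMap p) = S.map p := S.map_lift p

end Slice

section Charts

variable (hk : k + d = n) (hrk : ∀ p, Module.finrank ℝ (θ.classifyingKernel p) = k)

/-- The charted space structure of the classifying space given by the slices. -/
abbrev classifyingChartedSpace :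
    ChartedSpace (EuclideanSpace ℝ (Fin d)) θ.ClassifyingSpace where
  atlas := Set.range fun S : θ.Slice k d => S.quotientChart hk hrk
  chartAt x := (exists_slice hk (hrk (θ.lift x))).choose.quotientChart hk hrk
  mem_chart_source x :=
    ⟨_, (exists_slice hk (hrk (θ.lift x))).choose_spec, classifyingMap_lift x⟩
  chart_mem_atlas _ := ⟨_, rfl⟩

/-- A transition function is the invariant map of one slice restricted to the smooth central section
of another. -/
lemma isManifold_classifyingSpace :
    @IsManifold ℝ _ _ _ _ _ _ (𝓡 d) ∞ θ.ClassifyingSpace _ (classifyingChartedSpace hk hrk) := by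
  let _ := classifyingChartedSpace hk hrk
  refine isManifold_of_contDiffOn (𝓡 d) ∞ θ.ClassifyingSpace ?_
  rintro _ _ ⟨S, rfl⟩ ⟨S', rfl⟩
  have h1 : ContDiffOn ℝ ∞ (fun y => S'.map (S.point y S.center)) S.base :=
    (S'.contMDiff_map.comp_contMDiffOn
      (Slice.contMDiffOn_point_left S.center_mem)).contDiffOn
  refine (h1.congr fun y _ => S'.map_lift _).mono ?_
  rintro y ⟨hy, -⟩
  exact hy.1

lemma isSubmersion_classifyingMap :
    let _ := classifyingChartedSpace hk hrk
    IsSubmersion (𝓡 n) (𝓡 d) ∞ θ.classifyingMap := by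
  let _ := classifyingChartedSpace hk hrk
  have := isManifold_classifyingSpace hk hrk
  refine IsSubmersionOfComplement.isSubmersion (F := EuclideanSpace ℝ (Fin k)) fun p => ?_
  obtain ⟨S, hp⟩ := exists_slice hk (hrk p)
  refine IsSubmersionAtOfComplement.mk_of_charts S.L S.chart (S.quotientChart hk hrk) hp
    ⟨p, hp, rfl⟩ (S.chart.mem_maximalAtlas_of_contMDiffOn S.smooth S.smooth_symm)
    (IsManifold.subset_maximalAtlas ⟨S, rfl⟩) (fun q hq => ⟨q, hq, rfl⟩) fun x hx => ?_
  have hx' : x ∈ S.chart.target := by simpa using hx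
  have h1 := S.map_eq _ (S.chart.map_target hx')
  rw [S.chart.right_inv hx', ← S.quotientChart_classifyingMap hk hrk] at h1
  simpa using h1

end Charts

/-! ### The classifying Lie algebroid over an arbitrary compatible structure -/

section Realization

variable [ChartedSpace (EuclideanSpace ℝ (Fin d)) θ.ClassifyingSpace]
  [IsManifold (𝓡 d) ∞ θ.ClassifyingSpace]

variable (hsub : ∀ p, IsSubmersionAt (𝓡 n) (𝓡 d) ∞ θ.classifyingMap p)

include hsub

/-- Invariant functions are smooth on the classifying space. -/
lemma Inv.contMDiff_lift {f : M → ℝ} (hf : f ∈ θ.Inv) :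
    ContMDiff (𝓡 d) 𝓘(ℝ, ℝ) ∞ fun x => f (θ.lift x) := by
  intro x
  rw [← classifyingMap_lift x]
  refine contMDiffAt_of_comp_submersion (hsub _) ?_
  simp only [Inv.lift_classifyingMap hf]
  exact hf.1 _

lemma mdifferentiableAt_classifyingMap (p : M) :
    MDifferentiableAt (𝓡 n) (𝓡 d) θ.classifyingMap p :=
  (hsub p).contMDiffAt.mdifferentiableAt (by simp)

lemma Inv.mvfderiv_lift {f : M → ℝ} (hf : f ∈ θ.Inv) (p : M) (v : TangentSpace (𝓡 n) p) :
    mvfderiv (𝓡 d) (fun x => f (θ.lift x)) (θ.classifyingMap p)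
      (mfderiv (𝓡 n) (𝓡 d) θ.classifyingMap p v) = mvfderiv (𝓡 n) f p v := by
  rw [← mvfderiv_comp_map ((Inv.contMDiff_lift hsub hf).mdifferentiable (by simp) _)
    (mdifferentiableAt_classifyingMap hsub p)]
  simp only [Inv.lift_classifyingMap hf]

variable {d₀ : ℕ} (hk : k + d₀ = n) (hrk : ∀ p, Module.finrank ℝ (θ.classifyingKernel p) = k)

include hk hrk

/-- The kernel of the differential of the classifying map. -/
lemma mfderiv_classifyingMap_eq_zero_iff (p : M) (v : TangentSpace (𝓡 n) p) :
    mfderiv (𝓡 n) (𝓡 d) θ.classifyingMap p v = 0 ↔ v ∈ θ.classifyingKernel p := by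
  refine ⟨fun h f hf => ?_, fun h => ?_⟩
  · rw [← Inv.mvfderiv_lift hsub hf, h, map_zero]
  · obtain ⟨S, hp⟩ := exists_slice hk (hrk p)
    let t : EuclideanSpace ℝ (Fin d₀) → θ.ClassifyingSpace :=
      fun y => θ.classifyingMap (S.point y S.center)
    have ht : MDifferentiableAt (𝓡 d₀) (𝓡 d) t (S.map p) :=
      (mdifferentiableAt_classifyingMap hsub _).comp (S.map p)
        (((Slice.contMDiffOn_point_left S.center_mem).contMDiffAt
          (S.isOpen_base.mem_nhds (Slice.map_mem_base hp))).mdifferentiableAt (by simp))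
    -- Locally κ factors through `S.map`, whose differential kills the classifying kernel.
    have h1 : θ.classifyingMap =ᶠ[𝓝 p] fun q => t (S.map q) := by
      filter_upwards [S.chart.open_source.mem_nhds hp] with q hq
      have hb := Slice.map_mem_base hq
      exact Slice.classifyingMap_eq hk hrk hq (Slice.point_mem hb S.center_mem)
        (Slice.map_point hb S.center_mem).symm
    have h2 := mfderiv_comp_apply (I := 𝓡 n) (I' := 𝓡 d₀) (I'' := 𝓡 d) (g := t) (f := S.map) p ht
      (S.mdifferentiableAt_map p) v
    rw [Slice.mfderiv_map_eq_zero h, map_zero] at h2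
    have h3 : (mfderiv (𝓡 n) (𝓡 d) θ.classifyingMap p :
        EuclideanSpace ℝ (Fin n) →L[ℝ] EuclideanSpace ℝ (Fin d)) =
        mfderiv (𝓡 n) (𝓡 d) (fun q => t (S.map q)) p := h1.mfderiv_eq
    exact (congrArg
      (fun L : EuclideanSpace ℝ (Fin n) →L[ℝ] EuclideanSpace ℝ (Fin d) => L v) h3).trans h2

/-- Tangent vectors of the classifying space are separated by invariant functions. -/
lemma tangentVector_ext_lift {x : θ.ClassifyingSpace} {w w' : TangentSpace (𝓡 d) x}
    (h : ∀ f ∈ θ.Inv, mvfderiv (𝓡 d) (fun x => f (θ.lift x)) x w =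
      mvfderiv (𝓡 d) (fun x => f (θ.lift x)) x w') : w = w' := by
  obtain ⟨p, rfl⟩ := θ.classifyingMap_surjective x
  obtain ⟨v, hv⟩ := mfderiv_surjective_of_isSubmersionAt (hsub p) (w - w')
  rw [← sub_eq_zero, ← hv, mfderiv_classifyingMap_eq_zero_iff hsub hk hrk]
  intro f hf
  rw [← Inv.mvfderiv_lift hsub hf, hv, map_sub, h f hf, sub_self]

omit hsub hk hrk in
variable (θ d) in
/-- The anchor of the classifying Lie algebroid. -/
def anchor (i : Fin n) (x : θ.ClassifyingSpace) : TangentSpace (𝓡 d) x :=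
  (mfderiv (𝓡 n) (𝓡 d) θ.classifyingMap (θ.lift x) (θ.frame i (θ.lift x)) :
    EuclideanSpace ℝ (Fin d))

/-- The anchor is defined through a chosen lift. Independence of the lift holds because invariant
functions separate tangent vectors of the classifying space and their frame derivatives are again
invariant. -/
lemma mfderiv_classifyingMap_frame (i : Fin n) (p : M) :
    mfderiv (𝓡 n) (𝓡 d) θ.classifyingMap p (θ.frame i p) =
      θ.anchor d i (θ.classifyingMap p) := by
  refine tangentVector_ext_lift hsub hk hrk fun f hf => ?_
  rw [Inv.mvfderiv_lift hsub hf]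
  -- Stated for a free x because the chosen lift lies over the same point only up to a propositional
  -- equality.
  have key : ∀ (x : θ.ClassifyingSpace) (q : M) (v : TangentSpace (𝓡 n) q),
      θ.classifyingMap q = x → mvfderiv (𝓡 d) (fun x => f (θ.lift x)) x
        (mfderiv (𝓡 n) (𝓡 d) θ.classifyingMap q v : EuclideanSpace ℝ (Fin d)) =
          mvfderiv (𝓡 n) f q v := by
    rintro _ q v rfl
    exact Inv.mvfderiv_lift hsub hf q v
  exact ((key _ _ _ (classifyingMap_lift _)).trans
    (Inv.lift_classifyingMap (Inv.frame_derivative hf i) p)).symm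

/-- Locally the anchor is the tangent map of κ applied to the frame field along a smooth section. -/
lemma smooth_anchor (i : Fin n) : SmoothFieldOn (θ.anchor d i) Set.univ := by
  intro x _
  obtain ⟨p, rfl⟩ := θ.classifyingMap_surjective x
  obtain ⟨s, O, hO, hpO, -, hs, hκs⟩ := exists_local_section (hsub p)
  have hκ : ContMDiff (𝓡 n) (𝓡 d) ∞ θ.classifyingMap := fun q => (hsub q).contMDiffAt
  have h1 : ContMDiff (𝓡 n).tangent (𝓡 d).tangent ∞ (tangentMap (𝓡 n) (𝓡 d) θ.classifyingMap) :=
    hκ.contMDiff_tangentMap (by simp)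
  have h2 : ContMDiff (𝓡 n) (𝓡 n).tangent ∞
      (fun q => (⟨q, θ.frame i q⟩ : TangentBundle (𝓡 n) M)) := contMDiffOn_univ.1 (θ.smooth_frame i)
  have h3 := ((h1.comp h2).comp_contMDiffOn hs).contMDiffAt (hO.mem_nhds hpO)
  refine ContMDiffAt.contMDiffWithinAt (h3.congr_of_eventuallyEq ?_)
  filter_upwards [hO.mem_nhds hpO] with y hy
  have key : ∀ (x : θ.ClassifyingSpace) (q : M), θ.classifyingMap q = x →
      (⟨x, θ.anchor d i x⟩ : TangentBundle (𝓡 d) θ.ClassifyingSpace) =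
        tangentMap (𝓡 n) (𝓡 d) θ.classifyingMap ⟨q, θ.frame i q⟩ := by
    rintro _ q rfl
    rw [tangentMap, mfderiv_classifyingMap_frame hsub hk hrk]
  exact key y (s y) (hκs y hy)

/-- The initial data on the classifying space. -/
abbrev classifyingData : RealizationData n d θ.ClassifyingSpace where
  C i j l x := θ.structureFunction i j l (θ.lift x)
  F := θ.anchor d
  skew i j l _ := θ.structureFunction_skew i j l _
  smooth_C i j l := Inv.contMDiff_lift hsub (θ.structureFunction_mem_Inv i j l)
  smooth_F := smooth_anchor hsub hk hrk

lemma isRealization_classifyingData :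
    (classifyingData hsub hk hrk).IsRealization θ θ.classifyingMap := by
  refine ⟨fun q => (hsub q).contMDiffAt, fun l U V W hU hV hW p hp => ?_, fun p v => ?_⟩
  · rw [θ.extDerivOneForm_form hU hV hW hp]
    simp only [Inv.lift_classifyingMap (θ.structureFunction_mem_Inv _ _ _)]
    exact (sum_Ioi_skew _ (fun i j => θ.structureFunction_skew i j l p) _ _).symm
  · conv_lhs => rw [θ.eq_sum_frame v]
    simp only [map_sum, map_smul, mfderiv_classifyingMap_frame hsub hk hrk]

/-- Any compatible structure on the classifying space has the expected properties. -/
lemma isClassifyingRealization {D : RealizationData n d θ.ClassifyingSpace}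
    (hD : D.IsRealization θ θ.classifyingMap) :
    IsClassifyingRealization θ D θ.classifyingMap where
  surjective := θ.classifyingMap_surjective
  submersion := hsub
  realization := hD
  inv_eq _ hf _ _ h := Inv.eq_of_classifyingMap_eq hf h
  localEquivalence _ he _ hp := classifyingMap_localEquivalence he hp
  ker := mfderiv_classifyingMap_eq_zero_iff hsub hk hrk

/-- The slices have base dimension d₀, whereas d comes from an arbitrary structure making κ a
submersion. Rank-nullity at a point fixes d. -/
lemma dimension_classifyingSpace [Nonempty M] : k + d = n := by
  obtain ⟨p⟩ := ‹Nonempty M›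
  let T : TangentSpace (𝓡 n) p →ₗ[ℝ] TangentSpace (𝓡 d) (θ.classifyingMap p) :=
    (mfderiv (𝓡 n) (𝓡 d) θ.classifyingMap p).toLinearMap
  have h1 : LinearMap.ker T = θ.classifyingKernel p :=
    Submodule.ext fun v => mfderiv_classifyingMap_eq_zero_iff hsub hk hrk p v
  have h2 := T.finrank_range_add_finrank_ker
  rw [LinearMap.range_eq_top.2 (mfderiv_surjective_of_isSubmersionAt (hsub p)), h1, hrk,
    finrank_top, finrank_tangentSpace, finrank_tangentSpace] at h2
  omega

end Realization

end Coframe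

/-! ### Existence, uniqueness and value of the modular class -/

namespace Coframe

variable {n k : ℕ} {M : Type*} [TopologicalSpace M] [ChartedSpace (EuclideanSpace ℝ (Fin n)) M]
  [IsManifold (𝓡 n) ∞ M] {θ : Coframe n M} {ξ : Module.Basis (Fin k) ℝ θ.symmetryAlgebra}
  {μG : ∀ p : M, TangentSpace (𝓡 n) p [⋀^Fin k]→L[ℝ] ℝ}

lemma IsOrbitVolume.card_le (hvol : θ.IsOrbitVolume μG)
    (ξ : Module.Basis (Fin k) ℝ θ.symmetryAlgebra) : k ≤ n := by
  rcases isEmpty_or_nonempty M with hM | ⟨⟨p⟩⟩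
  · have h1 := Module.finrank_eq_card_basis ξ
    rw [Fintype.card_fin, Module.finrank_zero_of_subsingleton] at h1
    omega
  · rw [← hvol.finrank_orbitTangent ξ p]
    exact (Submodule.finrank_le _).trans_eq (finrank_tangentSpace p)

/-- The classifying space carries a compatible smooth structure. -/
lemma exists_classifyingRealization (horb : ∀ p, θ.orbitTangent p = θ.classifyingKernel p)
    (hvol : θ.IsOrbitVolume μG) (ξ : Module.Basis (Fin k) ℝ θ.symmetryAlgebra) :
    ∃ (d : ℕ) (_ : k + d = n) (_ : ChartedSpace (EuclideanSpace ℝ (Fin d)) θ.ClassifyingSpace)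
      (_ : IsManifold (𝓡 d) ∞ θ.ClassifyingSpace) (D : RealizationData n d θ.ClassifyingSpace),
      IsSubmersion (𝓡 n) (𝓡 d) ∞ θ.classifyingMap ∧
        IsClassifyingRealization θ D θ.classifyingMap := by
  have hk : k + (n - k) = n := Nat.add_sub_cancel' (hvol.card_le ξ)
  have hrk : ∀ p, Module.finrank ℝ (θ.classifyingKernel p) = k := fun p => by
    rw [← horb, hvol.finrank_orbitTangent ξ]
  let _ := classifyingChartedSpace hk hrk
  have := isManifold_classifyingSpace hk hrk
  have hsub := isSubmersion_classifyingMap hk hrk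
  exact ⟨n - k, hk, inferInstance, this, classifyingData hsub.isSubmersionAt hk hrk, hsub,
    isClassifyingRealization hsub.isSubmersionAt hk hrk
      (isRealization_classifyingData hsub.isSubmersionAt hk hrk)⟩

lemma log_orbitVolume_mem_closedInvariant (horb : ∀ p, θ.orbitTangent p = θ.classifyingKernel p)
    (hsmooth : SmoothForm μG) (hinv : θ.IsInvariantForm μG) (hvol : θ.IsOrbitVolume μG)
    (ξ : Module.Basis (Fin k) ℝ θ.symmetryAlgebra) :
    differential (n := n) (fun q => Real.log |μG q fun j => (ξ j).1 q|) ∈ θ.closedInvariant := by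
  obtain ⟨d, hk, _, _, D, -, h⟩ := exists_classifyingRealization horb hvol ξ
  exact h.differential_log_orbitVolume_mem (finSumFinEquiv.trans (finCongr hk)) horb hsmooth hinv
    hvol ξ

lemma isModularClass_neg (horb : ∀ p, θ.orbitTangent p = θ.classifyingKernel p)
    (hsmooth : SmoothForm μG) (hinv : θ.IsInvariantForm μG) (hvol : θ.IsOrbitVolume μG)
    (ξ : Module.Basis (Fin k) ℝ θ.symmetryAlgebra) :
    θ.IsModularClass (-θ.cohomologyClass _
      (log_orbitVolume_mem_closedInvariant horb hsmooth hinv hvol ξ)) := by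
  obtain ⟨d, hk, _, _, D, hsub, h⟩ := exists_classifyingRealization horb hvol ξ
  obtain ⟨ν, c, hν, hc, he⟩ := h.exists_modularCocycle (finSumFinEquiv.trans (finCongr hk)) horb
    hsmooth hinv hvol ξ
  have hm := θ.closedInvariant.neg_mem
    (log_orbitVolume_mem_closedInvariant horb hsmooth hinv hvol ξ)
  rw [← he] at hm
  refine ⟨d, _, _, D, hsub, h.realization, Or.inl ⟨ν, c, hν, hc, hm, ?_⟩⟩
  exact congrArg (Submodule.Quotient.mk (p := θ.exactInvariant)) (Subtype.ext he.symm)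

lemma IsModularClass.eq_neg (horb : ∀ p, θ.orbitTangent p = θ.classifyingKernel p)
    (hsmooth : SmoothForm μG) (hinv : θ.IsInvariantForm μG) (hvol : θ.IsOrbitVolume μG)
    (ξ : Module.Basis (Fin k) ℝ θ.symmetryAlgebra) {m : θ.H1} (hm : θ.IsModularClass m) :
    m = -θ.cohomologyClass _
      (log_orbitVolume_mem_closedInvariant horb hsmooth hinv hvol ξ) := by
  -- For empty M the dimension of the classifying space is not determined, but the cohomology is
  -- trivial.
  rcases isEmpty_or_nonempty M with hM | hM
  · have h1 : Subsingleton θ.closedInvariant :=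
      ⟨fun a b => Subtype.ext (funext fun p => (hM.false p).elim)⟩
    have h2 : Subsingleton θ.H1 := Quotient.instSubsingletonQuotient _
    exact Subsingleton.elim _ _
  obtain ⟨d, _, _, D, hsub, hD, hm⟩ := hm
  have hk₀ : k + (n - k) = n := Nat.add_sub_cancel' (hvol.card_le ξ)
  have hrk : ∀ p, Module.finrank ℝ (θ.classifyingKernel p) = k := fun p => by
    rw [← horb, hvol.finrank_orbitTangent ξ]
  have h := isClassifyingRealization hsub.isSubmersionAt hk₀ hrk hD
  have hk : k + d = n := dimension_classifyingSpace hsub.isSubmersionAt hk₀ hrk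
  -- A reference section is built over the very structure used by the given class, so only sections
  -- over one structure have to be compared.
  obtain ⟨ν, c, hν, hc, he⟩ := h.exists_modularCocycle (finSumFinEquiv.trans (finCongr hk)) horb
    hsmooth hinv hvol ξ
  obtain ⟨ν', c', hν', hc', hm', rfl⟩ | ⟨hno, -⟩ := hm
  · obtain ⟨φ, hφ, hφe⟩ := h.pullbackForm_sub_exact hν hν' hc hc'
    refine (Submodule.Quotient.eq θ.exactInvariant).2 ⟨φ, hφ, fun p => ?_⟩
    change θ.pullbackForm θ.classifyingMap c' p - (-differential _) p = _
    rw [hφe, he]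
    exact add_sub_cancel_left _ _
  -- The reference section excludes the alternative using the square of the line bundle.
  · exact (hno ⟨ν, hν⟩).elim

lemma modularClass_eq_neg (horb : ∀ p, θ.orbitTangent p = θ.classifyingKernel p)
    (hsmooth : SmoothForm μG) (hinv : θ.IsInvariantForm μG) (hvol : θ.IsOrbitVolume μG)
    (ξ : Module.Basis (Fin k) ℝ θ.symmetryAlgebra) :
    θ.modularClass = -θ.cohomologyClass _
      (log_orbitVolume_mem_closedInvariant horb hsmooth hinv hvol ξ) := by
  have h : ∃ m, θ.IsModularClass m := ⟨_, isModularClass_neg horb hsmooth hinv hvol ξ⟩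
  rw [modularClass, dif_pos h]
  exact h.choose_spec.eq_neg horb hsmooth hinv hvol ξ

lemma modularClass_eq_zero_iff (horb : ∀ p, θ.orbitTangent p = θ.classifyingKernel p)
    (hsmooth : SmoothForm μG) (hinv : θ.IsInvariantForm μG) (hvol : θ.IsOrbitVolume μG)
    (ξ : Module.Basis (Fin k) ℝ θ.symmetryAlgebra) :
    θ.modularClass = 0 ↔ ∃ f ∈ θ.Inv,
      differential (n := n) (fun q => Real.log |μG q fun j => (ξ j).1 q|) = differential f := by
  rw [modularClass_eq_neg horb hsmooth hinv hvol ξ, neg_eq_zero, cohomologyClass_eq_zero_iff]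

end Coframe

end CoframeGeometry

end

theorem mainTheorem12 {n k : ℕ} {M : Type*} [TopologicalSpace M]
    [ChartedSpace (EuclideanSpace ℝ (Fin n)) M] [IsManifold (𝓡 n) ∞ M]
    [T2Space M] [SecondCountableTopology M]
    (θ : CoframeGeometry.Coframe n M) (_hreg : θ.FullyRegular)
    (ξ : Module.Basis (Fin k) ℝ θ.symmetryAlgebra)
    (_horb : ∀ p, θ.orbitTangent p = θ.classifyingKernel p)
    (μG : ∀ p : M, TangentSpace (𝓡 n) p [⋀^Fin k]→L[ℝ] ℝ)
    (_hsmooth : CoframeGeometry.SmoothForm μG) (_hinv : θ.IsInvariantForm μG)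
    (_hvol : ∀ p, ∃ v : Fin k → TangentSpace (𝓡 n) p,
      (∀ j, v j ∈ θ.orbitTangent p) ∧ μG p v ≠ 0) :
    (∀ m, θ.IsModularClass m ↔ m = θ.modularClass) ∧
    (∃ h : CoframeGeometry.differential
        (fun p => Real.log |μG p (fun j => (ξ j : ∀ p : M, TangentSpace (𝓡 n) p) p)|) ∈
          θ.closedInvariant,
      θ.modularClass = -θ.cohomologyClass _ h) ∧
    (θ.modularClass = 0 → θ.Unimodular) ∧
    ((∀ p q, θ.classifyingMap p = θ.classifyingMap q → θ.SameOrbit p q) →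
      (θ.Unimodular ↔ θ.modularClass = 0)) := by
  have heq := CoframeGeometry.Coframe.modularClass_eq_neg _horb _hsmooth _hinv _hvol ξ
  have h0 := CoframeGeometry.Coframe.modularClass_eq_zero_iff _horb _hsmooth _hinv _hvol ξ
  have h3 : θ.modularClass = 0 → θ.Unimodular := fun h => by
    obtain ⟨f, hf, he⟩ := h0.1 h
    exact CoframeGeometry.Coframe.unimodular_of_exact _horb _hsmooth _hinv _hvol ξ hf he
  refine ⟨fun m => ⟨fun hm => ?_, ?_⟩, ⟨_, heq⟩, h3, fun hfib => ⟨fun h => ?_, h3⟩⟩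
  · rw [heq]
    exact hm.eq_neg _horb _hsmooth _hinv _hvol ξ
  · rintro rfl
    rw [heq]
    exact CoframeGeometry.Coframe.isModularClass_neg _horb _hsmooth _hinv _hvol ξ
  · exact h0.2 ⟨_, CoframeGeometry.Coframe.log_orbitVolume_mem_Inv _horb _hsmooth _hinv _hvol ξ
      hfib h, rfl⟩
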